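/- Let $k$ be an algebraically closed field of characteristic zero, $N$ a free abelian group of finite rank, $M=\mathrm{Hom}(N,\mathbb Z)$, and $T=\mathrm{Spec}\,k[M]$ the torus with cocharacter lattice $N$. Let $\Sigma$ be a smooth projective fan in $N_{\mathbb R}$: a finite collection of cones, closed under faces, any two meeting in a common face, each generated by a part of a $\mathbb Z$-basis of $N$, covering $N_{\mathbb R}$ and admitting a strictly convex piecewise linear support function. Let $X=X_\Sigma$ be the toric variety obtained by gluing the charts $U_\tau=\mathrm{Spec}\,k[\tau^\vee\cap M]$, $\tau\in\Sigma$. For $\sigma\in\Sigma$ let $N_\sigma\subseteq N$ be the sublattice spanned by the generators of $\sigma$, let $T^\sigma=\mathrm{Spec}\,k[\sigma^\perp\cap M]$ be the quotient torus with cocharacter lattice $N/N_\sigma$, and let $\Sigma^\sigma$ be the fan in $(N/N_\sigma)_{\mathbb R}$ consisting of the cones $\bar\tau=(\tau+\mathbb R\sigma)/\mathbb R\sigma$, for $\tau\in\Sigma$, $\tau\supseteq\sigma$. Let $D_\sigma^\circ\cong T^\sigma$ be the closed $T$-orbit in $U_\sigma$, embedded by the homomorphism $k[\sigma^\vee\cap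 M]\to k[\sigma^\perp\cap M]$ which is the identity on characters in $\sigma^\perp$ and maps the other characters to $0$, and let $D_\sigma$ be the closure of $D_\sigma^\circ$ in $X$. There is a canonical isomorphism $X_{\Sigma^\sigma}\cong D_\sigma$, given on the charts for $\tau\supseteq\sigma$ by the analogous homomorphisms $k[\tau^\vee\cap M]\to k[\sigma^\perp\cap\tau^\vee\cap M]$. Let $U^\sigma\subseteq X$ be the union of the $U_\tau$ with $\tau\supseteq\sigma$, and let $\mathrm{pr}\colon U^\sigma\to X_{\Sigma^\sigma}\cong D_\sigma$ be the smooth morphism extending $T\to T^\sigma$, given on charts by $k[\sigma^\perp\cap\tau^\vee\cap M]\subseteq k[\tau^\vee\cap M]$. Let $N'\subseteq N$ be a primitive sublattice (that is, $N/N'$ is torsion free), with corresponding subtorus $T'\subseteq T$, satisfying property (E) with respect to $\Sigma$: for every $\tau\in\Sigma$ the intersection $\tau\cap N'_{\mathbb R}$ is a face of $\tau$. Let $X'$ be the closure of $T'$ in $X$ (as a reduced closed subscheme), and let $\Sigma'=\{\tau\cap N'_{\mathbb R}:\tau\in\Sigma\}$ be the induced fan in $N'_{\mathbb R}$. Let $\sigma\in\Sigma$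 with $\sigma\subset N'_{\mathbb R}$; then $\sigma\in\Sigma'$, and it determines a fan $\Sigma'^\sigma$ in $(N'/N_\sigma)_{\mathbb R}$. Then, all intersections and preimages being scheme-theoretic: 1. $N'/N_\sigma\subseteq N/N_\sigma$ is a primitive sublattice, and the intersection of $X'$ with $D_\sigma^\circ\cong T^\sigma$ is the subtorus $T'^\sigma\subseteq T^\sigma$ associated with $N'/N_\sigma$. 2. $T'^\sigma\subseteq T^\sigma$ satisfies property (E) with respect to $\Sigma^\sigma$, and the intersection of $X'$ with $D_\sigma\cong X_{\Sigma^\sigma}$ is $X_{\Sigma'^\sigma}$, embedded in $X_{\Sigma^\sigma}$ by the toric morphism of the inclusion $N'/N_\sigma\subseteq N/N_\sigma$. 3. $X'\cap U^\sigma$ is the preimage of $X_{\Sigma'^\sigma}$ under the smooth morphism $\mathrm{pr}\colon U^\sigma\to X_{\Sigma^\sigma}$. -/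

import Mathlib

open CategoryTheory CategoryTheory.Limits AlgebraicGeometry TensorProduct

universe u

namespace ToricGeometry

noncomputable section

/-! ### Lattices, cones and fans -/

variable {N : Type u} [AddCommGroup N]

/-- The real extension `m_ℝ : N_ℝ → ℝ` of an integral functional `m ∈ M = Hom(N, ℤ)`. -/
def realEval (m : Module.Dual ℤ N) : Module.Dual ℝ (ℝ ⊗[ℤ] N) :=
  Module.Dual.baseChange ℝ m

@[simp] lemma realEval_tmul (m : Module.Dual ℤ N) (r : ℝ) (n : N) :
    realEval m (r ⊗ₜ n) = r * m n := by
  simp [realEval, mul_comm]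

lemma realEval_add (m m' : Module.Dual ℤ N) (v : ℝ ⊗[ℤ] N) :
    realEval (m + m') v = realEval m v + realEval m' v := by
  simp [realEval]

lemma realEval_zero (v : ℝ ⊗[ℤ] N) : realEval (0 : Module.Dual ℤ N) v = 0 := by
  simp [realEval]

lemma realEval_neg (m : Module.Dual ℤ N) (v : ℝ ⊗[ℤ] N) :
    realEval (-m) v = - realEval m v := by
  have := realEval_add m (-m) v
  rw [add_neg_cancel, realEval_zero] at this
  linarith

lemma realEval_comp {N₂ : Type u} [AddCommGroup N₂] (f : N →ₗ[ℤ] N₂) (m : Module.Dual ℤ N₂)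
    (v : ℝ ⊗[ℤ] N) : realEval (m ∘ₗ f) v = realEval m (f.baseChange ℝ v) := by
  induction v with
  | zero => simp
  | tmul r n => simp
  | add x y hx hy => simp [hx, hy]

/-- A cone in `N_ℝ` is smooth if it is generated by a part of a `ℤ`-basis of `N`. Such a cone is
simplicial, rational polyhedral and strongly convex. -/
def IsSmoothCone (σ : PointedCone ℝ (ℝ ⊗[ℤ] N)) : Prop :=
  ∃ (n : ℕ) (b : Module.Basis (Fin n) ℤ N) (s : Set (Fin n)),
    σ = PointedCone.hull ℝ ((fun i => (1 : ℝ) ⊗ₜ[ℤ] b i) '' s)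

lemma mem_hull_basis {ι : Type*} [Fintype ι] (b : Module.Basis ι ℤ N) (s : Set ι)
    (v : ℝ ⊗[ℤ] N) :
    v ∈ PointedCone.hull ℝ ((fun i => (1 : ℝ) ⊗ₜ[ℤ] b i) '' s) ↔
      (∀ i, 0 ≤ (b.baseChange ℝ).repr v i) ∧ ∀ i, i ∉ s → (b.baseChange ℝ).repr v i = 0 := by
  classical
  constructor
  · intro h
    induction h using Submodule.span_induction with
    | mem x hx =>
      obtain ⟨i, hi, rfl⟩ := hx
      have : (1 : ℝ) ⊗ₜ[ℤ] b i = b.baseChange ℝ i := by simp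
      simp only [this, Module.Basis.repr_self]
      refine ⟨fun j => ?_, fun j hj => ?_⟩
      · rw [Finsupp.single_apply]; split_ifs <;> simp
      · rw [Finsupp.single_apply, if_neg (by rintro rfl; exact hj hi)]
    | zero => simp
    | add x y _ _ hx hy =>
      refine ⟨fun i => ?_, fun i hi => ?_⟩
      · simpa using add_nonneg (hx.1 i) (hy.1 i)
      · simp [hx.2 i hi, hy.2 i hi]
    | smul a x _ hx =>
      have : ∀ i, (b.baseChange ℝ).repr (a • x) i = (a : ℝ) * (b.baseChange ℝ).repr x i := by
        intro i
        change (b.baseChange ℝ).repr ((a : ℝ) • x) i = _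
        rw [map_smul, Finsupp.smul_apply, smul_eq_mul]
      refine ⟨fun i => ?_, fun i hi => ?_⟩
      · rw [this]; exact mul_nonneg a.2 (hx.1 i)
      · rw [this, hx.2 i hi, mul_zero]
  · rintro ⟨h0, h1⟩
    rw [← (b.baseChange ℝ).sum_repr v]
    refine Submodule.sum_mem _ fun i _ => ?_
    by_cases hi : i ∈ s
    · refine PointedCone.smul_mem _ (h0 i) (Submodule.subset_span ⟨i, hi, by simp⟩)
    · rw [h1 i hi, zero_smul]; exact zero_mem _

lemma repr_tmul {ι : Type*} (b : Module.Basis ι ℤ N) (n : N) (i : ι) :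
    (b.baseChange ℝ).repr ((1 : ℝ) ⊗ₜ[ℤ] n) i = b.repr n i := by
  simp [Module.Basis.baseChange_repr_tmul]

lemma realEval_eq_sum {ι : Type*} [Fintype ι] (b : Module.Basis ι ℤ N) (m : Module.Dual ℤ N)
    (v : ℝ ⊗[ℤ] N) : realEval m v = ∑ i, (b.baseChange ℝ).repr v i * m (b i) := by
  conv_lhs => rw [← (b.baseChange ℝ).sum_repr v]
  simp

/-- A generating set of a smooth cone coming from a basis indexed by any finite type. -/
lemma IsSmoothCone.of_basis {ι : Type*} [Finite ι] (b : Module.Basis ι ℤ N) (s : Set ι) :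
    IsSmoothCone (PointedCone.hull ℝ ((fun i => (1 : ℝ) ⊗ₜ[ℤ] b i) '' s)) := by
  obtain ⟨n, ⟨e⟩⟩ := Finite.exists_equiv_fin ι
  refine ⟨n, b.reindex e, e '' s, ?_⟩
  rw [Set.image_image]
  simp

/-- A face of a smooth cone is cut out by an integral functional in the dual cone. -/
lemma IsSmoothCone.exists_face {σ F : PointedCone ℝ (ℝ ⊗[ℤ] N)} (hσ : IsSmoothCone σ)
    (hF : F.IsFaceOf σ) : ∃ m : Module.Dual ℤ N, (∀ v ∈ σ, 0 ≤ realEval m v) ∧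
      ∀ v, v ∈ F ↔ v ∈ σ ∧ realEval m v = 0 := by
  classical
  obtain ⟨n, b, s, rfl⟩ := hσ
  let m : Module.Dual ℤ N := b.constr ℤ fun i => if (1 : ℝ) ⊗ₜ[ℤ] b i ∈ F then (0 : ℤ) else 1
  have hm : ∀ i, m (b i) = if (1 : ℝ) ⊗ₜ[ℤ] b i ∈ F then (0 : ℤ) else 1 := fun i => by
    simp only [m, Module.Basis.constr_basis]
  have hnn : ∀ v ∈ PointedCone.hull ℝ ((fun i => (1 : ℝ) ⊗ₜ[ℤ] b i) '' s), ∀ i,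
      0 ≤ (b.baseChange ℝ).repr v i * (m (b i) : ℝ) := by
    intro v hv i
    rw [mem_hull_basis] at hv
    refine mul_nonneg (hv.1 i) ?_
    rw [hm]; split_ifs <;> simp
  refine ⟨m, fun v hv => ?_, fun v => ⟨fun hv => ⟨hF.le hv, ?_⟩, ?_⟩⟩
  · rw [realEval_eq_sum b]
    exact Finset.sum_nonneg fun i _ => hnn v hv i
  · rw [realEval_eq_sum b]
    refine Finset.sum_eq_zero fun i _ => ?_
    have hvσ := (mem_hull_basis b s v).1 (hF.le hv)
    by_cases hc : (b.baseChange ℝ).repr v i = 0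
    · simp [hc]
    have his : i ∈ s := by by_contra h; exact hc (hvσ.2 i h)
    have : (1 : ℝ) ⊗ₜ[ℤ] b i ∈ F := by
      have key := hF.mem_of_sum_smul_mem (ι := s) (f := fun j => (1 : ℝ) ⊗ₜ[ℤ] b j)
        (c := fun j => (b.baseChange ℝ).repr v j) (fun j => Submodule.subset_span ⟨j, j.2, rfl⟩)
        (fun j => hvσ.1 j) ?_ ⟨i, his⟩ (lt_of_le_of_ne (hvσ.1 i) (Ne.symm hc))
      · exact key
      · convert hv
        conv_rhs => rw [← (b.baseChange ℝ).sum_repr v]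
        rw [← Finset.sum_subset (Finset.subset_univ s.toFinset)
          (fun j _ hj => by rw [hvσ.2 j (by simpa using hj), zero_smul])]
        rw [← Finset.sum_coe_sort s.toFinset]
        refine Fintype.sum_equiv (Equiv.subtypeEquivRight (by simp)) _ _ (fun j => ?_)
        simp
    rw [hm, if_pos this]; simp
  · rintro ⟨hv, h0⟩
    rw [realEval_eq_sum b, Finset.sum_eq_zero_iff_of_nonneg (fun i _ => hnn v hv i)] at h0
    rw [← (b.baseChange ℝ).sum_repr v]
    refine Submodule.sum_mem _ fun i _ => ?_
    have h := h0 i (Finset.mem_univ i)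
    rw [hm] at h
    split_ifs at h with hi
    · refine PointedCone.smul_mem _ (((mem_hull_basis b s v).1 hv).1 i) ?_
      simpa using hi
    · have : (b.baseChange ℝ).repr v i = 0 := by simpa using h
      rw [this, zero_smul]; exact zero_mem _

lemma IsSmoothCone.exists_nsmul {σ : PointedCone ℝ (ℝ ⊗[ℤ] N)} (hσ : IsSmoothCone σ)
    {m u : Module.Dual ℤ N} (hm : ∀ v ∈ σ, 0 ≤ realEval m v)
    (hu : ∀ v ∈ σ, realEval m v = 0 → 0 ≤ realEval u v) :
    ∃ n : ℕ, ∀ v ∈ σ, 0 ≤ realEval (u + n • m) v := by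
  classical
  obtain ⟨d, b, s, rfl⟩ := hσ
  have hb : ∀ i ∈ s, (1 : ℝ) ⊗ₜ[ℤ] b i ∈ PointedCone.hull ℝ ((fun i => (1 : ℝ) ⊗ₜ[ℤ] b i) '' s) :=
    fun i hi => Submodule.subset_span ⟨i, hi, rfl⟩
  refine ⟨∑ i, (u (b i)).natAbs, fun v hv => ?_⟩
  rw [realEval_eq_sum b]
  have hv' := (mem_hull_basis b s v).1 hv
  refine Finset.sum_nonneg fun i _ => ?_
  by_cases hi : i ∈ s
  · refine mul_nonneg (hv'.1 i) ?_
    have h0 : 0 ≤ m (b i) := by have := hm _ (hb i hi); simpa using this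
    have h1 : m (b i) = 0 → 0 ≤ u (b i) := by
      have := hu _ (hb i hi); simpa using this
    have h2 : (u (b i)).natAbs ≤ ∑ i, (u (b i)).natAbs :=
      Finset.single_le_sum (f := fun i => (u (b i)).natAbs) (fun _ _ => Nat.zero_le _)
        (Finset.mem_univ i)
    generalize (∑ i, (u (b i)).natAbs) = k at h2
    have : 0 ≤ u (b i) + k * m (b i) := by
      rcases h0.eq_or_lt with h | h
      · rw [← h]; simpa using h1 h.symm
      · have : (k : ℤ) ≤ k * m (b i) := by nlinarith
        omega
    have h3 : (u + k • m) (b i) = u (b i) + k * m (b i) := by simp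
    rw [h3]; exact_mod_cast this
  · rw [hv'.2 i hi, zero_mul]

/-- A fan of smooth cones in `N_ℝ`: a finite nonempty collection of cones, each generated by a part
of a `ℤ`-basis of `N`, closed under passing to faces, in which any two cones meet in a common
face. -/
structure SmoothFan (N : Type u) [AddCommGroup N] where
  /-- the cones of the fan -/
  cones : Set (PointedCone ℝ (ℝ ⊗[ℤ] N))
  finite : cones.Finite
  nonempty : cones.Nonempty
  smooth : ∀ σ ∈ cones, IsSmoothCone σ
  face_mem : ∀ σ ∈ cones, ∀ F : PointedCone ℝ (ℝ ⊗[ℤ] N), F.IsFaceOf σ → F ∈ cones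
  inf_isFaceOf : ∀ σ ∈ cones, ∀ τ ∈ cones, (σ ⊓ τ).IsFaceOf σ

/-- A fan is complete if its cones cover `N_ℝ`. -/
def SmoothFan.IsComplete (S : SmoothFan N) : Prop :=
  ∀ v : ℝ ⊗[ℤ] N, ∃ σ ∈ S.cones, v ∈ σ

/-- A (complete) fan is projective if it admits a strictly convex piecewise linear support function:
a convex function `φ` on `N_ℝ` that on each maximal cone `σ` agrees with a linear function `ℓ`,
with `ℓ ≤ φ` everywhere and equality exactly on `σ`. -/
def SmoothFan.IsProjective (S : SmoothFan N) : Prop :=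
  ∃ φ : (ℝ ⊗[ℤ] N) → ℝ, ConvexOn ℝ Set.univ φ ∧
    ∀ σ, Maximal (· ∈ S.cones) σ → ∃ ℓ : Module.Dual ℝ (ℝ ⊗[ℤ] N),
      ∀ v, ℓ v ≤ φ v ∧ (ℓ v = φ v ↔ v ∈ σ)

/-- A sublattice `L ⊆ N` is primitive if `N / L` is torsion free. -/
def IsPrimitive (L : Submodule ℤ N) : Prop :=
  ∀ (a : ℤ) (n : N), a ≠ 0 → a • n ∈ L → n ∈ L

/-- The real subspace `L_ℝ ⊆ N_ℝ` spanned by a sublattice `L ⊆ N`. -/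
def realSpan (L : Submodule ℤ N) : Submodule ℝ (ℝ ⊗[ℤ] N) :=
  LinearMap.range (L.subtype.baseChange ℝ)

/-- Property (E) of the subtorus with cocharacter lattice `L`, with respect to the fan `S`:
`σ ∩ L_ℝ` is a face of `σ`, for all `σ ∈ S`. -/
def PropertyE (S : SmoothFan N) (L : Submodule ℤ N) : Prop :=
  ∀ σ ∈ S.cones, (σ ⊓ PointedCone.ofSubmodule (realSpan L)).IsFaceOf σ

lemma SmoothFan.inf_mem (S : SmoothFan N) {σ τ : PointedCone ℝ (ℝ ⊗[ℤ] N)} (hσ : σ ∈ S.cones)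
    (hτ : τ ∈ S.cones) : σ ⊓ τ ∈ S.cones :=
  S.face_mem σ hσ _ (S.inf_isFaceOf σ hσ τ hτ)

lemma SmoothFan.isFaceOf_of_le (S : SmoothFan N) {σ τ : PointedCone ℝ (ℝ ⊗[ℤ] N)}
    (hσ : σ ∈ S.cones) (hτ : τ ∈ S.cones) (h : σ ≤ τ) : σ.IsFaceOf τ := by
  have := S.inf_isFaceOf τ hτ σ hσ
  rwa [inf_eq_right.2 h] at this

lemma IsSmoothCone.bot_isFaceOf {σ : PointedCone ℝ (ℝ ⊗[ℤ] N)} (hσ : IsSmoothCone σ) :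
    (⊥ : PointedCone ℝ (ℝ ⊗[ℤ] N)).IsFaceOf σ := by
  obtain ⟨n, b, s, rfl⟩ := hσ
  refine ⟨bot_le, fun {x y a} hx hy ha h => ?_⟩
  rw [mem_hull_basis] at hx hy
  rw [Submodule.mem_bot] at h ⊢
  refine (b.baseChange ℝ).ext_elem fun i => ?_
  have h' : (b.baseChange ℝ).repr (a • x + y) i = 0 := by rw [h]; simp
  rw [map_add, map_smul, Finsupp.add_apply, Finsupp.smul_apply, smul_eq_mul] at h'
  have h1 := hx.1 i
  have h2 := hy.1 i
  have h3 := mul_nonneg ha.le h1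
  have h4 : a * (b.baseChange ℝ).repr x i = 0 := by linarith
  rcases mul_eq_zero.1 h4 with h5 | h5
  · exact absurd h5 ha.ne'
  · simpa using h5

lemma SmoothFan.bot_mem (S : SmoothFan N) : (⊥ : PointedCone ℝ (ℝ ⊗[ℤ] N)) ∈ S.cones := by
  obtain ⟨σ, hσ⟩ := S.nonempty
  exact S.face_mem σ hσ _ (S.smooth σ hσ).bot_isFaceOf

lemma IsSmoothCone.finite {σ : PointedCone ℝ (ℝ ⊗[ℤ] N)} (hσ : IsSmoothCone σ) :
    Module.Finite ℤ N := by
  obtain ⟨n, b, s, rfl⟩ := hσ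
  exact Module.Finite.of_basis b

lemma baseChange_subtype_injective (L : Submodule ℤ N) :
    Function.Injective (L.subtype.baseChange ℝ) := by
  have := Module.Flat.lTensor_preserves_injective_linearMap (M := ℝ) L.subtype
    L.injective_subtype
  exact this

lemma isTorsionFree_quotient {L : Submodule ℤ N} (hL : IsPrimitive L) :
    Module.IsTorsionFree ℤ (N ⧸ L) := by
  refine Module.IsTorsionFree.of_smul_eq_zero ?_
  intro a x hx
  obtain ⟨n, rfl⟩ := L.mkQ_surjective x
  by_cases ha : a = 0
  · exact Or.inl ha
  · right
    rw [← map_smul, Submodule.mkQ_apply, Submodule.Quotient.mk_eq_zero] at hx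
    rw [Submodule.mkQ_apply, Submodule.Quotient.mk_eq_zero]
    exact hL a n ha hx

lemma mem_of_tmul_mem_realSpan [Module.Finite ℤ N] {L : Submodule ℤ N} (hL : IsPrimitive L) {n : N}
    (h : (1 : ℝ) ⊗ₜ[ℤ] n ∈ realSpan L) : n ∈ L := by
  obtain ⟨x, hx⟩ := h
  have := isTorsionFree_quotient hL
  have hfree : Module.Free ℤ (N ⧸ L) := inferInstance
  let b := Module.Free.chooseBasis ℤ (N ⧸ L)
  have h0 : (L.mkQ.baseChange ℝ) ((1 : ℝ) ⊗ₜ[ℤ] n) = 0 := by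
    rw [← hx, ← LinearMap.comp_apply, ← LinearMap.baseChange_comp]
    have : L.mkQ ∘ₗ L.subtype = 0 := by ext; simp
    rw [this]; simp
  rw [LinearMap.baseChange_tmul] at h0
  have h1 : L.mkQ n = 0 := by
    refine b.ext_elem fun i => ?_
    have := repr_tmul b (L.mkQ n) i
    rw [h0] at this
    simp only [map_zero, Finsupp.coe_zero, Pi.zero_apply] at this ⊢
    exact_mod_cast this.symm
  simpa using h1

/-- A linearly independent family spanning a primitive sublattice is a part of a basis. -/
lemma IsSmoothCone.of_linearIndependent [Module.Finite ℤ N] {ι : Type*} [Finite ι] (v : ι → N)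
    (hv : LinearIndependent ℤ v) (hp : IsPrimitive (Submodule.span ℤ (Set.range v))) :
    IsSmoothCone (PointedCone.hull ℝ (Set.range fun i => (1 : ℝ) ⊗ₜ[ℤ] v i)) := by
  have := isTorsionFree_quotient hp
  have hfree : Module.Free ℤ (N ⧸ Submodule.span ℤ (Set.range v)) := inferInstance
  let c := Module.Free.chooseBasis ℤ (N ⧸ Submodule.span ℤ (Set.range v))
  have hs := IsSmoothCone.of_basis (Module.Basis.sumQuot (Module.Basis.span hv) c)
    (Set.range Sum.inl)
  convert hs using 2
  rw [← Set.range_comp]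
  congr 1
  ext i
  simp [Module.Basis.span_apply]

/-- The cone `σ ∩ L_ℝ`, viewed in `L_ℝ = ℝ ⊗ L`. -/
def restrictCone (L : Submodule ℤ N) (σ : PointedCone ℝ (ℝ ⊗[ℤ] N)) : PointedCone ℝ (ℝ ⊗[ℤ] L) :=
  σ.comap (L.subtype.baseChange ℝ)

lemma map_restrictCone (L : Submodule ℤ N) (σ : PointedCone ℝ (ℝ ⊗[ℤ] N)) :
    (restrictCone L σ).map (L.subtype.baseChange ℝ) =
      σ ⊓ PointedCone.ofSubmodule (realSpan L) := by
  ext v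
  simp only [PointedCone.mem_map, restrictCone, PointedCone.mem_comap, Submodule.mem_inf,
    PointedCone.mem_ofSubmodule_iff, realSpan, LinearMap.mem_range]
  constructor
  · rintro ⟨x, hx, rfl⟩
    exact ⟨hx, x, rfl⟩
  · rintro ⟨hx, x, rfl⟩
    exact ⟨x, hx, rfl⟩

lemma restrictCone_inf_realSpan (L : Submodule ℤ N) (σ : PointedCone ℝ (ℝ ⊗[ℤ] N)) :
    restrictCone L (σ ⊓ PointedCone.ofSubmodule (realSpan L)) = restrictCone L σ := by
  ext v
  simp [restrictCone, realSpan]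

lemma IsSmoothCone.restrict {L : Submodule ℤ N} (hL : IsPrimitive L)
    {σ : PointedCone ℝ (ℝ ⊗[ℤ] N)} (hσ : IsSmoothCone σ)
    (h : σ ≤ PointedCone.ofSubmodule (realSpan L)) : IsSmoothCone (restrictCone L σ) := by
  have hfin := hσ.finite
  obtain ⟨n, b, s, rfl⟩ := hσ
  have hb : ∀ i : s, b i ∈ L := fun i =>
    mem_of_tmul_mem_realSpan hL (h (Submodule.subset_span ⟨i, i.2, rfl⟩))
  let v : s → L := fun i => ⟨b i, hb i⟩
  have hv : LinearIndependent ℤ v := by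
    refine LinearIndependent.of_comp L.subtype ?_
    exact b.linearIndependent.comp _ Subtype.val_injective
  have hmem : ∀ x : L, x ∈ Submodule.span ℤ (Set.range v) ↔ ∀ i ∉ s, b.repr x i = 0 := by
    intro x
    have h1 : x ∈ Submodule.span ℤ (Set.range v) ↔ (x : N) ∈ Submodule.span ℤ (b '' s) := by
      have h2 : Submodule.span ℤ (b '' s) = (Submodule.span ℤ (Set.range v)).map L.subtype := by
        rw [Submodule.map_span, ← Set.range_comp, Set.image_eq_range]
        rfl
      rw [h2]
      exact (Function.Injective.mem_set_image L.injective_subtype).symm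
    rw [h1, b.mem_span_image]
    constructor
    · intro hx i hi
      by_contra hne
      exact hi (hx (by simpa using hne))
    · intro hx i hi
      by_contra hne
      exact (by simpa using hi : b.repr x i ≠ 0) (hx i hne)
  have hp : IsPrimitive (Submodule.span ℤ (Set.range v)) := by
    intro a x ha hx
    rw [hmem] at hx ⊢
    intro i hi
    have := hx i hi
    simpa [ha] using this
  have hs := IsSmoothCone.of_linearIndependent v hv hp
  convert hs using 1
  have hinj := baseChange_subtype_injective L
  have hinj' := Submodule.map_injective_of_injective
    (f := (L.subtype.baseChange ℝ).restrictScalars {c : ℝ // 0 ≤ c}) hinj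
  refine hinj' ?_
  have h2 := map_restrictCone L (PointedCone.hull ℝ ((fun i => (1 : ℝ) ⊗ₜ[ℤ] b i) '' s))
  rw [inf_eq_left.2 h] at h2
  refine h2.trans ?_
  rw [Submodule.map_span, ← Set.range_comp, Set.image_eq_range]
  congr 2

/-- The fan `S'` induced by `S` in `L_ℝ`, given by intersecting the cones of `S` with `L_ℝ`, for a
primitive sublattice `L` with property (E). -/
def SmoothFan.induced (S : SmoothFan N) (L : Submodule ℤ N) (hL : IsPrimitive L)
    (hE : PropertyE S L) : SmoothFan L where
  cones := restrictCone L '' S.cones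
  finite := S.finite.image _
  nonempty := S.nonempty.image _
  smooth := by
    rintro _ ⟨σ, hσ, rfl⟩
    rw [← restrictCone_inf_realSpan]
    exact (S.smooth _ (S.face_mem σ hσ _ (hE σ hσ))).restrict hL inf_le_right
  face_mem := by
    rintro _ ⟨σ, hσ, rfl⟩ F hF
    have hinj := baseChange_subtype_injective L
    have h1 := hF.map (L.subtype.baseChange ℝ) hinj
    rw [map_restrictCone] at h1
    refine ⟨_, S.face_mem σ hσ _ (h1.trans (hE σ hσ)), ?_⟩
    ext v
    simp only [restrictCone, PointedCone.mem_comap, PointedCone.mem_map]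
    exact ⟨fun ⟨x, hx, hxv⟩ => hinj hxv ▸ hx, fun h => ⟨v, h, rfl⟩⟩
  inf_isFaceOf := by
    rintro _ ⟨σ, hσ, rfl⟩ _ ⟨τ, hτ, rfl⟩
    exact (S.inf_isFaceOf σ hσ τ hτ).comap (L.subtype.baseChange ℝ)

/-- The sublattice `N_σ ⊆ N` generated by the lattice points of `σ`; if `σ` is generated by a part
of a basis of `N`, this is the sublattice spanned by these generators. -/
def coneLattice (σ : PointedCone ℝ (ℝ ⊗[ℤ] N)) : Submodule ℤ N :=
  Submodule.span ℤ {n : N | (1 : ℝ) ⊗ₜ[ℤ] n ∈ σ}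

/-- The projection `N_ℝ → (N / N_σ)_ℝ`. -/
def coneProj (σ : PointedCone ℝ (ℝ ⊗[ℤ] N)) :
    (ℝ ⊗[ℤ] N) →ₗ[ℝ] (ℝ ⊗[ℤ] (N ⧸ coneLattice σ)) :=
  (coneLattice σ).mkQ.baseChange ℝ

/-- The cone `(τ + ℝσ) / ℝσ` in `(N / N_σ)_ℝ`. -/
def quotientCone (σ τ : PointedCone ℝ (ℝ ⊗[ℤ] N)) : PointedCone ℝ (ℝ ⊗[ℤ] (N ⧸ coneLattice σ)) :=
  τ.map (coneProj σ)

lemma mem_coneLattice {ι : Type*} [Fintype ι] (b : Module.Basis ι ℤ N) (s : Set ι) (n : N) :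
    n ∈ coneLattice (PointedCone.hull ℝ ((fun i => (1 : ℝ) ⊗ₜ[ℤ] b i) '' s)) ↔
      ∀ i, i ∉ s → b.repr n i = 0 := by
  constructor
  · intro h
    induction h using Submodule.span_induction with
    | mem x hx =>
      intro i hi
      have := ((mem_hull_basis b s _).1 hx).2 i hi
      rw [repr_tmul] at this
      exact_mod_cast this
    | zero => simp
    | add x y _ _ hx hy => intro i hi; simp [hx i hi, hy i hi]
    | smul a x _ hx => intro i hi; simp [hx i hi]
  · intro h
    rw [← b.sum_repr n]
    refine Submodule.sum_mem _ fun i _ => ?_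
    by_cases hi : i ∈ s
    · exact Submodule.smul_mem _ _ (Submodule.subset_span (Submodule.subset_span ⟨i, hi, rfl⟩))
    · rw [h i hi, zero_smul]; exact zero_mem _

lemma IsSmoothCone.coneProj_eq_zero {σ : PointedCone ℝ (ℝ ⊗[ℤ] N)} (hσ : IsSmoothCone σ)
    {v : ℝ ⊗[ℤ] N} (hv : v ∈ σ) : coneProj σ v = 0 := by
  obtain ⟨n, b, s, rfl⟩ := hσ
  set σ := PointedCone.hull ℝ ((fun i => (1 : ℝ) ⊗ₜ[ℤ] b i) '' s) with hσ
  rw [← (b.baseChange ℝ).sum_repr v, map_sum]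
  refine Finset.sum_eq_zero fun i _ => ?_
  by_cases hi : i ∈ s
  · have : (coneLattice σ).mkQ (b i) = 0 := by
      rw [Submodule.mkQ_apply, Submodule.Quotient.mk_eq_zero]
      exact Submodule.subset_span (Submodule.subset_span ⟨i, hi, rfl⟩)
    rw [map_smul, Module.Basis.baseChange_apply, coneProj, LinearMap.baseChange_tmul, this,
      tmul_zero, smul_zero]
  · rw [((mem_hull_basis b s v).1 hv).2 i hi, zero_smul, map_zero]

/-- The kernel of `N_ℝ → (N / N_σ)_ℝ` consists of differences of elements of `σ`. -/
lemma exists_of_coneProj_eq {σ : PointedCone ℝ (ℝ ⊗[ℤ] N)} {v w : ℝ ⊗[ℤ] N}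
    (h : coneProj σ v = coneProj σ w) : ∃ a ∈ σ, ∃ b ∈ σ, v + a = w + b := by
  have h0 : coneProj σ (v - w) = 0 := by rw [map_sub, h, sub_self]
  have hex := lTensor_exact ℝ (f := (coneLattice σ).subtype) (g := (coneLattice σ).mkQ)
    (LinearMap.exact_subtype_mkQ _) (Submodule.mkQ_surjective _)
  obtain ⟨x, hx⟩ := (hex (v - w)).1 h0
  suffices H : ∀ x : ℝ ⊗[ℤ] (coneLattice σ), ∃ a ∈ σ, ∃ b ∈ σ,
      LinearMap.lTensor ℝ (coneLattice σ).subtype x + a = b by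
    obtain ⟨a, ha, b, hb, hab⟩ := H x
    refine ⟨a, ha, b, hb, ?_⟩
    rw [hx] at hab
    rw [← hab]; abel
  intro x
  induction x with
  | zero => exact ⟨0, zero_mem _, 0, zero_mem _, by simp⟩
  | add x y hx hy =>
    obtain ⟨a, ha, b, hb, hab⟩ := hx
    obtain ⟨a', ha', b', hb', hab'⟩ := hy
    refine ⟨a + a', add_mem ha ha', b + b', add_mem hb hb', ?_⟩
    rw [map_add, ← hab, ← hab']; abel
  | tmul r n =>
    obtain ⟨n, hn⟩ := n
    simp only [LinearMap.lTensor_tmul, Submodule.subtype_apply]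
    have H1 : ∃ a ∈ σ, ∃ b ∈ σ, (1 : ℝ) ⊗ₜ[ℤ] n + a = b := by
      induction hn using Submodule.span_induction with
      | mem x hx => exact ⟨0, zero_mem _, _, hx, by simp⟩
      | zero => exact ⟨0, zero_mem _, 0, zero_mem _, by simp⟩
      | add x y _ _ hx hy =>
        obtain ⟨a, ha, b, hb, hab⟩ := hx
        obtain ⟨a', ha', b', hb', hab'⟩ := hy
        refine ⟨a + a', add_mem ha ha', b + b', add_mem hb hb', ?_⟩
        rw [tmul_add, ← hab, ← hab']; abel
      | smul c x _ hx =>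
        obtain ⟨a, ha, b, hb, hab⟩ := hx
        rcases le_total 0 c with hc | hc
        · refine ⟨(c : ℝ) • a, PointedCone.smul_mem _ (by exact_mod_cast hc) ha,
            (c : ℝ) • b, PointedCone.smul_mem _ (by exact_mod_cast hc) hb, ?_⟩
          rw [← hab, smul_add, tmul_smul, Int.cast_smul_eq_zsmul ℝ c ((1 : ℝ) ⊗ₜ[ℤ] x)]
        · refine ⟨(-c : ℝ) • b, PointedCone.smul_mem _ (by exact_mod_cast neg_nonneg.2 hc) hb,
            (-c : ℝ) • a, PointedCone.smul_mem _ (by exact_mod_cast neg_nonneg.2 hc) ha, ?_⟩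
          rw [← hab, smul_add, tmul_smul, neg_smul, Int.cast_smul_eq_zsmul ℝ c ((1 : ℝ) ⊗ₜ[ℤ] x)]
          abel
    obtain ⟨a, ha, b, hb, hab⟩ := H1
    have hr : r ⊗ₜ[ℤ] n = r • ((1 : ℝ) ⊗ₜ[ℤ] n) := by rw [smul_tmul']; simp
    rcases le_total 0 r with hc | hc
    · refine ⟨r • a, PointedCone.smul_mem _ hc ha, r • b, PointedCone.smul_mem _ hc hb, ?_⟩
      rw [← hab, smul_add, hr]
    · refine ⟨(-r) • b, PointedCone.smul_mem _ (neg_nonneg.2 hc) hb,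
        (-r) • a, PointedCone.smul_mem _ (neg_nonneg.2 hc) ha, ?_⟩
      rw [← hab, smul_add, hr, neg_smul]
      abel

lemma IsSmoothCone.isPrimitive {σ : PointedCone ℝ (ℝ ⊗[ℤ] N)} (hσ : IsSmoothCone σ) :
    IsPrimitive (coneLattice σ) := by
  obtain ⟨n, b, s, rfl⟩ := hσ
  intro a x ha hx
  rw [mem_coneLattice] at hx ⊢
  intro i hi
  have := hx i hi
  simpa [ha] using this

lemma eq_hull_of_isFaceOf {ι : Type*} [Fintype ι] (b : Module.Basis ι ℤ N) (t : Set ι)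
    {σ : PointedCone ℝ (ℝ ⊗[ℤ] N)}
    (h : σ.IsFaceOf (PointedCone.hull ℝ ((fun i => (1 : ℝ) ⊗ₜ[ℤ] b i) '' t))) :
    σ = PointedCone.hull ℝ
      ((fun i => (1 : ℝ) ⊗ₜ[ℤ] b i) '' {i | i ∈ t ∧ (1 : ℝ) ⊗ₜ[ℤ] b i ∈ σ}) := by
  obtain ⟨m, hm, hmσ⟩ := (IsSmoothCone.of_basis b t).exists_face h
  refine le_antisymm (fun v hv => ?_) (Submodule.span_le.2 ?_)
  · obtain ⟨hvt, hv0⟩ := (hmσ v).1 hv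
    rw [mem_hull_basis] at hvt ⊢
    refine ⟨hvt.1, fun i hi => ?_⟩
    by_cases hit : i ∈ t
    · have hbt : (1 : ℝ) ⊗ₜ[ℤ] b i ∈ PointedCone.hull ℝ ((fun i => (1 : ℝ) ⊗ₜ[ℤ] b i) '' t) :=
        Submodule.subset_span ⟨i, hit, rfl⟩
      have hne : (m (b i) : ℝ) ≠ 0 := by
        intro h0
        refine hi ⟨hit, (hmσ _).2 ⟨hbt, ?_⟩⟩
        simp [h0]
      rw [realEval_eq_sum b, Finset.sum_eq_zero_iff_of_nonneg] at hv0
      · exact (mul_eq_zero.1 (hv0 i (Finset.mem_univ i))).resolve_right hne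
      · intro j _
        by_cases hjt : j ∈ t
        · refine mul_nonneg (hvt.1 j) ?_
          have := hm _ (Submodule.subset_span ⟨j, hjt, rfl⟩)
          simpa using this
        · rw [hvt.2 j hjt, zero_mul]
    · exact hvt.2 i hit
  · rintro _ ⟨i, hi, rfl⟩
    exact hi.2

lemma IsSmoothCone.quotient {σ τ : PointedCone ℝ (ℝ ⊗[ℤ] N)}
    (hτ : IsSmoothCone τ) (h : σ.IsFaceOf τ) : IsSmoothCone (quotientCone σ τ) := by
  classical
  have hfin := hτ.finite
  obtain ⟨n, b, t, rfl⟩ := hτ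
  set s : Set (Fin n) := {i | i ∈ t ∧ (1 : ℝ) ⊗ₜ[ℤ] b i ∈ σ} with hs
  have hσ := eq_hull_of_isFaceOf b t h
  rw [← hs] at hσ
  have hmem : ∀ x, x ∈ coneLattice σ ↔ ∀ i, i ∉ s → b.repr x i = 0 := by
    intro x
    rw [hσ]
    exact mem_coneLattice b s x
  clear_value s
  let v : (t \ s : Set (Fin n)) → N ⧸ coneLattice σ := fun i => (coneLattice σ).mkQ (b i)
  have hv : LinearIndependent ℤ v := by
    rw [Fintype.linearIndependent_iff]
    intro g hg i
    have h1 : ∑ i, g i • b i ∈ coneLattice σ := by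
      rw [← Submodule.Quotient.mk_eq_zero, ← Submodule.mkQ_apply, map_sum]
      simpa [v] using hg
    have h2 := (hmem _).1 h1 i i.2.2
    rw [map_sum, Finsupp.finsetSum_apply] at h2
    simpa [Finsupp.single_apply, Subtype.val_inj] using h2
  have hspan : ∀ x : N, (coneLattice σ).mkQ x ∈ Submodule.span ℤ (Set.range v) ↔
      ∀ i, i ∉ t → b.repr x i = 0 := by
    intro x
    constructor
    · intro hx i hi
      obtain ⟨c, hc⟩ := (Submodule.mem_span_range_iff_exists_fun ℤ).1 hx
      have h1 : x - ∑ j, c j • b j ∈ coneLattice σ := by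
        rw [← Submodule.Quotient.mk_eq_zero, ← Submodule.mkQ_apply, map_sub, ← hc, map_sum]
        simp [v]
      have his : i ∉ s := by
        intro h'
        rw [hs] at h'
        exact hi h'.1
      have h2 := (hmem _).1 h1 i his
      rw [map_sub, Finsupp.sub_apply, map_sum, Finsupp.finsetSum_apply, Finset.sum_eq_zero,
        sub_zero] at h2
      · exact h2
      · intro j _
        have : (j : Fin n) ≠ i := by
          rintro rfl
          exact hi j.2.1
        simp [this]
    · intro hx
      rw [← b.sum_repr x, map_sum]
      refine Submodule.sum_mem _ fun i _ => ?_
      by_cases hit : i ∈ t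
      · rw [map_smul]
        refine Submodule.smul_mem _ _ ?_
        by_cases his : i ∈ s
        · have : (coneLattice σ).mkQ (b i) = 0 := by
            rw [Submodule.mkQ_apply, Submodule.Quotient.mk_eq_zero, hmem]
            intro j hj
            have : i ≠ j := by
              rintro rfl
              exact hj his
            simp [this]
          rw [this]; exact zero_mem _
        · exact Submodule.subset_span ⟨⟨i, hit, his⟩, rfl⟩
      · rw [hx i hit, zero_smul, map_zero]; exact zero_mem _
  have hp : IsPrimitive (Submodule.span ℤ (Set.range v)) := by
    intro a x ha hx
    obtain ⟨x, rfl⟩ := (coneLattice σ).mkQ_surjective x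
    rw [← map_smul, hspan] at hx
    rw [hspan]
    intro i hi
    have := hx i hi
    simpa [ha] using this
  convert IsSmoothCone.of_linearIndependent v hv hp using 1
  refine le_antisymm ?_ (Submodule.span_le.2 ?_)
  · rw [quotientCone, PointedCone.map, Submodule.map_span, Submodule.span_le]
    rintro _ ⟨_, ⟨i, hi, rfl⟩, rfl⟩
    have h0 : (coneProj σ).restrictScalars {c : ℝ // 0 ≤ c} ((1 : ℝ) ⊗ₜ[ℤ] b i) =
        (1 : ℝ) ⊗ₜ[ℤ] (coneLattice σ).mkQ (b i) := rfl
    rw [h0]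
    by_cases his : i ∈ s
    · have : (coneLattice σ).mkQ (b i) = 0 := by
        rw [Submodule.mkQ_apply, Submodule.Quotient.mk_eq_zero, hmem]
        intro j hj
        have : i ≠ j := by
          rintro rfl
          exact hj his
        simp [this]
      rw [this, tmul_zero]; exact zero_mem _
    · exact Submodule.subset_span ⟨⟨i, hi, his⟩, rfl⟩
  · rintro _ ⟨i, rfl⟩
    exact ⟨(1 : ℝ) ⊗ₜ[ℤ] b i, Submodule.subset_span ⟨i, i.2.1, rfl⟩, rfl⟩

lemma quotientCone_le_iff (S : SmoothFan N) {σ τ τ' : PointedCone ℝ (ℝ ⊗[ℤ] N)}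
    (hτ : τ ∈ S.cones) (hτ' : τ' ∈ S.cones) (h : σ ≤ τ) (h' : σ ≤ τ') :
    quotientCone σ τ ≤ quotientCone σ τ' ↔ τ ≤ τ' := by
  refine ⟨fun hle v hv => ?_, fun hle => Submodule.map_mono hle⟩
  obtain ⟨w, hw, hwv⟩ := hle (⟨v, hv, rfl⟩ : coneProj σ v ∈ quotientCone σ τ)
  obtain ⟨a, ha, b, hb, hab⟩ := exists_of_coneProj_eq (σ := σ) (v := v) (w := w) hwv.symm
  have h1 : v + a ∈ τ ⊓ τ' := ⟨add_mem hv (h ha), hab ▸ add_mem hw (h' hb)⟩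
  exact ((S.inf_isFaceOf τ hτ τ' hτ').mem_of_add_mem_left hv (h ha) h1).2

/-- The fan `S^σ` in `(N / N_σ)_ℝ`, consisting of the cones `(τ + ℝσ) / ℝσ` for the cones
`τ ⊇ σ` of `S`. -/
def SmoothFan.star (S : SmoothFan N) (σ : PointedCone ℝ (ℝ ⊗[ℤ] N)) (hσ : σ ∈ S.cones) :
    SmoothFan (N ⧸ coneLattice σ) where
  cones := quotientCone σ '' {τ | τ ∈ S.cones ∧ σ ≤ τ}
  finite := (S.finite.subset fun _ h => h.1).image _
  nonempty := ⟨_, σ, ⟨hσ, le_rfl⟩, rfl⟩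
  smooth := by
    rintro _ ⟨τ, ⟨hτ, hle⟩, rfl⟩
    exact (S.smooth τ hτ).quotient (S.isFaceOf_of_le hσ hτ hle)
  face_mem := by
    rintro _ ⟨τ, ⟨hτ, hle⟩, rfl⟩ F hF
    have hface : (τ ⊓ F.comap (coneProj σ)).IsFaceOf τ := by
      refine ⟨inf_le_left, fun {x y a} hx hy ha h => ⟨hx, ?_⟩⟩
      have h2 : coneProj σ (a • x + y) ∈ F := h.2
      rw [map_add, map_smul] at h2
      exact hF.mem_of_smul_add_mem ⟨x, hx, rfl⟩ ⟨y, hy, rfl⟩ ha h2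
    refine ⟨_, ⟨S.face_mem τ hτ _ hface, le_inf hle fun v hv => ?_⟩, ?_⟩
    · rw [PointedCone.mem_comap, (S.smooth σ hσ).coneProj_eq_zero hv]
      exact zero_mem _
    · ext x
      constructor
      · rintro ⟨v, hv, rfl⟩
        exact hv.2
      · intro hx
        obtain ⟨v, hv, rfl⟩ := hF.le hx
        exact ⟨v, ⟨hv, hx⟩, rfl⟩
  inf_isFaceOf := by
    rintro _ ⟨τ, ⟨hτ, hle⟩, rfl⟩ _ ⟨τ', ⟨hτ', hle'⟩, rfl⟩
    have hf := S.inf_isFaceOf τ hτ τ' hτ'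
    refine ⟨inf_le_left, ?_⟩
    rintro x y a ⟨x, hx, rfl⟩ ⟨y, hy, rfl⟩ ha ⟨-, w, hw, hwv⟩
    have hwv' : coneProj σ (a • x + y) = coneProj σ w := by
      rw [map_add, map_smul]; exact hwv.symm
    obtain ⟨c, hc, d, hd, hcd⟩ := exists_of_coneProj_eq hwv'
    have hmem : a • x + (y + c) ∈ τ ⊓ τ' := by
      rw [← add_assoc]
      refine ⟨add_mem (add_mem (PointedCone.smul_mem _ ha.le hx) hy) (hle hc), ?_⟩
      rw [hcd]
      exact add_mem hw (hle' hd)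
    have hx' := hf.mem_of_smul_add_mem hx (add_mem hy (hle hc)) ha hmem
    exact ⟨⟨x, hx, rfl⟩, ⟨x, hx'.2, rfl⟩⟩


section Charts

variable (k : Type u) [Field k]

/-- The semigroup `σ^∨ ∩ M` of integral functionals that are nonnegative on `σ`. -/
def dualMonoid (σ : PointedCone ℝ (ℝ ⊗[ℤ] N)) : AddSubmonoid (Module.Dual ℤ N) where
  carrier := {m | ∀ v ∈ σ, 0 ≤ realEval m v}
  zero_mem' := fun v _ => (realEval_zero v).ge
  add_mem' := fun ha hb v hv => by
    rw [realEval_add]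
    exact add_nonneg (ha v hv) (hb v hv)

lemma mem_dualMonoid {σ : PointedCone ℝ (ℝ ⊗[ℤ] N)} {m : Module.Dual ℤ N} :
    m ∈ dualMonoid σ ↔ ∀ v ∈ σ, 0 ≤ realEval m v := Iff.rfl

lemma dualMonoid_anti {σ τ : PointedCone ℝ (ℝ ⊗[ℤ] N)} (h : σ ≤ τ) :
    dualMonoid τ ≤ dualMonoid σ := fun _ hm v hv => hm v (h hv)

/-- The inclusion `k[A] → k[B]` of semigroup rings for semigroups `A ⊆ B` of characters. -/
def inclHom {A B : AddSubmonoid (Module.Dual ℤ N)} (h : A ≤ B) :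
    AddMonoidAlgebra k A →+* AddMonoidAlgebra k B :=
  AddMonoidAlgebra.mapDomainRingHom k (AddSubmonoid.inclusion h)

/-- The affine toric variety `U_σ = Spec k[σ^∨ ∩ M]`. -/
abbrev affineChart (σ : PointedCone ℝ (ℝ ⊗[ℤ] N)) : Scheme.{u} :=
  Spec (.of (AddMonoidAlgebra k (dualMonoid σ)))

/-- The morphism `U_σ → U_τ` for `σ ⊆ τ`. -/
def chartMap {σ τ : PointedCone ℝ (ℝ ⊗[ℤ] N)} (h : σ ≤ τ) : affineChart k σ ⟶ affineChart k τ :=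
  Spec.map (CommRingCat.ofHom (inclHom k (dualMonoid_anti h)))

lemma inclHom_refl (A : AddSubmonoid (Module.Dual ℤ N)) :
    inclHom k (le_refl A) = RingHom.id _ := by
  refine AddMonoidAlgebra.ringHom_ext (fun r => ?_) (fun a => ?_)
  · simp [inclHom]
  · simp [inclHom]; rfl

lemma inclHom_comp {A B C : AddSubmonoid (Module.Dual ℤ N)} (h : A ≤ B) (h' : B ≤ C) :
    (inclHom k h').comp (inclHom k h) = inclHom k (h.trans h') := by
  refine AddMonoidAlgebra.ringHom_ext (fun r => ?_) (fun a => ?_)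
  · simp [inclHom]
  · simp [inclHom]; rfl

lemma chartMap_refl (σ : PointedCone ℝ (ℝ ⊗[ℤ] N)) : chartMap k (le_refl σ) = 𝟙 _ := by
  rw [chartMap, inclHom_refl]
  exact Spec.map_id _

lemma chartMap_comp {σ τ ω : PointedCone ℝ (ℝ ⊗[ℤ] N)} (h : σ ≤ τ) (h' : τ ≤ ω) :
    chartMap k h ≫ chartMap k h' = chartMap k (h.trans h') := by
  rw [chartMap, chartMap, chartMap, ← Spec.map_comp, ← CommRingCat.ofHom_comp, inclHom_comp]

lemma inclHom_injective {A B : AddSubmonoid (Module.Dual ℤ N)} (h : A ≤ B) :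
    Function.Injective (inclHom k h) :=
  AddMonoidAlgebra.mapDomain_injective (AddSubmonoid.inclusion_injective h)

/-- `k[B]` is the localization of `k[A]` at the character `m ∈ A` if `B = A + ℕ(-m)`. -/
lemma isLocalization_inclHom {A B : AddSubmonoid (Module.Dual ℤ N)} (h : A ≤ B)
    (m : Module.Dual ℤ N) (hm : m ∈ A) (hm' : -m ∈ B)
    (hB : ∀ u ∈ B, ∃ n : ℕ, u + n • m ∈ A) :
    letI := (inclHom k h).toAlgebra
    IsLocalization.Away (AddMonoidAlgebra.single (⟨m, hm⟩ : A) (1 : k)) (AddMonoidAlgebra k B) := by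
  let _ := (inclHom k h).toAlgebra
  have hx' : algebraMap (AddMonoidAlgebra k A) (AddMonoidAlgebra k B)
      (AddMonoidAlgebra.single (⟨m, hm⟩ : A) (1 : k)) =
      AddMonoidAlgebra.single (⟨m, h hm⟩ : B) (1 : k) := by
    change inclHom k h _ = _
    simp [inclHom]; rfl
  refine IsLocalization.Away.mk _ ?_ ?_ ?_
  · rw [hx']
    refine IsUnit.of_mul_eq_one (AddMonoidAlgebra.single (⟨-m, hm'⟩ : B) (1 : k)) ?_
    rw [AddMonoidAlgebra.single_mul_single, AddMonoidAlgebra.one_def]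
    congr 1
    · ext1; simp
    · simp
  · intro x
    rw [hx']
    induction x using AddMonoidAlgebra.induction_on with
    | of u =>
      obtain ⟨n, hn⟩ := hB u u.2
      refine ⟨n, AddMonoidAlgebra.single ⟨u + n • m, hn⟩ 1, ?_⟩
      change _ = inclHom k h _
      rw [AddMonoidAlgebra.single_pow, AddMonoidAlgebra.of_apply,
        AddMonoidAlgebra.single_mul_single, inclHom, AddMonoidAlgebra.mapDomainRingHom_apply,
        AddMonoidAlgebra.mapDomain_single]
      congr 1
      simp
    | add x y hx hy =>
      obtain ⟨n, a, ha⟩ := hx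
      obtain ⟨n', a', ha'⟩ := hy
      rw [← hx'] at ha ha' ⊢
      refine ⟨n + n', a * AddMonoidAlgebra.single (⟨m, hm⟩ : A) (1 : k) ^ n' +
        a' * AddMonoidAlgebra.single (⟨m, hm⟩ : A) (1 : k) ^ n, ?_⟩
      rw [map_add, map_mul, map_mul, map_pow, map_pow, ← ha, ← ha']
      ring
    | smul r x hx =>
      obtain ⟨n, a, ha⟩ := hx
      refine ⟨n, r • a, ?_⟩
      rw [smul_mul_assoc, ha]
      change r • inclHom k h a = inclHom k h (r • a)
      exact (map_smul (AddMonoidAlgebra.mapDomainAlgHom k k (AddSubmonoid.inclusion h)) r a).symm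
  · intro a b hab
    exact ⟨0, by rw [inclHom_injective k h hab]⟩

lemma chartMap_face {σ F : PointedCone ℝ (ℝ ⊗[ℤ] N)} (hσ : IsSmoothCone σ) (hle : F ≤ σ)
    (m : Module.Dual ℤ N) (hm : m ∈ dualMonoid σ)
    (hF : ∀ v, v ∈ F ↔ v ∈ σ ∧ realEval m v = 0) :
    IsOpenImmersion (chartMap k hle) ∧ Set.range (chartMap k hle) =
      (PrimeSpectrum.basicOpen (AddMonoidAlgebra.single (⟨m, hm⟩ : dualMonoid σ) (1 : k)) :
        Set (PrimeSpectrum (AddMonoidAlgebra k (dualMonoid σ)))) := by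
  let _ := (inclHom k (dualMonoid_anti hle)).toAlgebra
  have hloc := isLocalization_inclHom k (dualMonoid_anti hle) m hm
    (fun v hv => by rw [realEval_neg, ((hF v).1 hv).2, neg_zero])
    (fun u hu => hσ.exists_nsmul hm fun v hv h0 => hu v ((hF v).2 ⟨hv, h0⟩))
  exact ⟨IsOpenImmersion.of_isLocalization
      (AddMonoidAlgebra.single (⟨m, hm⟩ : dualMonoid σ) (1 : k)),
    PrimeSpectrum.localization_away_comap_range (AddMonoidAlgebra k (dualMonoid F))
      (AddMonoidAlgebra.single (⟨m, hm⟩ : dualMonoid σ) (1 : k))⟩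

lemma isOpenImmersion_chartMap {σ F : PointedCone ℝ (ℝ ⊗[ℤ] N)} (hσ : IsSmoothCone σ)
    (h : F.IsFaceOf σ) : IsOpenImmersion (chartMap k h.le) := by
  obtain ⟨m, hm, hF⟩ := hσ.exists_face h
  exact (chartMap_face k hσ h.le m hm hF).1

/-- Inside `U_σ`, the charts of two faces of `σ` meet in the chart of their intersection. -/
lemma exists_chartMap_eq {σ F G : PointedCone ℝ (ℝ ⊗[ℤ] N)} (hσ : IsSmoothCone σ)
    (hF : F.IsFaceOf σ) (hG : G.IsFaceOf σ) (x : affineChart k F) (y : affineChart k G)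
    (hxy : chartMap k hF.le x = chartMap k hG.le y) :
    ∃ z : affineChart k (F ⊓ G : PointedCone ℝ (ℝ ⊗[ℤ] N)),
      chartMap k (inf_le_left : F ⊓ G ≤ F) z = x ∧
      chartMap k (inf_le_right : F ⊓ G ≤ G) z = y := by
  obtain ⟨m, hm, hmF⟩ := hσ.exists_face hF
  obtain ⟨l, hl, hlG⟩ := hσ.exists_face hG
  obtain ⟨hFo, hFr⟩ := chartMap_face k hσ hF.le m hm hmF
  obtain ⟨hGo, hGr⟩ := chartMap_face k hσ hG.le l hl hlG
  obtain ⟨-, hr⟩ := chartMap_face (F := F ⊓ G) k hσ (inf_le_left.trans hF.le) (m + l)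
    ((dualMonoid σ).add_mem hm hl) (fun v => by
      rw [Submodule.mem_inf, hmF, hlG, realEval_add]
      constructor
      · rintro ⟨⟨h1, h2⟩, -, h3⟩
        exact ⟨h1, by rw [h2, h3, add_zero]⟩
      · rintro ⟨h1, h2⟩
        have h3 := hm v h1
        have h4 := hl v h1
        exact ⟨⟨h1, by linarith⟩, h1, by linarith⟩)
  have h1 : chartMap k hF.le x ∈ Set.range (chartMap k hF.le) := ⟨x, rfl⟩
  have h2 : chartMap k hF.le x ∈ Set.range (chartMap k hG.le) := ⟨y, hxy.symm⟩
  have h3 : chartMap k hF.le x ∈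
      Set.range (chartMap k ((inf_le_left.trans hF.le : F ⊓ G ≤ σ))) := by
    rw [hFr] at h1
    rw [hGr] at h2
    rw [hr]
    have h4 : AddMonoidAlgebra.single (⟨m + l, (dualMonoid σ).add_mem hm hl⟩ : dualMonoid σ)
        (1 : k) = AddMonoidAlgebra.single (⟨m, hm⟩ : dualMonoid σ) (1 : k) *
          AddMonoidAlgebra.single (⟨l, hl⟩ : dualMonoid σ) (1 : k) := by
      rw [AddMonoidAlgebra.single_mul_single, mul_one]; rfl
    rw [h4, PrimeSpectrum.basicOpen_mul]
    exact ⟨h1, h2⟩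
  obtain ⟨z, hz⟩ := h3
  refine ⟨z, ?_, ?_⟩
  · apply (chartMap k hF.le).isOpenEmbedding.injective
    rw [← Scheme.Hom.comp_apply, chartMap_comp, hz]
  · apply (chartMap k hG.le).isOpenEmbedding.injective
    rw [← Scheme.Hom.comp_apply, chartMap_comp, hz, hxy]

end Charts

section ToricVariety

variable (k : Type u) [Field k] (S : SmoothFan N)

/-- The diagram of the affine charts `U_σ`, `σ ∈ S`, ordered by inclusion of faces. -/
def SmoothFan.diagram : S.cones ⥤ Scheme.{u} where
  obj σ := affineChart k σ.1
  map f := chartMap k (leOfHom f)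
  map_id σ := chartMap_refl k σ.1
  map_comp f g := (chartMap_comp k (leOfHom f) (leOfHom g)).symm

instance {σ τ : S.cones} (f : σ ⟶ τ) : IsOpenImmersion ((S.diagram k).map f) :=
  isOpenImmersion_chartMap k (S.smooth _ τ.2) (S.isFaceOf_of_le σ.2 τ.2 (leOfHom f))

instance : (S.diagram k ⋙ Scheme.forget).IsLocallyDirected where
  cond {σ τ ω} f g x y hxy := by
    obtain ⟨z, hz, hz'⟩ := exists_chartMap_eq k (S.smooth _ ω.2)
      (S.isFaceOf_of_le σ.2 ω.2 (leOfHom f)) (S.isFaceOf_of_le τ.2 ω.2 (leOfHom g)) x y hxy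
    exact ⟨⟨σ.1 ⊓ τ.1, S.inf_mem σ.2 τ.2⟩, homOfLE (Subtype.mk_le_mk.2 inf_le_left),
      homOfLE (Subtype.mk_le_mk.2 inf_le_right), z, hz, hz'⟩

/-- The toric variety `X_S` over `k` of the fan `S`: the affine charts `U_σ = Spec k[σ^∨ ∩ M]` for
`σ ∈ S`, glued along `U_σ ∩ U_τ = U_{σ ∩ τ}`. -/
def SmoothFan.toricVariety : Scheme.{u} := colimit (S.diagram k)

/-- The inclusion of the open affine chart `U_σ` in `X_S`. -/
def SmoothFan.chart (σ : PointedCone ℝ (ℝ ⊗[ℤ] N)) (hσ : σ ∈ S.cones) :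
    affineChart k σ ⟶ S.toricVariety k :=
  colimit.ι (S.diagram k) ⟨σ, hσ⟩

instance (σ : PointedCone ℝ (ℝ ⊗[ℤ] N)) (hσ : σ ∈ S.cones) : IsOpenImmersion (S.chart k σ hσ) :=
  inferInstanceAs (IsOpenImmersion (colimit.ι (S.diagram k) ⟨σ, hσ⟩))

lemma SmoothFan.chartMap_chart {σ τ : PointedCone ℝ (ℝ ⊗[ℤ] N)} (hσ : σ ∈ S.cones)
    (hτ : τ ∈ S.cones) (h : σ ≤ τ) : chartMap k h ≫ S.chart k τ hτ = S.chart k σ hσ :=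
  colimit.w (S.diagram k) (homOfLE h : (⟨σ, hσ⟩ : S.cones) ⟶ ⟨τ, hτ⟩)

/-- A morphism out of `X_S` is given by compatible morphisms on the affine charts. -/
def SmoothFan.glue {Y : Scheme.{u}}
    (g : ∀ σ (_ : σ ∈ S.cones), affineChart k σ ⟶ Y)
    (hg : ∀ σ (hσ : σ ∈ S.cones) τ (hτ : τ ∈ S.cones) (h : σ ≤ τ),
      chartMap k h ≫ g τ hτ = g σ hσ) : S.toricVariety k ⟶ Y :=
  colimit.desc (S.diagram k)
    { pt := Y
      ι := { app := fun σ => g σ.1 σ.2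
             naturality := fun σ τ f =>
              (hg σ.1 σ.2 τ.1 τ.2 (leOfHom f)).trans (Category.comp_id (g σ.1 σ.2)).symm } }

lemma SmoothFan.chart_glue {Y : Scheme.{u}}
    (g : ∀ σ (_ : σ ∈ S.cones), affineChart k σ ⟶ Y)
    (hg : ∀ σ (hσ : σ ∈ S.cones) τ (hτ : τ ∈ S.cones) (h : σ ≤ τ),
      chartMap k h ≫ g τ hτ = g σ hσ) (σ : PointedCone ℝ (ℝ ⊗[ℤ] N)) (hσ : σ ∈ S.cones) :
    S.chart k σ hσ ≫ S.glue k g hg = g σ hσ :=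
  colimit.ι_desc _ _

end ToricVariety

section Tori

variable (k : Type u) [Field k]

/-- The torus `T = Spec k[M]` with cocharacter lattice `N` and character lattice
`M = Hom(N, ℤ)`. -/
abbrev torus (N : Type u) [AddCommGroup N] : Scheme.{u} :=
  Spec (.of (AddMonoidAlgebra k (Module.Dual ℤ N)))

/-- The homomorphism of tori given by a homomorphism `f` of cocharacter lattices. -/
def torusMap {N₁ N₂ : Type u} [AddCommGroup N₁] [AddCommGroup N₂] (f : N₁ →ₗ[ℤ] N₂) :
    torus k N₁ ⟶ torus k N₂ :=
  Spec.map (CommRingCat.ofHom (AddMonoidAlgebra.mapDomainRingHom k f.dualMap.toAddMonoidHom))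

/-- The inclusion in `T` of the subtorus `T' = Spec k[Hom(L, ℤ)]` associated with a (primitive)
sublattice `L ⊆ N`. -/
def subtorusInclusion (L : Submodule ℤ N) : torus k L ⟶ torus k N := torusMap k L.subtype

/-- The inclusion of the torus `T` in the affine chart `U_σ`, given by `k[σ^∨ ∩ M] ⊆ k[M]`. -/
def torusToChart (σ : PointedCone ℝ (ℝ ⊗[ℤ] N)) : torus k N ⟶ affineChart k σ :=
  Spec.map (CommRingCat.ofHom (AddMonoidAlgebra.mapDomainRingHom k (dualMonoid σ).subtype))

/-- The inclusion of the torus `T` in the toric variety `X_S`. -/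
def SmoothFan.torusInclusion (S : SmoothFan N) : torus k N ⟶ S.toricVariety k :=
  torusToChart k ⊥ ≫ S.chart k ⊥ S.bot_mem

/-- The closure of a subset of a scheme, as a reduced closed subscheme (given by its ideal
sheaf). -/
def reducedClosure {X : Scheme.{u}} (Z : Set X) : X.IdealSheafData :=
  Scheme.IdealSheafData.vanishingIdeal ⟨closure Z, isClosed_closure⟩

/-- The closure `X'` in `X_S` of the subtorus `T' ⊆ T` associated with `L`, as a reduced closed
subscheme. -/
def SmoothFan.subtorusClosure (S : SmoothFan N) (L : Submodule ℤ N) :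
    (S.toricVariety k).IdealSheafData :=
  reducedClosure (Set.range (subtorusInclusion k L ≫ S.torusInclusion k))

end Tori

section ToricMorphisms

variable (k : Type u) [Field k] {N₂ : Type u} [AddCommGroup N₂]

/-- The pullback of characters `τ^∨ ∩ M₂ → σ^∨ ∩ M` along a lattice homomorphism `f : N → N₂` that
maps the cone `σ` into the cone `τ`. -/
def dualMonoidMap (f : N →ₗ[ℤ] N₂) {σ : PointedCone ℝ (ℝ ⊗[ℤ] N)}
    {τ : PointedCone ℝ (ℝ ⊗[ℤ] N₂)} (h : ∀ v ∈ σ, f.baseChange ℝ v ∈ τ) :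
    dualMonoid τ →+ dualMonoid σ where
  toFun m := ⟨m.1 ∘ₗ f, fun v hv => by
    rw [realEval_comp]
    exact m.2 _ (h v hv)⟩
  map_zero' := by ext; simp
  map_add' _ _ := by ext; simp

/-- The morphism of affine toric varieties `U_σ → U_τ` given by a lattice homomorphism that maps the
cone `σ` into the cone `τ`. -/
def toricChartMap (f : N →ₗ[ℤ] N₂) {σ : PointedCone ℝ (ℝ ⊗[ℤ] N)}
    {τ : PointedCone ℝ (ℝ ⊗[ℤ] N₂)} (h : ∀ v ∈ σ, f.baseChange ℝ v ∈ τ) :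
    affineChart k σ ⟶ affineChart k τ :=
  Spec.map (CommRingCat.ofHom (AddMonoidAlgebra.mapDomainRingHom k (dualMonoidMap f h)))

lemma chartMap_toricChartMap (f : N →ₗ[ℤ] N₂) {σ σ' : PointedCone ℝ (ℝ ⊗[ℤ] N)}
    {τ τ' : PointedCone ℝ (ℝ ⊗[ℤ] N₂)} (h : ∀ v ∈ σ, f.baseChange ℝ v ∈ τ)
    (h' : ∀ v ∈ σ', f.baseChange ℝ v ∈ τ') (hσ : σ ≤ σ') (hτ : τ ≤ τ') :
    chartMap k hσ ≫ toricChartMap k f h' = toricChartMap k f h ≫ chartMap k hτ := by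
  rw [chartMap, chartMap, toricChartMap, toricChartMap, ← Spec.map_comp, ← Spec.map_comp,
    ← CommRingCat.ofHom_comp, ← CommRingCat.ofHom_comp]
  congr 2
  refine AddMonoidAlgebra.ringHom_ext (fun r => ?_) (fun a => ?_)
  · simp [inclHom]
  · simp [inclHom]; rfl

/-- The toric morphism `X_S → X_{S₂}` given by a lattice homomorphism `f : N → N₂` that maps each
cone of `S` into a cone of `S₂`. -/
def SmoothFan.toricMap (S : SmoothFan N) (S₂ : SmoothFan N₂) (f : N →ₗ[ℤ] N₂)
    (h : ∀ σ ∈ S.cones, ∃ τ ∈ S₂.cones, ∀ v ∈ σ, f.baseChange ℝ v ∈ τ) :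
    S.toricVariety k ⟶ S₂.toricVariety k :=
  S.glue k (fun σ hσ => toricChartMap k f (h σ hσ).choose_spec.2 ≫
      S₂.chart k (h σ hσ).choose (h σ hσ).choose_spec.1) (by
    intro σ hσ τ hτ hle
    have h1 := (h σ hσ).choose_spec
    have h2 := (h τ hτ).choose_spec
    have h3 : ∀ v ∈ σ, f.baseChange ℝ v ∈ (h σ hσ).choose ⊓ (h τ hτ).choose := fun v hv => ⟨h1.2 v hv, h2.2 v (hle hv)⟩
    have hmem := S₂.inf_mem h1.1 h2.1
    have e1 := chartMap_toricChartMap k f h3 h2.2 hle inf_le_right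
    have e2 := chartMap_toricChartMap k f h3 h1.2 le_rfl inf_le_left
    rw [chartMap_refl, Category.id_comp] at e2
    rw [← Category.assoc, e1, Category.assoc, S₂.chartMap_chart k hmem, e2, Category.assoc,
      S₂.chartMap_chart k hmem])

/-- On affine charts, a toric morphism is given by pullback of characters. -/
lemma SmoothFan.chart_toricMap (S : SmoothFan N) (S₂ : SmoothFan N₂) (f : N →ₗ[ℤ] N₂)
    (h : ∀ σ ∈ S.cones, ∃ τ ∈ S₂.cones, ∀ v ∈ σ, f.baseChange ℝ v ∈ τ)
    {σ : PointedCone ℝ (ℝ ⊗[ℤ] N)} (hσ : σ ∈ S.cones) {τ : PointedCone ℝ (ℝ ⊗[ℤ] N₂)}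
    (hτ : τ ∈ S₂.cones) (hf : ∀ v ∈ σ, f.baseChange ℝ v ∈ τ) :
    S.chart k σ hσ ≫ S.toricMap k S₂ f h = toricChartMap k f hf ≫ S₂.chart k τ hτ := by
  rw [SmoothFan.toricMap, SmoothFan.chart_glue]
  have h1 := (h σ hσ).choose_spec
  have h3 : ∀ v ∈ σ, f.baseChange ℝ v ∈ (h σ hσ).choose ⊓ τ := fun v hv => ⟨h1.2 v hv, hf v hv⟩
  have hmem := S₂.inf_mem h1.1 hτ
  have e1 := chartMap_toricChartMap k f h3 hf le_rfl inf_le_right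
  have e2 := chartMap_toricChartMap k f h3 h1.2 le_rfl inf_le_left
  rw [chartMap_refl, Category.id_comp] at e1 e2
  rw [e1, e2, Category.assoc, Category.assoc, S₂.chartMap_chart k hmem, S₂.chartMap_chart k hmem]

end ToricMorphisms

section OrbitClosures

variable (k : Type u) [Field k] {σ τ : PointedCone ℝ (ℝ ⊗[ℤ] N)}

lemma coneLattice_le_ker {m : Module.Dual ℤ N} (h : ∀ v ∈ σ, realEval m v = 0) :
    coneLattice σ ≤ LinearMap.ker m := by
  refine Submodule.span_le.2 fun n hn => ?_
  have := h _ hn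
  simpa using this

/-- A character `m ∈ σ^⊥ ∩ τ^∨ ∩ M`, as a character of the quotient torus `T^σ`. -/
def descend (m : Module.Dual ℤ N) (h : ∀ v ∈ σ, realEval m v = 0) :
    Module.Dual ℤ (N ⧸ coneLattice σ) :=
  (coneLattice σ).liftQ m (coneLattice_le_ker h)

lemma descend_mem {m : Module.Dual ℤ N} (h : ∀ v ∈ σ, realEval m v = 0)
    {ω : PointedCone ℝ (ℝ ⊗[ℤ] (N ⧸ coneLattice σ))} (hω : ω ≤ quotientCone σ τ)
    (hm : m ∈ dualMonoid τ) : descend m h ∈ dualMonoid ω := by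
  intro w hw
  obtain ⟨v, hv, rfl⟩ := hω hw
  have h1 : descend m h ∘ₗ (coneLattice σ).mkQ = m := Submodule.liftQ_mkQ _ _ _
  have h2 := realEval_comp (coneLattice σ).mkQ (descend m h) v
  rw [h1] at h2
  exact h2 ▸ hm v hv

open Classical in
/-- For a cone `τ ⊇ σ` with image `τ̄` in the quotient, the surjective homomorphism
`k[τ^∨ ∩ M] → k[σ^⊥ ∩ τ^∨ ∩ M] = k[τ̄^∨ ∩ Hom(N / N_σ, ℤ)]` which is the identity on the characters
in `σ^⊥` and maps all other characters to `0`. (Here `ω` stands for `τ̄`.) -/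
def perpHom (hle : σ ≤ τ) {ω : PointedCone ℝ (ℝ ⊗[ℤ] (N ⧸ coneLattice σ))}
    (hω : ω ≤ quotientCone σ τ) :
    AddMonoidAlgebra k (dualMonoid τ) →ₐ[k] AddMonoidAlgebra k (dualMonoid ω) :=
  AddMonoidAlgebra.lift k _ _
    { toFun := fun m =>
        if h : ∀ v ∈ σ, realEval m.toAdd.1 v = 0 then
          AddMonoidAlgebra.single (⟨descend m.toAdd.1 h, descend_mem h hω m.toAdd.2⟩ : dualMonoid ω) 1
        else 0
      map_one' := by
        have h0 : ∀ v ∈ σ,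
            realEval (Multiplicative.toAdd (1 : Multiplicative (dualMonoid τ))).1 v = 0 :=
          fun v _ => realEval_zero v
        rw [dif_pos h0, AddMonoidAlgebra.one_def]
        congr 1
        ext x
        rfl
      map_mul' := by
        intro m m'
        by_cases h : ∀ v ∈ σ, realEval m.toAdd.1 v = 0
        · by_cases h' : ∀ v ∈ σ, realEval m'.toAdd.1 v = 0
          · have h'' : ∀ v ∈ σ, realEval (m * m').toAdd.1 v = 0 := fun v hv => by
              have := realEval_add m.toAdd.1 m'.toAdd.1 v
              rw [h v hv, h' v hv, add_zero] at this
              exact this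
            rw [dif_pos h, dif_pos h', dif_pos h'', AddMonoidAlgebra.single_mul_single, mul_one]
            congr 1
            ext x
            rfl
          · rw [dif_neg h', mul_zero, dif_neg]
            intro h''
            refine h' fun v hv => ?_
            have h1 := realEval_add m.toAdd.1 m'.toAdd.1 v
            rw [h v hv, zero_add] at h1
            exact h1.symm.trans (h'' v hv)
        · rw [dif_neg h, zero_mul, dif_neg]
          intro h''
          refine h fun v hv => ?_
          have h1 := realEval_add m.toAdd.1 m'.toAdd.1 v
          have h2 := m.toAdd.2 v (hle hv)
          have h3 := m'.toAdd.2 v (hle hv)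
          have h4 : realEval (m.toAdd.1 + m'.toAdd.1) v = 0 := h'' v hv
          linarith }

lemma perpHom_single_of_perp (hle : σ ≤ τ) {ω : PointedCone ℝ (ℝ ⊗[ℤ] (N ⧸ coneLattice σ))}
    (hω : ω ≤ quotientCone σ τ) (m : dualMonoid τ) (h : ∀ v ∈ σ, realEval m.1 v = 0) :
    perpHom k hle hω (AddMonoidAlgebra.single m 1) =
      AddMonoidAlgebra.single (⟨descend m.1 h, descend_mem h hω m.2⟩ : dualMonoid ω) 1 := by
  rw [perpHom, AddMonoidAlgebra.lift_single, one_smul]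
  exact dif_pos h

lemma perpHom_single_of_not_perp (hle : σ ≤ τ)
    {ω : PointedCone ℝ (ℝ ⊗[ℤ] (N ⧸ coneLattice σ))}
    (hω : ω ≤ quotientCone σ τ) (m : dualMonoid τ) (h : ¬ ∀ v ∈ σ, realEval m.1 v = 0) :
    perpHom k hle hω (AddMonoidAlgebra.single m 1) = 0 := by
  rw [perpHom, AddMonoidAlgebra.lift_single, one_smul]
  exact dif_neg h

/-- The closed immersion `U_τ̄ → U_τ` of affine charts, for `τ ⊇ σ`, where `τ̄` is the image of `τ`
in the quotient. -/
def perpChartMap (hle : σ ≤ τ) {ω : PointedCone ℝ (ℝ ⊗[ℤ] (N ⧸ coneLattice σ))}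
    (hω : ω ≤ quotientCone σ τ) : affineChart k ω ⟶ affineChart k τ :=
  Spec.map (CommRingCat.ofHom (perpHom k hle hω).toRingHom)

lemma perpChartMap_chartMap {τ' : PointedCone ℝ (ℝ ⊗[ℤ] N)} (hle : σ ≤ τ) (hle' : σ ≤ τ')
    {ω ω' : PointedCone ℝ (ℝ ⊗[ℤ] (N ⧸ coneLattice σ))}
    (hω : ω ≤ quotientCone σ τ) (hω' : ω' ≤ quotientCone σ τ') (h : τ ≤ τ') (h' : ω ≤ ω') :
    chartMap k h' ≫ perpChartMap k hle' hω' = perpChartMap k hle hω ≫ chartMap k h := by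
  rw [chartMap, chartMap, perpChartMap, perpChartMap, ← Spec.map_comp, ← Spec.map_comp,
    ← CommRingCat.ofHom_comp, ← CommRingCat.ofHom_comp]
  congr 2
  suffices H : (perpHom k hle hω).comp (AddMonoidAlgebra.mapDomainAlgHom k k
      (AddSubmonoid.inclusion (dualMonoid_anti h))) =
      (AddMonoidAlgebra.mapDomainAlgHom k k (AddSubmonoid.inclusion (dualMonoid_anti h'))).comp
        (perpHom k hle' hω') from (congrArg AlgHom.toRingHom H).symm
  apply AddMonoidAlgebra.algHom_ext
  · intro m
    by_cases hm : ∀ v ∈ σ, realEval m.1 v = 0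
    · have e1 := perpHom_single_of_perp k hle' hω' m hm
      have e2 := perpHom_single_of_perp k hle hω (AddSubmonoid.inclusion (dualMonoid_anti h) m) hm
      simp only [AlgHom.comp_apply, AddMonoidAlgebra.mapDomainAlgHom_apply,
        AddMonoidAlgebra.mapDomain_single]
      rw [e1, e2, AddMonoidAlgebra.mapDomain_single]
      rfl
    · have e1 := perpHom_single_of_not_perp k hle' hω' m hm
      have e2 := perpHom_single_of_not_perp k hle hω
        (AddSubmonoid.inclusion (dualMonoid_anti h) m) hm
      simp only [AlgHom.comp_apply, AddMonoidAlgebra.mapDomainAlgHom_apply,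
        AddMonoidAlgebra.mapDomain_single]
      rw [e1, e2, AddMonoidAlgebra.mapDomain_zero]
  · exact Subsingleton.elim _ _

variable (S : SmoothFan N)

/-- The orbit morphism `T^σ → X_S` with image the orbit `D_σ^∘`, the closed `T`-orbit in the affine
chart `U_σ`. It is the closed immersion of `T^σ = Spec k[σ^⊥ ∩ M]` in `U_σ = Spec k[σ^∨ ∩ M]`
mapping a character in `σ^⊥` to itself and every other character to `0`, followed by the inclusion
of the chart `U_σ` in `X_S`. -/
def SmoothFan.orbitInclusion (σ : PointedCone ℝ (ℝ ⊗[ℤ] N)) (hσ : σ ∈ S.cones) :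
    torus k (N ⧸ coneLattice σ) ⟶ S.toricVariety k :=
  torusToChart k (quotientCone σ σ) ≫ perpChartMap k (le_refl σ) (le_refl (quotientCone σ σ)) ≫
    S.chart k σ hσ

/-- The closure `D_σ` in `X_S` of the orbit `D_σ^∘`, as a reduced closed subscheme. -/
def SmoothFan.orbitClosure (σ : PointedCone ℝ (ℝ ⊗[ℤ] N)) (hσ : σ ∈ S.cones) :
    (S.toricVariety k).IdealSheafData :=
  reducedClosure (Set.range (S.orbitInclusion k σ hσ))

/-- The morphism `X_{S^σ} → X_S`, given on affine charts, for `τ ⊇ σ`, by the surjective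
homomorphisms `k[τ^∨ ∩ M] → k[σ^⊥ ∩ τ^∨ ∩ M]`. -/
def SmoothFan.starInclusion (σ : PointedCone ℝ (ℝ ⊗[ℤ] N)) (hσ : σ ∈ S.cones) :
    (S.star σ hσ).toricVariety k ⟶ S.toricVariety k :=
  (S.star σ hσ).glue k
    (fun _ hω => perpChartMap k hω.choose_spec.1.2 hω.choose_spec.2.ge ≫
      S.chart k hω.choose hω.choose_spec.1.1) (by
    intro ω hω ω' hω' h
    have h1 := hω.choose_spec
    have h2 := hω'.choose_spec
    have hle : hω.choose ≤ hω'.choose := by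
      rw [← quotientCone_le_iff S h1.1.1 h2.1.1 h1.1.2 h2.1.2, h1.2, h2.2]
      exact h
    rw [← Category.assoc, perpChartMap_chartMap k h1.1.2 h2.1.2 h1.2.ge h2.2.ge hle h,
      Category.assoc, S.chartMap_chart k h1.1.1 h2.1.1 hle])

/-- The open subset `U^σ` of `X_S`: the union of the affine charts `U_τ` for the cones `τ ⊇ σ`. -/
def SmoothFan.starOpen (σ : PointedCone ℝ (ℝ ⊗[ℤ] N)) : (S.toricVariety k).Opens :=
  ⨆ τ : {τ // τ ∈ S.cones ∧ σ ≤ τ}, (S.chart k τ.1 τ.2.1).opensRange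

/-- The inclusion of the affine chart `U_τ` in `U^σ`, for `τ ⊇ σ`. -/
def SmoothFan.chartToStarOpen (σ : PointedCone ℝ (ℝ ⊗[ℤ] N)) (τ : PointedCone ℝ (ℝ ⊗[ℤ] N))
    (hτ : τ ∈ S.cones) (hle : σ ≤ τ) : affineChart k τ ⟶ (S.starOpen k σ).toScheme :=
  IsOpenImmersion.lift (S.starOpen k σ).ι (S.chart k τ hτ) (by
    rw [Scheme.Opens.range_ι]
    exact le_iSup (fun τ : {τ // τ ∈ S.cones ∧ σ ≤ τ} => (S.chart k τ.1 τ.2.1).opensRange)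
      ⟨τ, hτ, hle⟩)

lemma SmoothFan.chartToStarOpen_ι (σ : PointedCone ℝ (ℝ ⊗[ℤ] N)) (τ : PointedCone ℝ (ℝ ⊗[ℤ] N))
    (hτ : τ ∈ S.cones) (hle : σ ≤ τ) :
    S.chartToStarOpen k σ τ hτ hle ≫ (S.starOpen k σ).ι = S.chart k τ hτ :=
  IsOpenImmersion.lift_fac _ _ _

instance (σ : PointedCone ℝ (ℝ ⊗[ℤ] N)) (τ : PointedCone ℝ (ℝ ⊗[ℤ] N))
    (hτ : τ ∈ S.cones) (hle : σ ≤ τ) : IsOpenImmersion (S.chartToStarOpen k σ τ hτ hle) := by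
  have : IsOpenImmersion (S.chartToStarOpen k σ τ hτ hle ≫ (S.starOpen k σ).ι) := by
    rw [S.chartToStarOpen_ι k]; infer_instance
  exact IsOpenImmersion.of_comp _ (S.starOpen k σ).ι

/-- The open cover of `U^σ` by the affine charts `U_τ` for `τ ⊇ σ`. -/
def SmoothFan.starCover (σ : PointedCone ℝ (ℝ ⊗[ℤ] N)) :
    (S.starOpen k σ).toScheme.OpenCover :=
  Scheme.Cover.mkOfCovers {τ // τ ∈ S.cones ∧ σ ≤ τ} (fun τ => affineChart k τ.1)
    (fun τ => S.chartToStarOpen k σ τ.1 τ.2.1 τ.2.2) (by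
      intro x
      obtain ⟨τ, y, hy⟩ := TopologicalSpace.Opens.mem_iSup.1 x.2
      refine ⟨τ, y, ?_⟩
      apply (S.starOpen k σ).ι.isOpenEmbedding.injective
      rw [← Scheme.Hom.comp_apply, S.chartToStarOpen_ι k]
      exact hy) (fun τ => inferInstance)

lemma SmoothFan.chartMap_chartToStarOpen {σ τ τ' : PointedCone ℝ (ℝ ⊗[ℤ] N)}
    (hτ : τ ∈ S.cones ∧ σ ≤ τ) (hτ' : τ' ∈ S.cones ∧ σ ≤ τ') (h : τ ≤ τ') :
    chartMap k h ≫ S.chartToStarOpen k σ τ' hτ'.1 hτ'.2 =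
      S.chartToStarOpen k σ τ hτ.1 hτ.2 := by
  rw [← cancel_mono (S.starOpen k σ).ι, Category.assoc, S.chartToStarOpen_ι k,
    S.chartToStarOpen_ι k]
  exact S.chartMap_chart k hτ.1 hτ'.1 h

/-- The charts of two cones `τ, τ' ⊇ σ` of a fan meet in the chart of `τ ∩ τ' ⊇ σ`. -/
lemma SmoothFan.exists_pullback_lift_eq {σ τ τ' : PointedCone ℝ (ℝ ⊗[ℤ] N)}
    (hτ : τ ∈ S.cones ∧ σ ≤ τ) (hτ' : τ' ∈ S.cones ∧ σ ≤ τ')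
    (x : ↥(pullback (S.chartToStarOpen k σ τ hτ.1 hτ.2)
      (S.chartToStarOpen k σ τ' hτ'.1 hτ'.2))) :
    ∃ z : affineChart k (τ ⊓ τ'), pullback.lift (f := S.chartToStarOpen k σ τ hτ.1 hτ.2)
      (g := S.chartToStarOpen k σ τ' hτ'.1 hτ'.2) (chartMap k inf_le_left) (chartMap k inf_le_right)
      ((S.chartMap_chartToStarOpen k ⟨S.inf_mem hτ.1 hτ'.1, le_inf hτ.2 hτ'.2⟩ hτ inf_le_left).trans
        (S.chartMap_chartToStarOpen k ⟨S.inf_mem hτ.1 hτ'.1, le_inf hτ.2 hτ'.2⟩ hτ'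
          inf_le_right).symm) z = x := by
  have hpq : pullback.fst (S.chartToStarOpen k σ τ hτ.1 hτ.2)
        (S.chartToStarOpen k σ τ' hτ'.1 hτ'.2) ≫ S.chart k τ hτ.1 =
      pullback.snd (S.chartToStarOpen k σ τ hτ.1 hτ.2)
        (S.chartToStarOpen k σ τ' hτ'.1 hτ'.2) ≫ S.chart k τ' hτ'.1 := by
    rw [← S.chartToStarOpen_ι k σ τ hτ.1 hτ.2, ← S.chartToStarOpen_ι k σ τ' hτ'.1 hτ'.2,
      ← Category.assoc, ← Category.assoc, pullback.condition]
  have hx := congrArg (fun φ => φ x) hpq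
  simp only [Scheme.Hom.comp_apply] at hx
  obtain ⟨κ, f, g, (z : affineChart k κ.1), hz, -⟩ := Scheme.IsLocallyDirected.ι_eq_ι_iff (S.diagram k) |>.1 hx
  have hκ : κ.1 ≤ τ ⊓ τ' := le_inf (leOfHom f) (leOfHom g)
  refine ⟨chartMap k hκ z, ?_⟩
  apply (pullback.fst (S.chartToStarOpen k σ τ hτ.1 hτ.2)
    (S.chartToStarOpen k σ τ' hτ'.1 hτ'.2)).isOpenEmbedding.injective
  rw [← Scheme.Hom.comp_apply, pullback.lift_fst, ← Scheme.Hom.comp_apply, chartMap_comp]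
  exact hz

instance (σ : PointedCone ℝ (ℝ ⊗[ℤ] N)) : Preorder (S.starCover k σ).I₀ :=
  inferInstanceAs (Preorder {τ // τ ∈ S.cones ∧ σ ≤ τ})

instance (σ : PointedCone ℝ (ℝ ⊗[ℤ] N)) : (S.starCover k σ).LocallyDirected where
  trans {τ τ'} f := chartMap k (leOfHom f : τ.1 ≤ τ'.1)
  trans_id τ := chartMap_refl k τ.1
  trans_comp f g := (chartMap_comp k (leOfHom f) (leOfHom g)).symm
  w {τ τ'} f := S.chartMap_chartToStarOpen k τ.2 τ'.2 (leOfHom f)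
  directed {τ τ'} x := by
    obtain ⟨z, hz⟩ := S.exists_pullback_lift_eq k τ.2 τ'.2 x
    exact ⟨⟨τ.1 ⊓ τ'.1, S.inf_mem τ.2.1 τ'.2.1, le_inf τ.2.2 τ'.2.2⟩,
      homOfLE (Subtype.mk_le_mk.2 inf_le_left), homOfLE (Subtype.mk_le_mk.2 inf_le_right), z, hz⟩
  property_trans {τ τ'} f :=
    isOpenImmersion_chartMap k (S.smooth _ τ'.2.1) (S.isFaceOf_of_le τ.2.1 τ'.2.1 (leOfHom f))

lemma coneProj_mem {σ τ : PointedCone ℝ (ℝ ⊗[ℤ] N)} {v : ℝ ⊗[ℤ] N} (hv : v ∈ τ) :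
    (coneLattice σ).mkQ.baseChange ℝ v ∈ quotientCone σ τ :=
  ⟨v, hv, rfl⟩

/-- The affine chart `U_τ → U_τ̄` of the projection `U^σ → X_{S^σ}`, for `τ ⊇ σ`, where `τ̄` is the
image of `τ` in the quotient. It is given by the inclusion `k[σ^⊥ ∩ τ^∨ ∩ M] → k[τ^∨ ∩ M]`. -/
def quotientChartMap (σ τ : PointedCone ℝ (ℝ ⊗[ℤ] N)) :
    affineChart k τ ⟶ affineChart k (quotientCone σ τ) :=
  toricChartMap k (coneLattice σ).mkQ (fun _ hv => coneProj_mem hv)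

lemma quotientCone_mono {σ τ τ' : PointedCone ℝ (ℝ ⊗[ℤ] N)} (h : τ ≤ τ') :
    quotientCone σ τ ≤ quotientCone σ τ' :=
  Submodule.map_mono h

lemma SmoothFan.quotientCone_mem_star {σ τ : PointedCone ℝ (ℝ ⊗[ℤ] N)} (hσ : σ ∈ S.cones)
    (hτ : τ ∈ S.cones ∧ σ ≤ τ) : quotientCone σ τ ∈ (S.star σ hσ).cones :=
  ⟨τ, hτ, rfl⟩

lemma SmoothFan.chartMap_quotientChartMap (σ : PointedCone ℝ (ℝ ⊗[ℤ] N)) (hσ : σ ∈ S.cones)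
    {τ τ' : PointedCone ℝ (ℝ ⊗[ℤ] N)} (hτ : τ ∈ S.cones ∧ σ ≤ τ) (hτ' : τ' ∈ S.cones ∧ σ ≤ τ')
    (h : τ ≤ τ') :
    chartMap k h ≫ quotientChartMap k σ τ' ≫
        (S.star σ hσ).chart k (quotientCone σ τ') (S.quotientCone_mem_star hσ hτ') =
      quotientChartMap k σ τ ≫ (S.star σ hσ).chart k (quotientCone σ τ)
        (S.quotientCone_mem_star hσ hτ) := by
  rw [← Category.assoc, quotientChartMap, quotientChartMap,
    chartMap_toricChartMap k _ (fun _ hv => coneProj_mem hv) (fun _ hv => coneProj_mem hv) h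
      (quotientCone_mono h), Category.assoc,
    (S.star σ hσ).chartMap_chart k (S.quotientCone_mem_star hσ hτ)]

/-- The projection `U^σ → X_{S^σ}` extending the homomorphism of tori `T → T^σ`. -/
def SmoothFan.starProjection (σ : PointedCone ℝ (ℝ ⊗[ℤ] N)) (hσ : σ ∈ S.cones) :
    (S.starOpen k σ).toScheme ⟶ (S.star σ hσ).toricVariety k :=
  (S.starCover k σ).glueMorphismsOfLocallyDirected
    (fun τ => quotientChartMap k σ τ.1 ≫ (S.star σ hσ).chart k (quotientCone σ τ.1)
      (S.quotientCone_mem_star hσ τ.2))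
    (fun {τ τ'} f => S.chartMap_quotientChartMap k σ hσ τ.2 τ'.2 (leOfHom f))

/-- On affine charts, the projection `U^σ → X_{S^σ}` is given by the inclusions
`k[σ^⊥ ∩ τ^∨ ∩ M] → k[τ^∨ ∩ M]`. -/
lemma SmoothFan.chartToStarOpen_starProjection (σ τ : PointedCone ℝ (ℝ ⊗[ℤ] N)) (hσ : σ ∈ S.cones)
    (hτ : τ ∈ S.cones) (hle : σ ≤ τ) :
    S.chartToStarOpen k σ τ hτ hle ≫ S.starProjection k σ hσ =
      quotientChartMap k σ τ ≫ (S.star σ hσ).chart k (quotientCone σ τ)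
        (S.quotientCone_mem_star hσ ⟨hτ, hle⟩) :=
  (S.starCover k σ).map_glueMorphismsOfLocallyDirected _
    (fun {τ τ'} f => S.chartMap_quotientChartMap k σ hσ τ.2 τ'.2 (leOfHom f))
    (⟨τ, hτ, hle⟩ : {τ // τ ∈ S.cones ∧ σ ≤ τ})

end OrbitClosures

section Subtori

variable (k : Type u) [Field k] (S : SmoothFan N)

/-- The injective homomorphism `L / L_σ → N / N_σ` with image `L / N_σ`, for a cone `σ ⊆ L_ℝ`. -/
def quotientLatticeMap (L : Submodule ℤ N) (σ : PointedCone ℝ (ℝ ⊗[ℤ] N)) :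
    (L ⧸ coneLattice (restrictCone L σ)) →ₗ[ℤ] (N ⧸ coneLattice σ) :=
  Submodule.mapQ _ _ L.subtype (Submodule.span_le.2 fun _ hn => Submodule.subset_span hn)

lemma SmoothFan.restrictCone_mem (L : Submodule ℤ N) (hL : IsPrimitive L) (hE : PropertyE S L)
    {σ : PointedCone ℝ (ℝ ⊗[ℤ] N)} (hσ : σ ∈ S.cones) :
    restrictCone L σ ∈ (S.induced L hL hE).cones :=
  ⟨σ, hσ, rfl⟩

lemma SmoothFan.quotientLatticeMap_cone (L : Submodule ℤ N) (hL : IsPrimitive L)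
    (hE : PropertyE S L) (σ : PointedCone ℝ (ℝ ⊗[ℤ] N)) (hσ : σ ∈ S.cones)
    (hσL : σ ≤ PointedCone.ofSubmodule (realSpan L)) :
    ∀ ω ∈ ((S.induced L hL hE).star _ (S.restrictCone_mem L hL hE hσ)).cones,
      ∃ τ ∈ (S.star σ hσ).cones, ∀ v ∈ ω, (quotientLatticeMap L σ).baseChange ℝ v ∈ τ := by
  rintro _ ⟨_, ⟨⟨τ, hτ, rfl⟩, hle⟩, rfl⟩
  have hle' : σ ≤ τ := by
    intro v hv
    obtain ⟨x, rfl⟩ := hσL hv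
    exact hle hv
  refine ⟨_, S.quotientCone_mem_star hσ ⟨hτ, hle'⟩, ?_⟩
  rintro _ ⟨v, hv, rfl⟩
  refine ⟨L.subtype.baseChange ℝ v, hv, ?_⟩
  change ((coneLattice σ).mkQ.baseChange ℝ ∘ₗ L.subtype.baseChange ℝ) v =
    ((quotientLatticeMap L σ).baseChange ℝ ∘ₗ
      (coneLattice (restrictCone L σ)).mkQ.baseChange ℝ) v
  rw [← LinearMap.baseChange_comp, ← LinearMap.baseChange_comp]
  rfl

/-- For `T' ⊆ T` with property (E), with induced fan `S'`, and `σ ∈ S` with `σ ⊆ L_ℝ`: the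
morphism `X_{S'^σ} → X_{S^σ}` given by the inclusion of cocharacter lattices
`L / N_σ ⊆ N / N_σ`. -/
def SmoothFan.inducedStarInclusion (L : Submodule ℤ N) (hL : IsPrimitive L)
    (hE : PropertyE S L) (σ : PointedCone ℝ (ℝ ⊗[ℤ] N)) (hσ : σ ∈ S.cones)
    (hσL : σ ≤ PointedCone.ofSubmodule (realSpan L)) :
    ((S.induced L hL hE).star (restrictCone L σ) (S.restrictCone_mem L hL hE hσ)).toricVariety k ⟶
      (S.star σ hσ).toricVariety k :=
  SmoothFan.toricMap k _ _ (quotientLatticeMap L σ) (S.quotientLatticeMap_cone L hL hE σ hσ hσL)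

end Subtori

end

end ToricGeometry

open ToricGeometry

namespace ToricGeometry

section

/-! ### Pullback squares of schemes -/

/-! All assertions are local on the charts U_τ, where they become statements about semigroup rings.
The decisive point is that property (E) makes the restriction of characters τ^∨ ∩ M → (τ ∩ L_ℝ)^∨ ∩
Hom(L, ℤ) surjective. Since τ ∩ L_ℝ is a face of τ, no nontrivial nonnegative combination of the
generators of τ outside L_ℝ falls into L_ℝ. A separation argument in N / L then yields an integral
functional m that vanishes on L, is nonnegative on τ, and vanishes on τ only inside L_ℝ
(`IsSmoothCone.exists_dual_vanishing`). A character of L extends to N because L is a direct summand,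
and adding a large multiple of m makes the extension nonnegative on τ without changing it on L
(`IsSmoothCone.dualMonoidMap_subtype_surjective`). Hence the chart of τ ∩ L_ℝ is a reduced closed
subscheme of U_τ in which T' is dense, so it is X' ∩ U_τ
(`SmoothFan.exists_isPullback_subtorusClosure`).

For τ ⊇ σ, two squares of rings have to be pushouts. The kernel of a map of semigroup rings induced
by a surjection of semigroups is generated by the differences χ^a − χ^b of characters with the same
image (`ker_mapDomainRingHom_le`), so only such binomials have to be lifted. For X' ∩ D_σ, two
characters in σ^⊥ ∩ τ^∨ with the same image on L / N_σ are already characters in τ^∨ that agree on L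
(`isPullback_perpChartMap`). For the preimage under pr, smoothness of τ splits each a ∈ τ^∨ into a
part determined by its restriction to N_σ and a part in σ^⊥ ∩ τ^∨. Two characters that agree on L ⊇
N_σ share the first part, so χ^a − χ^b is a character times a binomial from the base
(`isPullback_quotientChartMap`). A splitting of the same kind exhibits k[τ^∨ ∩ M] as a polynomial
ring over the base, with one variable for each generator of σ, whence pr is smooth.

Globally, the preimages of charts are charts (`SmoothFan.isPullback_toricMap`,
`SmoothFan.isPullback_starInclusion`), and cartesian squares glue over an open cover because the
closed immersions involved are monomorphisms (`exists_isPullback_of_openCover`). The orbit D_σ^∘ is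
the case τ = σ, where the quotient cone is zero. Finally X_{S^σ} is D_σ, because it is a reduced
closed subscheme of X in which the torus T^σ is dense. -/

lemma ker_eq_vanishingIdeal {X Y : Scheme.{u}} (f : X ⟶ Y) [IsReduced X] :
    f.ker = Scheme.IdealSheafData.vanishingIdeal (.closure (Set.range f)) := by
  have h := Scheme.IdealSheafData.map_vanishingIdeal f ⊤
  rw [Scheme.IdealSheafData.vanishingIdeal_top, Scheme.nilradical_eq_bot,
    Scheme.IdealSheafData.map_bot] at h
  rw [h, TopologicalSpace.Closeds.coe_top, Set.image_univ]

/-- On each affine open the ideal in question is the vanishing ideal of a set of primes, hence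
radical. -/
lemma isReduced_vanishingIdeal {X : Scheme.{u}} (Z : TopologicalSpace.Closeds X) :
    IsReduced (Scheme.IdealSheafData.vanishingIdeal Z).subscheme := by
  have (U : X.affineOpens) :
      IsReduced ((Scheme.IdealSheafData.vanishingIdeal Z).subschemeCover.openCover.X U) := by
    have : _root_.IsReduced
        (Γ(X, U.1) ⧸ (Scheme.IdealSheafData.vanishingIdeal Z).ideal U) := by
      rw [← Ideal.isRadical_iff_quotient_reduced, Scheme.IdealSheafData.vanishingIdeal_ideal]
      exact PrimeSpectrum.isRadical_vanishingIdeal _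
    exact inferInstanceAs (IsReduced
      (Spec (.of (Γ(X, U.1) ⧸ (Scheme.IdealSheafData.vanishingIdeal Z).ideal U))))
  have (U : (Scheme.IdealSheafData.vanishingIdeal Z).subschemeCover.openCover.I₀) :
      IsReduced ((Scheme.IdealSheafData.vanishingIdeal Z).subschemeCover.openCover.X U) := this U
  exact IsReduced.of_openCover _ (Scheme.IdealSheafData.vanishingIdeal Z).subschemeCover.openCover

/-- The preimage of a reduced closed subscheme `Z` in an open subscheme `U` is the reduced closed
subscheme of `U` with the expected underlying set. -/
lemma exists_isPullback_of_range_eq {Z X U W : Scheme.{u}} (i : Z ⟶ X) [IsClosedImmersion i]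
    [IsReduced Z] (f : U ⟶ X) [IsOpenImmersion f] (j : W ⟶ U) [IsClosedImmersion j] [IsReduced W]
    (h : Set.range j = f ⁻¹' Set.range i) : ∃ g, IsPullback g j i f := by
  -- The pullback is open in the reduced scheme `Z`, so it and `W` are reduced closed subschemes of
  -- `U` with the same underlying set; their ideal sheaves coincide.
  have : IsReduced (pullback i f) := isReduced_of_isOpenImmersion (pullback.fst i f)
  have hk : (pullback.snd i f).ker = j.ker := by
    rw [ker_eq_vanishingIdeal, ker_eq_vanishingIdeal, h, Scheme.Pullback.range_snd]
  have := IsClosedImmersion.isIso_lift (pullback.snd i f) j hk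
  let e := IsClosedImmersion.lift (pullback.snd i f) j hk.le
  refine ⟨e ≫ pullback.fst i f, IsPullback.of_iso (IsPullback.of_hasPullback i f)
    (asIso e).symm (Iso.refl _) (Iso.refl _) (Iso.refl _) ?_ ?_ ?_ ?_⟩
  · simp
  · simp [e]
  · simp
  · simp

/-- Pullback squares can be glued along an open cover of a corner, if the parallel side is a
monomorphism. -/
lemma exists_isPullback_of_openCover {X Y Z W : Scheme.{u}} (i : Z ⟶ X) [Mono i] (f : Y ⟶ X)
    (j : W ⟶ Y) (𝒰 : Y.OpenCover)
    (h : ∀ a, ∃ (V : Scheme.{u}) (w : V ⟶ W) (u : V ⟶ 𝒰.X a) (z : V ⟶ Z),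
      IsPullback w u j (𝒰.f a) ∧ IsPullback z u i (𝒰.f a ≫ f)) :
    ∃ g, IsPullback g j i f := by
  choose V w u z h₁ h₂ using h
  have hw (a) : IsOpenImmersion (w a) := MorphismProperty.of_isPullback (h₁ a).flip inferInstance
  let 𝒲 : W.OpenCover := Scheme.Cover.mkOfCovers 𝒰.I₀ V w (by
    intro x
    obtain ⟨a, y, hy⟩ := 𝒰.exists_eq (j x)
    obtain ⟨v, hv, -⟩ := Scheme.exists_preimage_of_isPullback (h₁ a) x y hy.symm
    exact ⟨a, v, hv⟩) hw
  have key (a) : z a ≫ i = w a ≫ j ≫ f := by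
    rw [(h₂ a).w, reassoc_of% (h₁ a).w]
  obtain ⟨g, hg⟩ : ∃ g : W ⟶ Z, ∀ a, w a ≫ g = z a := by
    -- Agreement on overlaps comes for free: both sides have the same composite with the
    -- monomorphism `i`.
    have hz (a b : 𝒰.I₀) : pullback.fst (w a) (w b) ≫ z a = pullback.snd (w a) (w b) ≫ z b := by
      rw [← cancel_mono i, Category.assoc, Category.assoc, key, key]
      exact pullback.condition_assoc _
    exact ⟨𝒲.glueMorphisms z hz, 𝒲.ι_glueMorphisms z hz⟩
  have hgi : g ≫ i = j ≫ f := by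
    have h (a : 𝒰.I₀) : w a ≫ g ≫ i = w a ≫ j ≫ f := by rw [reassoc_of% hg a, key]
    exact 𝒲.hom_ext _ _ h
  obtain ⟨c, hc₁, hc₂⟩ : ∃ c : W ⟶ pullback i f, c ≫ pullback.fst i f = g ∧
      c ≫ pullback.snd i f = j :=
    ⟨pullback.lift g j hgi, pullback.lift_fst _ _ _, pullback.lift_snd _ _ _⟩
  have hp (a) : ∃ p : V a ⟶ pullback i f, p ≫ pullback.fst i f = z a ∧
      p ≫ pullback.snd i f = u a ≫ 𝒰.f a :=
    ⟨pullback.lift (z a) (u a ≫ 𝒰.f a) (by rw [(h₂ a).w, Category.assoc]),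
      pullback.lift_fst _ _ _, pullback.lift_snd _ _ _⟩
  choose p hp₁ hp₂ using hp
  have hp (a) : IsPullback (p a) (u a) (pullback.snd i f) (𝒰.f a) := by
    refine IsPullback.of_right (h₁₂ := pullback.fst i f) (h₂₂ := f) (v₁₃ := i) ?_ (hp₂ a)
      (IsPullback.of_hasPullback i f)
    rw [hp₁]
    exact h₂ a
  have hcp (a) : w a ≫ c = p a := by
    refine pullback.hom_ext ?_ ?_
    · rw [Category.assoc, hc₁, hg, hp₁]
    · rw [Category.assoc, hc₂, hp₂, (h₁ a).w]
  have hpo (a) : IsOpenImmersion (p a) := MorphismProperty.of_isPullback (hp a).flip inferInstance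
  let 𝒬 : (pullback i f).OpenCover := Scheme.Cover.mkOfCovers 𝒰.I₀ V p (by
    intro x
    obtain ⟨a, y, hy⟩ := 𝒰.exists_eq (pullback.snd i f x)
    obtain ⟨v, hv, -⟩ := Scheme.exists_preimage_of_isPullback (hp a) x y hy.symm
    exact ⟨a, v, hv⟩) hpo
  have hc : IsIso c := by
    refine IsZariskiLocalAtTarget.of_openCover (P := .isomorphisms Scheme) 𝒬 fun (a : 𝒰.I₀) => ?_
    -- Both `W` and the pullback restrict to `V a` over the a-th member of the cover, so the base
    -- change of `c` to `V a` is an isomorphism.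
    have h3 : IsPullback (w a) (𝟙 _) c (p a) := by
      refine IsPullback.of_bot (v₂₂ := pullback.snd i f) (v₂₁ := u a) (h₃₁ := 𝒰.f a) ?_
        (by simp [hcp]) (hp a)
      rw [hc₂, Category.id_comp]
      exact h₁ a
    have h4 := h3.isoPullback_inv_snd
    change IsIso (pullback.snd c (p a))
    rw [← h4]
    infer_instance
  exact ⟨g, IsPullback.of_iso (IsPullback.of_hasPullback i f) (asIso c).symm (Iso.refl _)
    (Iso.refl _) (Iso.refl _) (by simp [← hc₁]) (by simp [← hc₂]) (by simp) (by simp)⟩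

/-- A pushout square of rings, from a surjection `A → B` and a surjection `C → D` whose kernel is
generated by the image of the kernel of `A → B`. -/
lemma isPullback_specMap_of_ker_le {A B C D : Type u} [CommRing A] [CommRing B] [CommRing C]
    [CommRing D] (φ : A →+* B) (ψ : A →+* C) (β : B →+* D) (γ : C →+* D)
    (hφ : Function.Surjective φ) (hγ : Function.Surjective γ) (h : β.comp φ = γ.comp ψ)
    (hker : RingHom.ker γ ≤ (RingHom.ker φ).map ψ) :
    IsPullback (Spec.map (CommRingCat.ofHom β)) (Spec.map (CommRingCat.ofHom γ))
      (Spec.map (CommRingCat.ofHom φ)) (Spec.map (CommRingCat.ofHom ψ)) := by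
  refine isPullback_SpecMap_of_isPushout _ _ _ _ ⟨⟨by ext1; simp [h]⟩, ⟨?_⟩⟩
  refine PushoutCocone.IsColimit.mk _ (fun s => CommRingCat.ofHom
    (RingHom.liftOfSurjective γ hγ ⟨s.inr.hom, ?_⟩)) ?_ ?_ ?_
  -- `D` is the quotient of `C` by ker γ, so a map out of `C` descends once it kills the generators,
  -- namely the images of elements of ker φ; those die because the cocone factors through `B`.
  · refine hker.trans (Ideal.map_le_iff_le_comap.2 fun a ha => ?_)
    have := congrArg (fun f => f.hom a) s.condition
    simp only [CommRingCat.hom_comp, CommRingCat.hom_ofHom, RingHom.comp_apply] at this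
    rw [RingHom.mem_ker] at ha
    rw [Ideal.mem_comap, RingHom.mem_ker, ← this, ha, map_zero]
  · intro s
    ext b
    obtain ⟨a, rfl⟩ := hφ b
    have := congrArg (fun f => f.hom a) s.condition
    have h' := congrArg (fun f => f a) h
    simp only [CommRingCat.hom_comp, CommRingCat.hom_ofHom, RingHom.comp_apply] at this h' ⊢
    rw [h', this, RingHom.liftOfRightInverse_comp_apply]
  · intro s
    ext c
    simp [RingHom.liftOfRightInverse_comp_apply]
  · intro s m h1 h2
    ext d
    obtain ⟨c, rfl⟩ := hγ d
    have := congrArg (fun f => f.hom c) h2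
    simp only [CommRingCat.hom_comp, CommRingCat.hom_ofHom, RingHom.comp_apply] at this ⊢
    rw [RingHom.liftOfRightInverse_comp_apply, this]

end

section

/-! ### Lattices and cones -/

variable {N : Type u} [AddCommGroup N]

/-- An integral form of Gordan's theorem: if the integral vectors `v i` satisfy no nontrivial linear
relation with nonnegative coefficients, then some integral functional is positive on all of them. -/
lemma exists_int_forall_sum_pos {ι κ : Type*} [Fintype ι] [Fintype κ] (v : κ → ι → ℤ)
    (h : ∀ c : κ → ℝ, (∀ i, 0 ≤ c i) → (∀ j, ∑ i, c i * v i j = 0) → c = 0) :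
    ∃ f : ι → ℤ, ∀ i, 0 < ∑ j, f j * v i j := by
  classical
  let w : κ → ι → ℝ := fun i j => v i j
  -- A convex combination equal to zero would be a nonnegative relation whose coefficients sum to 1,
  -- hence a nontrivial one.
  have h0 : (0 : ι → ℝ) ∉ convexHull ℝ (Set.range w) := by
    intro h0
    rw [convexHull_range_eq_exists_affineCombination] at h0
    obtain ⟨t, c, hc, hsum, hw⟩ := h0
    rw [t.affineCombination_eq_linear_combination _ _ hsum] at hw
    have h1 := h (fun i => if i ∈ t then c i else 0)
      (fun i => by split_ifs with hi; exacts [hc i hi, le_rfl]) (fun j => by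
        have := congrFun hw j
        simp only [Finset.sum_apply, Pi.smul_apply, smul_eq_mul, Pi.zero_apply, w] at this
        simpa only [ite_mul, zero_mul, Finset.sum_ite_mem, Finset.univ_inter] using this)
    have h2 : ∀ i ∈ t, c i = 0 := fun i hi => by simpa [hi] using congrFun h1 i
    rw [Finset.sum_eq_zero h2] at hsum
    exact zero_ne_one hsum
  have hcl : IsClosed (convexHull ℝ (Set.range w)) :=
    (Set.finite_range w).isClosed_convexHull ℝ
  obtain ⟨f, u, hf0, hf⟩ := geometric_hahn_banach_point_closed (convex_convexHull ℝ _) hcl h0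
  rw [map_zero] at hf0
  have hfw (i : κ) : 0 < ∑ j, f (Pi.single j 1) * w i j := by
    have h1 := hf (w i) (subset_convexHull ℝ _ ⟨i, rfl⟩)
    have h2 : f (w i) = ∑ j, f (Pi.single j 1) * w i j := by
      conv_lhs => rw [pi_eq_sum_univ' (w i)]
      rw [map_sum]
      refine Finset.sum_congr rfl fun j _ => ?_
      rw [map_smul, smul_eq_mul, mul_comm]
    rw [← h2]
    exact hf0.trans h1
  -- Positivity on finitely many vectors is an open condition, so the real separating functional can
  -- be replaced by a rational one and then by an integral one, multiplying by the common
  -- denominator `d`.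
  let U : Set (ι → ℝ) := {g | ∀ i, 0 < ∑ j, g j * w i j}
  have hU : IsOpen U := by
    have : U = ⋂ i, {g | 0 < ∑ j, g j * w i j} := by ext; simp [U]
    rw [this]
    exact isOpen_iInter_of_finite fun i => isOpen_lt continuous_const (by fun_prop)
  have hd : DenseRange (fun (q : ι → ℚ) (j : ι) => (q j : ℝ)) :=
    DenseRange.piMap fun _ => Rat.isDenseEmbedding_coe_real.dense
  obtain ⟨q, hq⟩ := hd.exists_mem_open hU ⟨_, hfw⟩
  let d : ℤ := ∏ j, ((q j).den : ℤ)
  have hd : 0 < d := Finset.prod_pos fun j _ => by exact_mod_cast (q j).den_pos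
  have hg (j : ι) : ∃ n : ℤ, (n : ℝ) = d * (q j : ℝ) := by
    obtain ⟨e, he⟩ : ((q j).den : ℤ) ∣ d := Finset.dvd_prod_of_mem _ (Finset.mem_univ j)
    refine ⟨e * (q j).num, ?_⟩
    have h1 : ((q j).den : ℝ) * (q j : ℝ) = (q j).num := by
      exact_mod_cast Rat.den_mul_eq_num (q j)
    rw [he]
    push_cast
    rw [mul_comm ((q j).den : ℝ), mul_assoc, h1]
  choose g hg using hg
  refine ⟨g, fun i => ?_⟩
  have h1 : (0 : ℝ) < d * ∑ j, (q j : ℝ) * w i j := mul_pos (by exact_mod_cast hd) (hq i)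
  have h2 : ((∑ j, g j * v i j : ℤ) : ℝ) = d * ∑ j, (q j : ℝ) * w i j := by
    push_cast
    rw [Finset.mul_sum]
    refine Finset.sum_congr rfl fun j _ => ?_
    rw [hg, mul_assoc]
  rw [← h2] at h1
  exact_mod_cast h1

/-- This is exactness of L_ℝ → N_ℝ → (N / L)_ℝ in the middle. -/
lemma mem_realSpan_iff (L : Submodule ℤ N) (v : ℝ ⊗[ℤ] N) :
    v ∈ realSpan L ↔ L.mkQ.baseChange ℝ v = 0 :=
  ((lTensor_exact ℝ (f := L.subtype) (g := L.mkQ) (LinearMap.exact_subtype_mkQ _)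
    (Submodule.mkQ_surjective _)) v).symm

/-- If `σ ∩ L_ℝ` is a face of `σ`, it is cut out by an integral functional vanishing on `L`. -/
lemma IsSmoothCone.exists_dual_vanishing {σ : PointedCone ℝ (ℝ ⊗[ℤ] N)} (hσ : IsSmoothCone σ)
    {L : Submodule ℤ N} (hL : IsPrimitive L)
    (hF : (σ ⊓ PointedCone.ofSubmodule (realSpan L)).IsFaceOf σ) :
    ∃ m : Module.Dual ℤ N, (∀ n ∈ L, m n = 0) ∧ m ∈ dualMonoid σ ∧
      ∀ v ∈ σ, realEval m v = 0 → v ∈ realSpan L := by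
  classical
  have hfin := hσ.finite
  have := isTorsionFree_quotient hL
  have hfree : Module.Free ℤ (N ⧸ L) := inferInstance
  let c := Module.Free.chooseBasis ℤ (N ⧸ L)
  obtain ⟨n, b, s, rfl⟩ := hσ
  have hbs : ∀ i ∈ s, (1 : ℝ) ⊗ₜ[ℤ] b i ∈
      PointedCone.hull ℝ ((fun i => (1 : ℝ) ⊗ₜ[ℤ] b i) '' s) :=
    fun i hi => Submodule.subset_span ⟨i, hi, rfl⟩
  -- The generators of σ outside L_ℝ: these are the vectors on which the functional has to be
  -- positive.
  let κ := {i : Fin n // i ∈ s ∧ (1 : ℝ) ⊗ₜ[ℤ] b i ∉ realSpan L}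
  obtain ⟨f, hf⟩ := exists_int_forall_sum_pos
    (fun (i : κ) j => c.repr (L.mkQ (b i.1)) j) (by
      intro a ha h0
      -- A nonnegative relation among the images in N / L is a point of σ lying in L_ℝ. As σ ∩ L_ℝ
      -- is a face, each generator with positive coefficient would lie in L_ℝ, contrary to the
      -- choice of `κ`.
      have hmem : ∑ i : κ, a i • ((1 : ℝ) ⊗ₜ[ℤ] b i.1) ∈ realSpan L := by
        rw [mem_realSpan_iff]
        refine (c.baseChange ℝ).ext_elem fun j => ?_
        simp only [map_sum, map_smul, LinearMap.baseChange_tmul, Finsupp.finsetSum_apply,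
          Finsupp.smul_apply, repr_tmul, smul_eq_mul, map_zero, Finsupp.zero_apply]
        exact h0 j
      funext i
      by_contra hne
      have h1 := hF.mem_of_sum_smul_mem (ι := κ) (f := fun i => (1 : ℝ) ⊗ₜ[ℤ] b i.1) (c := a)
        (fun i => hbs _ i.2.1) ha
        ⟨Submodule.sum_mem _ fun i _ => PointedCone.smul_mem _ (ha i) (hbs _ i.2.1), hmem⟩
        i (lt_of_le_of_ne (ha i) (Ne.symm hne))
      exact i.2.2 h1.2)
  let m : Module.Dual ℤ N := (∑ j, f j • c.coord j) ∘ₗ L.mkQ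
  have hmL : ∀ n ∈ L, m n = 0 := by
    intro n hn
    have : L.mkQ n = 0 := by simpa using hn
    simp only [m, LinearMap.comp_apply, this, map_zero]
  have hmκ (i : κ) : 0 < m (b i.1) := by
    have : m (b i.1) = ∑ j, f j * c.repr (L.mkQ (b i.1)) j := by simp [m]
    rw [this]
    exact hf i
  have hm0 : ∀ i ∈ s, (1 : ℝ) ⊗ₜ[ℤ] b i ∈ realSpan L → m (b i) = 0 :=
    fun i _ h => hmL _ (mem_of_tmul_mem_realSpan hL h)
  have hnn : ∀ v ∈ PointedCone.hull ℝ ((fun i => (1 : ℝ) ⊗ₜ[ℤ] b i) '' s), ∀ i,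
      0 ≤ (b.baseChange ℝ).repr v i * (m (b i) : ℝ) := by
    intro v hv i
    rw [mem_hull_basis] at hv
    by_cases hi : i ∈ s
    · refine mul_nonneg (hv.1 i) ?_
      by_cases h : (1 : ℝ) ⊗ₜ[ℤ] b i ∈ realSpan L
      · rw [hm0 i hi h, Int.cast_zero]
      · exact_mod_cast (hmκ ⟨i, hi, h⟩).le
    · rw [hv.2 i hi, zero_mul]
  refine ⟨m, hmL, fun v hv => ?_, fun v hv h0 => ?_⟩
  · rw [realEval_eq_sum b]
    exact Finset.sum_nonneg fun i _ => hnn v hv i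
  · rw [realEval_eq_sum b, Finset.sum_eq_zero_iff_of_nonneg fun i _ => hnn v hv i] at h0
    rw [← (b.baseChange ℝ).sum_repr v]
    refine Submodule.sum_mem _ fun i _ => ?_
    by_cases hz : (b.baseChange ℝ).repr v i = 0
    · rw [hz, zero_smul]; exact zero_mem _
    have hi : i ∈ s := by
      by_contra hi
      exact hz (((mem_hull_basis b s v).1 hv).2 i hi)
    have hmi : m (b i) = 0 := by
      exact_mod_cast (mul_eq_zero.1 (h0 i (Finset.mem_univ i))).resolve_left hz
    refine Submodule.smul_mem _ _ ?_
    rw [Module.Basis.baseChange_apply]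
    by_contra hn
    exact (hmκ ⟨i, hi, hn⟩).ne' hmi

lemma restrictCone_maps (L : Submodule ℤ N) (σ : PointedCone ℝ (ℝ ⊗[ℤ] N)) :
    ∀ v ∈ restrictCone L σ, L.subtype.baseChange ℝ v ∈ σ := fun _ hv => hv

/-- Characters of `L` that are nonnegative on `σ ∩ L_ℝ` extend to characters of `N` that are
nonnegative on `σ`, if `σ ∩ L_ℝ` is a face of `σ`. -/
lemma IsSmoothCone.dualMonoidMap_subtype_surjective {σ : PointedCone ℝ (ℝ ⊗[ℤ] N)}
    (hσ : IsSmoothCone σ) {L : Submodule ℤ N} (hL : IsPrimitive L)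
    (hF : (σ ⊓ PointedCone.ofSubmodule (realSpan L)).IsFaceOf σ) :
    Function.Surjective (dualMonoidMap L.subtype (restrictCone_maps L σ)) := by
  have hfin := hσ.finite
  have := isTorsionFree_quotient hL
  have hfree : Module.Free ℤ (N ⧸ L) := inferInstance
  rintro ⟨l, hl⟩
  obtain ⟨m, hmL, hm, hm0⟩ := hσ.exists_dual_vanishing hL hF
  obtain ⟨p, hp⟩ := Module.projective_lifting_property L.mkQ LinearMap.id L.mkQ_surjective
  obtain ⟨r, hr⟩ : ∃ r : N →ₗ[ℤ] L, r ∘ₗ L.subtype = LinearMap.id := by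
    -- The section `p` of N → N / L exists because N / L is free; n ↦ n − p(n mod L) is then a
    -- retraction of N onto L.
    have hmem (n : N) : (LinearMap.id - p ∘ₗ L.mkQ : N →ₗ[ℤ] N) n ∈ L := by
      rw [← Submodule.Quotient.mk_eq_zero, ← Submodule.mkQ_apply]
      have := LinearMap.congr_fun hp (L.mkQ n)
      simp only [LinearMap.comp_apply, LinearMap.id_apply] at this
      simp only [LinearMap.sub_apply, LinearMap.id_apply, LinearMap.comp_apply, map_sub, this,
        sub_self]
    refine ⟨(LinearMap.id - p ∘ₗ L.mkQ).codRestrict L hmem, ?_⟩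
    ext x
    have : L.mkQ x = 0 := by simp
    simp only [LinearMap.comp_apply, Submodule.subtype_apply, LinearMap.codRestrict_apply,
      LinearMap.sub_apply, LinearMap.id_apply, this, map_zero, sub_zero]
  let u : Module.Dual ℤ N := l ∘ₗ r
  have hu : u ∘ₗ L.subtype = l := by
    rw [LinearMap.comp_assoc, hr, LinearMap.comp_id]
  -- Where m vanishes on σ the vector lies in L_ℝ, and there `u` equals `l`, which is nonnegative.
  -- On the finitely many other generators a large multiple of m compensates.
  obtain ⟨k, hk⟩ := hσ.exists_nsmul (u := u) hm (fun v hv h0 => by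
    obtain ⟨x, rfl⟩ := hm0 v hv h0
    rw [← realEval_comp, hu]
    exact hl x hv)
  refine ⟨⟨u + k • m, hk⟩, ?_⟩
  ext x
  have h1 := LinearMap.congr_fun hu x
  simp only [LinearMap.comp_apply, Submodule.subtype_apply] at h1
  simp [dualMonoidMap, h1, hmL x x.2]

end

section

/-! ### Semigroup rings and affine charts -/

/-- The kernel of the homomorphism of semigroup rings given by a surjection `f` is generated by the
differences of characters with the same image. -/
lemma ker_mapDomainRingHom_le (k : Type*) [CommRing k] {A B : Type*} [AddCommMonoid A]
    [AddCommMonoid B] (f : A →+ B) (hf : Function.Surjective f) :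
    RingHom.ker (AddMonoidAlgebra.mapDomainRingHom k f) ≤
      Ideal.span {x | ∃ a b, f a = f b ∧
        x = AddMonoidAlgebra.single a (1 : k) - AddMonoidAlgebra.single b 1} := by
  intro x hx
  set I := Ideal.span {x | ∃ a b, f a = f b ∧
        x = AddMonoidAlgebra.single a (1 : k) - AddMonoidAlgebra.single b 1}
  -- Modulo `I` each character may be replaced by the chosen representative of its fibre, so `x` is
  -- determined modulo `I` by its image.
  have key : ∀ x : AddMonoidAlgebra k A, x - AddMonoidAlgebra.mapDomain (Function.surjInv hf)
      (AddMonoidAlgebra.mapDomain f x) ∈ I := by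
    intro x
    induction x using AddMonoidAlgebra.induction_linear with
    | zero => simp
    | add x y hx hy =>
      rw [AddMonoidAlgebra.mapDomain_add, AddMonoidAlgebra.mapDomain_add, add_sub_add_comm]
      exact add_mem hx hy
    | single a r =>
      rw [AddMonoidAlgebra.mapDomain_single, AddMonoidAlgebra.mapDomain_single]
      have h := I.mul_mem_left (AddMonoidAlgebra.single 0 r) (Ideal.subset_span
        ⟨a, Function.surjInv hf (f a), (Function.surjInv_eq hf _).symm, rfl⟩)
      rw [mul_sub, AddMonoidAlgebra.single_mul_single, AddMonoidAlgebra.single_mul_single] at h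
      simpa using h
  have h := key x
  rw [RingHom.mem_ker, AddMonoidAlgebra.mapDomainRingHom_apply] at hx
  rwa [hx, AddMonoidAlgebra.mapDomain_zero, sub_zero] at h

lemma mapDomainRingHom_surjective (k : Type*) [CommRing k] {A B : Type*} [AddCommMonoid A]
    [AddCommMonoid B] (f : A →+ B) (hf : Function.Surjective f) :
    Function.Surjective (AddMonoidAlgebra.mapDomainRingHom k f) := by
  intro x
  refine ⟨AddMonoidAlgebra.mapDomain (Function.surjInv hf) x, ?_⟩
  induction x using AddMonoidAlgebra.induction_linear with
  | zero => simp
  | add x y hx hy => rw [AddMonoidAlgebra.mapDomain_add, map_add, hx, hy]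
  | single b r => simp [Function.surjInv_eq hf]

variable {N : Type u} [AddCommGroup N] (k : Type u) [Field k]

/-- M ≅ ℤ^n has unique sums, which excludes zero divisors in k[M]. The smooth cone only supplies a
finite basis of N. -/
lemma IsSmoothCone.isDomain_torus {σ : PointedCone ℝ (ℝ ⊗[ℤ] N)} (hσ : IsSmoothCone σ) :
    IsDomain (AddMonoidAlgebra k (Module.Dual ℤ N)) := by
  obtain ⟨n, b, s, rfl⟩ := hσ
  let e : Module.Dual ℤ N ≃+ (Fin n → ℤ) := (b.constr ℤ).symm.toAddEquiv
  have : UniqueSums (Module.Dual ℤ N) :=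
    UniqueSums.of_injective_addHom e.toAddHom e.injective inferInstance
  infer_instance

lemma mapDomainRingHom_subtype_injective (A : AddSubmonoid (Module.Dual ℤ N)) :
    Function.Injective (AddMonoidAlgebra.mapDomainRingHom k A.subtype) :=
  AddMonoidAlgebra.mapDomain_injective Subtype.val_injective

lemma IsSmoothCone.isReduced_affineChart {σ : PointedCone ℝ (ℝ ⊗[ℤ] N)} (hσ : IsSmoothCone σ) :
    IsReduced (affineChart k σ) := by
  have := hσ.isDomain_torus k
  have : _root_.IsReduced (AddMonoidAlgebra k (dualMonoid σ)) :=
    isReduced_of_injective _ (mapDomainRingHom_subtype_injective k (dualMonoid σ))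
  infer_instance

/-- A morphism of affine schemes given by an injective ring map is dominant. -/
lemma denseRange_torusToChart (σ : PointedCone ℝ (ℝ ⊗[ℤ] N)) : DenseRange (torusToChart k σ) := by
  refine (PrimeSpectrum.denseRange_comap_iff_ker_le_nilRadical _).2 ?_
  exact ((RingHom.injective_iff_ker_eq_bot _).1
    (mapDomainRingHom_subtype_injective k (dualMonoid σ))).trans_le bot_le

lemma torusToChart_chartMap {σ τ : PointedCone ℝ (ℝ ⊗[ℤ] N)} (h : σ ≤ τ) :
    torusToChart k σ ≫ chartMap k h = torusToChart k τ := by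
  rw [torusToChart, chartMap, torusToChart, ← Spec.map_comp, ← CommRingCat.ofHom_comp]
  congr 2
  refine AddMonoidAlgebra.ringHom_ext (fun r => ?_) (fun a => ?_)
  · simp [inclHom]
  · simp [inclHom]

lemma SmoothFan.torusInclusion_eq (S : SmoothFan N) {τ : PointedCone ℝ (ℝ ⊗[ℤ] N)}
    (hτ : τ ∈ S.cones) : S.torusInclusion k = torusToChart k τ ≫ S.chart k τ hτ := by
  rw [SmoothFan.torusInclusion, ← torusToChart_chartMap k (bot_le : ⊥ ≤ τ), Category.assoc,
    S.chartMap_chart k S.bot_mem]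

/-! ### Homomorphisms of tori and the closure of the subtorus on charts -/

variable {N₂ N₃ : Type u} [AddCommGroup N₂] [AddCommGroup N₃]

lemma torusToChart_toricChartMap (f : N →ₗ[ℤ] N₂) {σ : PointedCone ℝ (ℝ ⊗[ℤ] N)}
    {τ : PointedCone ℝ (ℝ ⊗[ℤ] N₂)} (h : ∀ v ∈ σ, f.baseChange ℝ v ∈ τ) :
    torusToChart k σ ≫ toricChartMap k f h = torusMap k f ≫ torusToChart k τ := by
  rw [torusToChart, toricChartMap, torusMap, torusToChart, ← Spec.map_comp, ← Spec.map_comp,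
    ← CommRingCat.ofHom_comp, ← CommRingCat.ofHom_comp]
  congr 2
  refine AddMonoidAlgebra.ringHom_ext (fun r => ?_) (fun a => ?_)
  · simp
  · simp; rfl

lemma torusMap_comp (f : N →ₗ[ℤ] N₂) (g : N₂ →ₗ[ℤ] N₃) :
    torusMap k f ≫ torusMap k g = torusMap k (g ∘ₗ f) := by
  rw [torusMap, torusMap, torusMap, ← Spec.map_comp, ← CommRingCat.ofHom_comp]
  congr 2
  refine AddMonoidAlgebra.ringHom_ext (fun r => ?_) (fun a => ?_)
  · simp
  · simp; rfl

lemma torusMap_id : torusMap k (LinearMap.id : N →ₗ[ℤ] N) = 𝟙 _ := by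
  rw [torusMap]
  refine Eq.trans ?_ (Spec.map_id _)
  congr 1
  ext1
  refine AddMonoidAlgebra.ringHom_ext (fun r => ?_) (fun a => ?_)
  · simp
  · simp

lemma isIso_torusMap (e : N ≃ₗ[ℤ] N₂) : IsIso (torusMap k (e : N →ₗ[ℤ] N₂)) :=
  ⟨torusMap k (e.symm : N₂ →ₗ[ℤ] N), by rw [torusMap_comp]; simp [torusMap_id],
    by rw [torusMap_comp]; simp [torusMap_id]⟩

/-- Every character is nonnegative on the zero cone. The cone is allowed to be only propositionally
zero because this is applied to the image of σ modulo N_σ. -/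
lemma isIso_torusToChart {σ : PointedCone ℝ (ℝ ⊗[ℤ] N)} (h : σ = ⊥) :
    IsIso (torusToChart k σ) := by
  have hs : Function.Surjective (dualMonoid σ).subtype := fun m =>
    ⟨⟨m, fun v hv => by
      rw [h, Submodule.mem_bot] at hv
      rw [hv, map_zero]⟩, rfl⟩
  have hb : Function.Bijective (AddMonoidAlgebra.mapDomainRingHom k (dualMonoid σ).subtype) :=
    ⟨mapDomainRingHom_subtype_injective k _, mapDomainRingHom_surjective k _ hs⟩
  rw [torusToChart, isIso_SpecMap_iff]
  exact hb

lemma isClosedImmersion_toricChartMap (f : N →ₗ[ℤ] N₂) {σ : PointedCone ℝ (ℝ ⊗[ℤ] N)}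
    {τ : PointedCone ℝ (ℝ ⊗[ℤ] N₂)} (h : ∀ v ∈ σ, f.baseChange ℝ v ∈ τ)
    (hs : Function.Surjective (dualMonoidMap f h)) : IsClosedImmersion (toricChartMap k f h) :=
  IsClosedImmersion.spec_of_surjective _ (mapDomainRingHom_surjective k _ hs)

lemma closure_range_comp {X Y Z : Scheme.{u}} (t : X ⟶ Y) (c : Y ⟶ Z) (ht : DenseRange t)
    [IsClosedImmersion c] : closure (Set.range (t ≫ c)) = Set.range c := by
  have h : Set.range (t ≫ c) = c '' Set.range t := by
    rw [← Set.range_comp]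
    congr 1
  rw [h, c.isClosedEmbedding.closure_image_eq, ht.closure_range, Set.image_univ]

/-- T' lies in every chart U_τ, and there it is the dense torus of the affine toric variety of τ ∩
L_ℝ; this lets the closure X' be computed chart by chart. -/
lemma subtorusInclusion_torusInclusion (S : SmoothFan N) (L : Submodule ℤ N)
    {τ : PointedCone ℝ (ℝ ⊗[ℤ] N)} (hτ : τ ∈ S.cones) :
    subtorusInclusion k L ≫ S.torusInclusion k = (torusToChart k (restrictCone L τ) ≫
      toricChartMap k L.subtype (restrictCone_maps L τ)) ≫ S.chart k τ hτ := by
  rw [torusToChart_toricChartMap, S.torusInclusion_eq k hτ, Category.assoc]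
  rfl

lemma isReduced_subtorusClosure (S : SmoothFan N) (L : Submodule ℤ N) :
    IsReduced (S.subtorusClosure k L).subscheme :=
  isReduced_vanishingIdeal _

lemma range_reducedClosure {X : Scheme.{u}} (Z : Set X) :
    Set.range (reducedClosure Z).subschemeι = closure Z := by
  rw [Scheme.IdealSheafData.range_subschemeι, reducedClosure,
    Scheme.IdealSheafData.coe_support_vanishingIdeal]
  rfl

/-- The closure of the subtorus `T'` meets the chart `U_τ` in the affine toric variety of the cone
`τ ∩ L_ℝ`. -/
lemma SmoothFan.exists_isPullback_subtorusClosure (S : SmoothFan N) {L : Submodule ℤ N}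
    (hL : IsPrimitive L) (hE : PropertyE S L) {τ : PointedCone ℝ (ℝ ⊗[ℤ] N)} (hτ : τ ∈ S.cones) :
    ∃ g : affineChart k (restrictCone L τ) ⟶ (S.subtorusClosure k L).subscheme,
      IsPullback g (toricChartMap k L.subtype (restrictCone_maps L τ))
        (S.subtorusClosure k L).subschemeι (S.chart k τ hτ) := by
  have h1 := isReduced_subtorusClosure k S L
  have h2 : IsReduced (affineChart k (restrictCone L τ)) :=
    ((S.induced L hL hE).smooth _ ⟨τ, hτ, rfl⟩).isReduced_affineChart k
  have h3 : IsClosedImmersion (toricChartMap k L.subtype (restrictCone_maps L τ)) :=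
    isClosedImmersion_toricChartMap k _ _
      ((S.smooth τ hτ).dualMonoidMap_subtype_surjective hL (hE τ hτ))
  refine exists_isPullback_of_range_eq _ _ _ ?_
  have hr := range_reducedClosure (Set.range (subtorusInclusion k L ≫ S.torusInclusion k))
  refine Eq.trans ?_ (congrArg (fun Z => S.chart k τ hτ ⁻¹' Z) hr.symm)
  -- Closures are compatible with restriction to an open subset, so X' ∩ U_τ is the closure of T'
  -- within U_τ, which is the image of the closed immersion.
  rw [(S.chart k τ hτ).isOpenEmbedding.isOpenMap.preimage_closure_eq_closure_preimage
    (S.chart k τ hτ).continuous, subtorusInclusion_torusInclusion k S L hτ,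
    ← closure_range_comp _ _ (denseRange_torusToChart k (restrictCone L τ))]
  congr 1
  ext y
  simp only [Set.mem_range, Set.mem_preimage, Scheme.Hom.comp_apply]
  exact ⟨fun ⟨x, hx⟩ => ⟨x, by rw [hx]⟩,
    fun ⟨x, hx⟩ => ⟨x, (S.chart k τ hτ).isOpenEmbedding.injective hx⟩⟩

end

section

/-! ### Charts of toric morphisms and of orbit closures -/

variable {N : Type u} [AddCommGroup N] (k : Type u) [Field k]

lemma SmoothFan.exists_chart_eq (S : SmoothFan N) (x : S.toricVariety k) :
    ∃ (σ : PointedCone ℝ (ℝ ⊗[ℤ] N)) (hσ : σ ∈ S.cones) (y : affineChart k σ),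
      S.chart k σ hσ y = x := by
  obtain ⟨σ, y, hy⟩ := Scheme.IsLocallyDirected.ι_jointly_surjective (S.diagram k) x
  exact ⟨σ.1, σ.2, y, hy⟩

/-- The charts are glued only along faces, so a coincidence of points in X is witnessed in the chart
of a common cone contained in σ ∩ τ. -/
lemma SmoothFan.exists_chartMap_inf_eq (S : SmoothFan N) {σ τ : PointedCone ℝ (ℝ ⊗[ℤ] N)}
    (hσ : σ ∈ S.cones) (hτ : τ ∈ S.cones) (x : affineChart k σ) (y : affineChart k τ)
    (hxy : S.chart k σ hσ x = S.chart k τ hτ y) :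
    ∃ z : affineChart k (σ ⊓ τ : PointedCone ℝ (ℝ ⊗[ℤ] N)), chartMap k inf_le_left z = x := by
  obtain ⟨κ, f, g, (z : affineChart k κ.1), hz, -⟩ :=
    Scheme.IsLocallyDirected.ι_eq_ι_iff (S.diagram k) |>.1 hxy
  have hκ : κ.1 ≤ σ ⊓ τ := le_inf (leOfHom f) (leOfHom g)
  refine ⟨chartMap k hκ z, ?_⟩
  rw [← Scheme.Hom.comp_apply, chartMap_comp]
  exact hz

lemma SmoothFan.chart_chartMap_apply (S : SmoothFan N) {σ τ : PointedCone ℝ (ℝ ⊗[ℤ] N)}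
    (hσ : σ ∈ S.cones) (hτ : τ ∈ S.cones) (h : σ ≤ τ) (x : affineChart k σ) :
    S.chart k τ hτ (chartMap k h x) = S.chart k σ hσ x := by
  rw [← Scheme.Hom.comp_apply, S.chartMap_chart k hσ hτ h]

variable {N₂ : Type u} [AddCommGroup N₂]

/-- The preimage of the chart `U_τ` under a toric morphism is the chart of `f⁻¹(τ)`, if this is a
cone of the fan. -/
lemma SmoothFan.isPullback_toricMap (S : SmoothFan N) (S₂ : SmoothFan N₂) (f : N →ₗ[ℤ] N₂)
    (h : ∀ σ ∈ S.cones, ∃ τ ∈ S₂.cones, ∀ v ∈ σ, f.baseChange ℝ v ∈ τ)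
    {ω : PointedCone ℝ (ℝ ⊗[ℤ] N)} (hω : ω ∈ S.cones) {τ : PointedCone ℝ (ℝ ⊗[ℤ] N₂)}
    (hτ : τ ∈ S₂.cones) (hf : ∀ v, v ∈ ω ↔ f.baseChange ℝ v ∈ τ) :
    IsPullback (S.chart k ω hω) (toricChartMap k f fun v hv => (hf v).1 hv)
      (S.toricMap k S₂ f h) (S₂.chart k τ hτ) := by
  have hcomm := S.chart_toricMap k S₂ f h hω hτ fun v hv => (hf v).1 hv
  refine (IsOpenImmersion.isPullback _ _ _ _ hcomm ?_).flip
  ext x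
  constructor
  · rintro ⟨p, hp⟩
    obtain ⟨σ, hσ, y, rfl⟩ := S.exists_chart_eq k x
    obtain ⟨τ', hτ', hστ⟩ := h σ hσ
    rw [← Scheme.Hom.comp_apply, S.chart_toricMap k S₂ f h hσ hτ' hστ,
      Scheme.Hom.comp_apply] at hp
    obtain ⟨z, hz⟩ := S₂.exists_chartMap_inf_eq k hτ' hτ _ _ hp.symm
    -- The character m cuts out τ' ∩ τ in τ', so χ^m is nonzero at the image of `y`. Its pullback m
    -- ∘ f cuts out σ ∩ f⁻¹(τ) = σ ∩ ω in σ and is nonzero at `y`, which places `y` in the chart of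
    -- σ ∩ ω.
    obtain ⟨m, hm, hmF⟩ := (S₂.smooth τ' hτ').exists_face (S₂.inf_isFaceOf τ' hτ' τ hτ)
    have hz' : toricChartMap k f hστ y ∈ Set.range (chartMap k (inf_le_left : τ' ⊓ τ ≤ τ')) :=
      ⟨z, hz⟩
    rw [(chartMap_face k (S₂.smooth τ' hτ') inf_le_left m hm hmF).2] at hz'
    have hm' : m ∘ₗ f ∈ dualMonoid σ := fun v hv => by
      rw [realEval_comp]
      exact hm _ (hστ v hv)
    have hF := (chartMap_face (F := σ ⊓ ω) k (S.smooth σ hσ) inf_le_left (m ∘ₗ f) hm' (fun v => by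
      rw [realEval_comp, Submodule.mem_inf, hf]
      refine and_congr_right fun hv => ?_
      have := hmF (f.baseChange ℝ v)
      rw [Submodule.mem_inf] at this
      exact ⟨fun h1 => (this.1 ⟨hστ v hv, h1⟩).2, fun h1 => (this.2 ⟨hστ v hv, h1⟩).2⟩)).2
    have hy : y ∈ Set.range (chartMap k (inf_le_left : σ ⊓ ω ≤ σ)) := by
      rw [hF]
      intro hmem
      refine hz' ?_
      change AddMonoidAlgebra.mapDomainRingHom k (dualMonoidMap f hστ)
        (AddMonoidAlgebra.single (⟨m, hm⟩ : dualMonoid τ') (1 : k)) ∈ y.asIdeal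
      rw [AddMonoidAlgebra.mapDomainRingHom_apply, AddMonoidAlgebra.mapDomain_single]
      exact hmem
    obtain ⟨w, rfl⟩ := hy
    refine ⟨chartMap k inf_le_right w, ?_⟩
    rw [S.chart_chartMap_apply k (S.inf_mem hσ hω), S.chart_chartMap_apply k (S.inf_mem hσ hω)]
  · rintro ⟨y, rfl⟩
    refine ⟨toricChartMap k f (fun v hv => (hf v).1 hv) y, ?_⟩
    rw [← Scheme.Hom.comp_apply, ← Scheme.Hom.comp_apply, hcomm]

/-! ### The closed immersion of X_{S^σ} in X_S and its image D_σ -/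

variable (S : SmoothFan N) {σ : PointedCone ℝ (ℝ ⊗[ℤ] N)} (hσ : σ ∈ S.cones)

/-- `starInclusion` is defined with a chosen preimage of each cone of the star. Inclusions between
quotient cones reflect inclusions of the cones themselves, so the choice can be replaced by τ. -/
lemma SmoothFan.chart_starInclusion {τ : PointedCone ℝ (ℝ ⊗[ℤ] N)} (hτ : τ ∈ S.cones ∧ σ ≤ τ) :
    (S.star σ hσ).chart k (quotientCone σ τ) (S.quotientCone_mem_star hσ hτ) ≫
        S.starInclusion k σ hσ =
      perpChartMap k hτ.2 (le_refl (quotientCone σ τ)) ≫ S.chart k τ hτ.1 := by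
  have hω := S.quotientCone_mem_star hσ hτ
  rw [SmoothFan.starInclusion, SmoothFan.chart_glue]
  have h1 := hω.choose_spec
  have hle : hω.choose ≤ τ :=
    (quotientCone_le_iff S h1.1.1 hτ.1 h1.1.2 hτ.2).1 h1.2.le
  have h2 := perpChartMap_chartMap k h1.1.2 hτ.2 h1.2.ge (le_refl (quotientCone σ τ)) hle le_rfl
  rw [chartMap_refl, Category.id_comp] at h2
  rw [h2, Category.assoc, S.chartMap_chart k h1.1.1 hτ.1 hle]

/-- Characters outside σ^⊥ restrict to zero on the orbit closure, so one that is nonzero at a point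
of it must be perpendicular to σ. -/
lemma perpChartMap_mem_basicOpen {σ τ : PointedCone ℝ (ℝ ⊗[ℤ] N)} (hle : σ ≤ τ)
    {ω : PointedCone ℝ (ℝ ⊗[ℤ] (N ⧸ coneLattice σ))} (hω : ω ≤ quotientCone σ τ)
    {m : Module.Dual ℤ N} (hm : m ∈ dualMonoid τ) (y : affineChart k ω)
    (hy : perpChartMap k hle hω y ∈
      (PrimeSpectrum.basicOpen (AddMonoidAlgebra.single (⟨m, hm⟩ : dualMonoid τ) (1 : k)) :
        Set (PrimeSpectrum (AddMonoidAlgebra k (dualMonoid τ))))) :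
    ∃ h : ∀ v ∈ σ, realEval m v = 0, y ∈
      (PrimeSpectrum.basicOpen (AddMonoidAlgebra.single
          (⟨descend m h, descend_mem h hω hm⟩ : dualMonoid ω) (1 : k)) :
        Set (PrimeSpectrum (AddMonoidAlgebra k (dualMonoid ω)))) := by
  have hy' : perpHom k hle hω (AddMonoidAlgebra.single ⟨m, hm⟩ 1) ∉ y.asIdeal := hy
  by_cases h : ∀ v ∈ σ, realEval m v = 0
  · rw [perpHom_single_of_perp k hle hω ⟨m, hm⟩ h] at hy'
    exact ⟨h, hy'⟩
  · rw [perpHom_single_of_not_perp k hle hω ⟨m, hm⟩ h] at hy'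
    exact absurd (zero_mem _) hy'

lemma realEval_descend {σ : PointedCone ℝ (ℝ ⊗[ℤ] N)} {m : Module.Dual ℤ N}
    (h : ∀ v ∈ σ, realEval m v = 0) (v : ℝ ⊗[ℤ] N) :
    realEval (descend m h) (coneProj σ v) = realEval m v := by
  have h1 : descend m h ∘ₗ (coneLattice σ).mkQ = m := Submodule.liftQ_mkQ _ _ _
  have h2 := realEval_comp (coneLattice σ).mkQ (descend m h) v
  rw [h1] at h2
  exact h2.symm

lemma SmoothFan.exists_chart_star_eq (x : (S.star σ hσ).toricVariety k) :
    ∃ (τ : PointedCone ℝ (ℝ ⊗[ℤ] N)) (hτ : τ ∈ S.cones ∧ σ ≤ τ)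
      (y : affineChart k (quotientCone σ τ)),
      (S.star σ hσ).chart k (quotientCone σ τ) (S.quotientCone_mem_star hσ hτ) y = x := by
  obtain ⟨_, ⟨τ, hτ, rfl⟩, y, hy⟩ := (S.star σ hσ).exists_chart_eq k x
  exact ⟨τ, hτ, y, hy⟩

/-- A point of `X_{S^σ}` that is mapped to the chart `U_τ` of `X_S` lies in the chart `U_τ̄`, and
`τ ⊇ σ`. -/
lemma SmoothFan.exists_of_starInclusion_eq {τ : PointedCone ℝ (ℝ ⊗[ℤ] N)} (hτ : τ ∈ S.cones)
    (x : (S.star σ hσ).toricVariety k) (p : affineChart k τ)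
    (hp : S.starInclusion k σ hσ x = S.chart k τ hτ p) :
    ∃ (hle : σ ≤ τ) (y : affineChart k (quotientCone σ τ)),
      (S.star σ hσ).chart k (quotientCone σ τ) (S.quotientCone_mem_star hσ ⟨hτ, hle⟩) y = x := by
  obtain ⟨τ', hτ', y, rfl⟩ := S.exists_chart_star_eq k hσ x
  rw [← Scheme.Hom.comp_apply, S.chart_starInclusion k hσ hτ', Scheme.Hom.comp_apply] at hp
  obtain ⟨z, hz⟩ := S.exists_chartMap_inf_eq k hτ'.1 hτ _ _ hp
  obtain ⟨m, hm, hmF⟩ := (S.smooth τ' hτ'.1).exists_face (S.inf_isFaceOf τ' hτ'.1 τ hτ)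
  have hz' : perpChartMap k hτ'.2 (le_refl (quotientCone σ τ')) y ∈
    Set.range (chartMap k (inf_le_left : τ' ⊓ τ ≤ τ')) := ⟨z, hz⟩
  rw [(chartMap_face k (S.smooth τ' hτ'.1) inf_le_left m hm hmF).2] at hz'
  obtain ⟨hmσ, hy⟩ := perpChartMap_mem_basicOpen k hτ'.2 (le_refl _) hm y hz'
  -- The character cutting out τ' ∩ τ is nonzero at a point of the orbit closure, hence lies in σ^⊥,
  -- and σ is contained in the face it defines.
  have hle : σ ≤ τ := fun v hv => ((hmF v).2 ⟨hτ'.2 hv, hmσ v hv⟩).2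
  refine ⟨hle, ?_⟩
  have hmem := (S.star σ hσ).inf_mem (S.quotientCone_mem_star hσ hτ')
    (S.quotientCone_mem_star hσ ⟨hτ, hle⟩)
  -- Having descended to N / N_σ, the same character cuts out the intersection of the two quotient
  -- cones. Vectors with equal image differ by elements of σ, on which it vanishes.
  have hF := (chartMap_face (F := quotientCone σ τ' ⊓ quotientCone σ τ) k
    ((S.star σ hσ).smooth _ (S.quotientCone_mem_star hσ hτ')) inf_le_left (descend m hmσ)
    (descend_mem hmσ le_rfl hm) (fun v => by
      constructor
      · rintro ⟨⟨w, hw, rfl⟩, w', hw', hww⟩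
        refine ⟨⟨w, hw, rfl⟩, ?_⟩
        refine (realEval_descend hmσ w).trans ?_
        obtain ⟨a, ha, b, hb, hab⟩ := exists_of_coneProj_eq (σ := σ) (v := w) (w := w') hww.symm
        have h1 : w + a ∈ τ' ⊓ τ :=
          ⟨add_mem hw (hτ'.2 ha), hab ▸ add_mem hw' (hle hb)⟩
        have h2 := ((hmF _).1 h1).2
        rwa [map_add, hmσ a ha, add_zero] at h2
      · rintro ⟨⟨w, hw, rfl⟩, h0⟩
        have h1 := (realEval_descend hmσ w).symm.trans h0
        exact ⟨⟨w, hw, rfl⟩, ⟨w, ((hmF w).2 ⟨hw, h1⟩).2, rfl⟩⟩)).2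
  have hy' : y ∈ Set.range (chartMap k (inf_le_left :
      quotientCone σ τ' ⊓ quotientCone σ τ ≤ quotientCone σ τ')) := by
    rw [hF]; exact hy
  obtain ⟨w, rfl⟩ := hy'
  refine ⟨chartMap k inf_le_right w, ?_⟩
  rw [(S.star σ hσ).chart_chartMap_apply k hmem, (S.star σ hσ).chart_chartMap_apply k hmem]

lemma SmoothFan.isPullback_starInclusion {τ : PointedCone ℝ (ℝ ⊗[ℤ] N)}
    (hτ : τ ∈ S.cones ∧ σ ≤ τ) :
    IsPullback ((S.star σ hσ).chart k (quotientCone σ τ) (S.quotientCone_mem_star hσ hτ))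
      (perpChartMap k hτ.2 (le_refl (quotientCone σ τ))) (S.starInclusion k σ hσ)
      (S.chart k τ hτ.1) := by
  have hcomm := S.chart_starInclusion k hσ hτ
  refine (IsOpenImmersion.isPullback _ _ _ _ hcomm ?_).flip
  ext x
  constructor
  · rintro ⟨p, hp⟩
    obtain ⟨_, y, hy⟩ := S.exists_of_starInclusion_eq k hσ hτ.1 x p hp.symm
    exact ⟨y, hy⟩
  · rintro ⟨y, rfl⟩
    refine ⟨perpChartMap k hτ.2 (le_refl (quotientCone σ τ)) y, ?_⟩
    rw [← Scheme.Hom.comp_apply, ← Scheme.Hom.comp_apply, hcomm]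

/-- The identification of the dual semigroup of the quotient cone with σ^⊥ ∩ τ^∨ ∩ M, by pulling
characters back to N. -/
lemma exists_dualMonoid_descend_eq {σ τ : PointedCone ℝ (ℝ ⊗[ℤ] N)} (hσ : IsSmoothCone σ)
    (a : dualMonoid (quotientCone σ τ)) :
    ∃ h : ∀ v ∈ σ, realEval (a.1 ∘ₗ (coneLattice σ).mkQ) v = 0,
      a.1 ∘ₗ (coneLattice σ).mkQ ∈ dualMonoid τ ∧ descend (a.1 ∘ₗ (coneLattice σ).mkQ) h = a.1 := by
  refine ⟨fun v hv => ?_, fun v hv => ?_, ?_⟩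
  · rw [realEval_comp]
    exact (congrArg _ (hσ.coneProj_eq_zero hv)).trans (map_zero _)
  · rw [realEval_comp]
    exact a.2 _ (coneProj_mem hv)
  · refine Submodule.linearMap_qext _ ?_
    exact Submodule.liftQ_mkQ _ _ _

lemma perpHom_surjective {σ τ : PointedCone ℝ (ℝ ⊗[ℤ] N)} (hσ : IsSmoothCone σ) (hle : σ ≤ τ) :
    Function.Surjective (perpHom k hle (le_refl (quotientCone σ τ))) := by
  intro x
  induction x using AddMonoidAlgebra.induction_on with
  | of a =>
    obtain ⟨h, hm, ha⟩ := exists_dualMonoid_descend_eq hσ a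
    refine ⟨AddMonoidAlgebra.single ⟨_, hm⟩ 1, ?_⟩
    rw [perpHom_single_of_perp k hle le_rfl ⟨_, hm⟩ h, AddMonoidAlgebra.of_apply]
    congr 1
    exact Subtype.ext ha
  | add x y hx hy =>
    obtain ⟨x, rfl⟩ := hx
    obtain ⟨y, rfl⟩ := hy
    exact ⟨x + y, map_add _ _ _⟩
  | smul r x hx =>
    obtain ⟨x, rfl⟩ := hx
    exact ⟨r • x, map_smul _ _ _⟩

lemma isClosedImmersion_perpChartMap {σ τ : PointedCone ℝ (ℝ ⊗[ℤ] N)} (hσ : IsSmoothCone σ)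
    (hle : σ ≤ τ) : IsClosedImmersion (perpChartMap k hle (le_refl (quotientCone σ τ))) :=
  IsClosedImmersion.spec_of_surjective _ (perpHom_surjective k hσ hle)

/-- The open cover of `X_S` by its affine charts. -/
noncomputable def SmoothFan.chartCover : (S.toricVariety k).OpenCover :=
  Scheme.Cover.mkOfCovers S.cones (fun τ => affineChart k τ.1) (fun τ => S.chart k τ.1 τ.2)
    (fun x => by
      obtain ⟨τ, hτ, y, hy⟩ := S.exists_chart_eq k x
      exact ⟨⟨τ, hτ⟩, y, hy⟩) (fun τ => inferInstance)

/-- The open cover of `X_{S^σ}` by the affine charts `U_τ̄` for `τ ⊇ σ`. -/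
noncomputable def SmoothFan.starChartCover : ((S.star σ hσ).toricVariety k).OpenCover :=
  Scheme.Cover.mkOfCovers {τ // τ ∈ S.cones ∧ σ ≤ τ} (fun τ => affineChart k (quotientCone σ τ.1))
    (fun τ => (S.star σ hσ).chart k (quotientCone σ τ.1) (S.quotientCone_mem_star hσ τ.2))
    (fun x => by
      obtain ⟨τ, hτ, y, hy⟩ := S.exists_chart_star_eq k hσ x
      exact ⟨⟨τ, hτ⟩, y, hy⟩) (fun τ => inferInstance)

lemma isClosedImmersion_of_isPullback {X Y : Scheme.{u}} (f : X ⟶ Y) (𝒰 : Y.OpenCover)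
    (h : ∀ a, ∃ (V : Scheme.{u}) (w : V ⟶ X) (c : V ⟶ 𝒰.X a),
      IsPullback w c f (𝒰.f a) ∧ IsClosedImmersion c) : IsClosedImmersion f := by
  refine IsZariskiLocalAtTarget.of_openCover (P := @IsClosedImmersion) 𝒰 fun a => ?_
  obtain ⟨V, w, c, hp, hc⟩ := h a
  change IsClosedImmersion (pullback.snd f (𝒰.f a))
  rw [← hp.isoPullback_inv_snd]
  infer_instance

lemma isClosedImmersion_of_isEmpty {X Y : Scheme.{u}} (f : X ⟶ Y) (_ : IsEmpty X) :
    IsClosedImmersion f := inferInstance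

/-- Over U_τ with τ ⊇ σ this is the surjection of semigroup rings. Over the remaining charts the
source is empty, since a point mapped into U_τ forces σ ≤ τ. -/
lemma SmoothFan.isClosedImmersion_starInclusion : IsClosedImmersion (S.starInclusion k σ hσ) := by
  refine isClosedImmersion_of_isPullback _ (S.chartCover k) fun (τ : S.cones) => ?_
  by_cases hle : σ ≤ τ.1
  · exact ⟨_, _, _, S.isPullback_starInclusion k hσ ⟨τ.2, hle⟩,
      isClosedImmersion_perpChartMap k (S.smooth σ hσ) hle⟩
  · refine ⟨_, _, _, IsPullback.of_hasPullback (S.starInclusion k σ hσ) (S.chart k τ.1 τ.2), ?_⟩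
    have hempty : IsEmpty ↥(pullback (S.starInclusion k σ hσ) (S.chart k τ.1 τ.2)) := by
      refine ⟨fun x => hle ?_⟩
      have hx := congrArg (fun φ => φ x)
        (pullback.condition (f := S.starInclusion k σ hσ) (g := S.chart k τ.1 τ.2))
      simp only [Scheme.Hom.comp_apply] at hx
      exact (S.exists_of_starInclusion_eq k hσ τ.2 _ _ hx).1
    exact isClosedImmersion_of_isEmpty _ hempty

lemma SmoothFan.denseRange_torusInclusion : DenseRange (S.torusInclusion k) := by
  intro x
  obtain ⟨τ, hτ, y, rfl⟩ := S.exists_chart_eq k x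
  rw [S.torusInclusion_eq k hτ]
  have h := (denseRange_torusToChart k τ) y
  have h2 := image_closure_subset_closure_image (S.chart k τ hτ).continuous ⟨y, h, rfl⟩
  rw [← Set.range_comp] at h2
  exact h2

lemma SmoothFan.isReduced_toricVariety : IsReduced (S.toricVariety k) := by
  have (τ : (S.chartCover k).I₀) : IsReduced ((S.chartCover k).X τ) :=
    (S.smooth _ τ.2).isReduced_affineChart k
  exact IsReduced.of_openCover _ (S.chartCover k)

/-- The orbit is the open torus of X_{S^σ}, so its closure in X is all of X_{S^σ}. -/
lemma SmoothFan.orbitInclusion_eq :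
    S.orbitInclusion k σ hσ = (S.star σ hσ).torusInclusion k ≫ S.starInclusion k σ hσ := by
  rw [(S.star σ hσ).torusInclusion_eq k (S.quotientCone_mem_star hσ ⟨hσ, le_rfl⟩), Category.assoc,
    S.chart_starInclusion k hσ ⟨hσ, le_rfl⟩]
  rfl

/-- The canonical isomorphism `X_{S^σ} ≅ D_σ`. -/
lemma SmoothFan.exists_iso_orbitClosure :
    ∃ e : (S.star σ hσ).toricVariety k ≅ (S.orbitClosure k σ hσ).subscheme,
      e.hom ≫ (S.orbitClosure k σ hσ).subschemeι = S.starInclusion k σ hσ := by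
  have h1 := S.isClosedImmersion_starInclusion k hσ
  have h2 := (S.star σ hσ).isReduced_toricVariety k
  have h3 : IsReduced (S.orbitClosure k σ hσ).subscheme := isReduced_vanishingIdeal _
  -- Taking the identity of X as the open immersion turns the comparison of preimages into
  -- uniqueness of the reduced closed subscheme on a given closed set.
  obtain ⟨g, hg⟩ := exists_isPullback_of_range_eq (S.orbitClosure k σ hσ).subschemeι (𝟙 _)
    (S.starInclusion k σ hσ) (by
      refine Eq.trans ?_ (range_reducedClosure _).symm
      rw [S.orbitInclusion_eq k hσ, closure_range_comp _ _
        ((S.star σ hσ).denseRange_torusInclusion k)])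
  have := hg.isIso_fst_of_isIso
  exact ⟨asIso g, by simpa using hg.w⟩

end

section

/-! ### Induced fans and quotients -/

variable {N : Type u} [AddCommGroup N] (k : Type u) [Field k] {L : Submodule ℤ N}
  {σ τ : PointedCone ℝ (ℝ ⊗[ℤ] N)}

lemma quotientLatticeMap_coneProj (L : Submodule ℤ N) (σ : PointedCone ℝ (ℝ ⊗[ℤ] N))
    (v : ℝ ⊗[ℤ] L) :
    (quotientLatticeMap L σ).baseChange ℝ (coneProj (restrictCone L σ) v) =
      coneProj σ (L.subtype.baseChange ℝ v) := by
  change ((quotientLatticeMap L σ).baseChange ℝ ∘ₗ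
      (coneLattice (restrictCone L σ)).mkQ.baseChange ℝ) v =
    ((coneLattice σ).mkQ.baseChange ℝ ∘ₗ L.subtype.baseChange ℝ) v
  rw [← LinearMap.baseChange_comp, ← LinearMap.baseChange_comp]
  rfl

lemma restrictCone_mono (L : Submodule ℤ N) (h : σ ≤ τ) : restrictCone L σ ≤ restrictCone L τ :=
  fun _ hv => h hv

/-- The cone of `τ ∩ L_ℝ` in the quotient by `σ` is the intersection of the quotient of `τ` with
`(L / N_σ)_ℝ`. -/
lemma mem_quotientCone_restrictCone (hL : IsPrimitive L) (hσ : IsSmoothCone σ) (hle : σ ≤ τ)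
    (hσL : σ ≤ PointedCone.ofSubmodule (realSpan L))
    (v : ℝ ⊗[ℤ] (L ⧸ coneLattice (restrictCone L σ))) :
    v ∈ quotientCone (restrictCone L σ) (restrictCone L τ) ↔
      (quotientLatticeMap L σ).baseChange ℝ v ∈ quotientCone σ τ := by
  constructor
  · rintro ⟨w, hw, rfl⟩
    exact ⟨L.subtype.baseChange ℝ w, hw, (quotientLatticeMap_coneProj L σ w).symm⟩
  · rintro ⟨t, ht, hvt⟩
    obtain ⟨w, rfl⟩ : ∃ w, coneProj (restrictCone L σ) w = v :=
      LinearMap.lTensor_surjective ℝ (Submodule.mkQ_surjective _) v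
    have h1 : coneProj σ (L.subtype.baseChange ℝ w) = coneProj σ t :=
      (quotientLatticeMap_coneProj L σ w).symm.trans hvt.symm
    obtain ⟨a, ha, b, hb, hab⟩ := exists_of_coneProj_eq h1
    obtain ⟨a, rfl⟩ := hσL ha
    -- A lift `w` of the vector to L_ℝ need not lie in τ, but w + a equals t + b with b in σ. As a ∈
    -- σ ⊆ L_ℝ, the correction stays in L_ℝ and dies in the quotient.
    refine ⟨w + a, ?_, ?_⟩
    · change L.subtype.baseChange ℝ (w + a) ∈ τ
      rw [map_add, hab]
      exact add_mem ht (hle hb)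
    · refine (map_add (coneProj (restrictCone L σ)) w a).trans ?_
      rw [(hσ.restrict hL hσL).coneProj_eq_zero ha, add_zero]

lemma coneLattice_le [Module.Finite ℤ N] (hL : IsPrimitive L)
    (hσL : σ ≤ PointedCone.ofSubmodule (realSpan L)) : coneLattice σ ≤ L :=
  Submodule.span_le.2 fun _ hn => mem_of_tmul_mem_realSpan hL (hσL hn)

lemma isPrimitive_map_mkQ [Module.Finite ℤ N] (hL : IsPrimitive L)
    (hσL : σ ≤ PointedCone.ofSubmodule (realSpan L)) :
    IsPrimitive (L.map (coneLattice σ).mkQ) := by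
  have hmem (n : N) : (coneLattice σ).mkQ n ∈ L.map (coneLattice σ).mkQ ↔ n ∈ L := by
    refine ⟨?_, fun h => ⟨n, h, rfl⟩⟩
    rintro ⟨l, hl, h⟩
    have h1 : l - n ∈ coneLattice σ := by
      rw [← Submodule.Quotient.mk_eq_zero, ← Submodule.mkQ_apply, map_sub, h, sub_self]
    have h2 := L.sub_mem hl (coneLattice_le hL hσL h1)
    rwa [sub_sub_cancel] at h2
  intro a x ha hx
  obtain ⟨n, rfl⟩ := (coneLattice σ).mkQ_surjective x
  rw [← map_smul, hmem] at hx
  rw [hmem]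
  exact hL a n ha hx

/-- The kernel of the projection is spanned by σ, which is contained in L_ℝ; hence L_ℝ is saturated
under it. -/
lemma coneProj_mem_realSpan_iff (hσL : σ ≤ PointedCone.ofSubmodule (realSpan L))
    (v : ℝ ⊗[ℤ] N) :
    coneProj σ v ∈ realSpan (L.map (coneLattice σ).mkQ) ↔ v ∈ realSpan L := by
  have hcomm : ∀ w : ℝ ⊗[ℤ] L, (L.map (coneLattice σ).mkQ).subtype.baseChange ℝ
      (((coneLattice σ).mkQ.submoduleMap L).baseChange ℝ w) =
        coneProj σ (L.subtype.baseChange ℝ w) := by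
    intro w
    change ((L.map (coneLattice σ).mkQ).subtype.baseChange ℝ ∘ₗ
        ((coneLattice σ).mkQ.submoduleMap L).baseChange ℝ) w =
      ((coneLattice σ).mkQ.baseChange ℝ ∘ₗ L.subtype.baseChange ℝ) w
    rw [← LinearMap.baseChange_comp, ← LinearMap.baseChange_comp]
    rfl
  constructor
  · rintro ⟨x, hx⟩
    obtain ⟨w, rfl⟩ : ∃ w, ((coneLattice σ).mkQ.submoduleMap L).baseChange ℝ w = x :=
      LinearMap.lTensor_surjective ℝ ((coneLattice σ).mkQ.submoduleMap_surjective L) x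
    rw [hcomm] at hx
    obtain ⟨a, ha, b, hb, hab⟩ := exists_of_coneProj_eq hx
    have h1 : L.subtype.baseChange ℝ w + a ∈ realSpan L := add_mem ⟨w, rfl⟩ (hσL ha)
    rw [hab] at h1
    exact (Submodule.add_mem_iff_left _ (hσL hb)).1 h1
  · rintro ⟨w, rfl⟩
    exact ⟨_, hcomm w⟩

/-- By saturation of L_ℝ, a point of the quotient cone lies in the quotient subspace exactly when
its lifts to τ lie in L_ℝ. The face condition for τ thus passes to its image. -/
lemma SmoothFan.propertyE_star (S : SmoothFan N) (hE : PropertyE S L) (hσ : σ ∈ S.cones)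
    (hσL : σ ≤ PointedCone.ofSubmodule (realSpan L)) :
    PropertyE (S.star σ hσ) (L.map (coneLattice σ).mkQ) := by
  rintro _ ⟨τ, ⟨hτ, hle⟩, rfl⟩
  refine ⟨inf_le_left, ?_⟩
  rintro _ _ a ⟨x, hx, rfl⟩ ⟨y, hy, rfl⟩ ha ⟨-, h⟩
  have h' : coneProj σ (a • x + y) ∈ realSpan (L.map (coneLattice σ).mkQ) := by
    rw [map_add, map_smul]
    exact h
  rw [coneProj_mem_realSpan_iff hσL] at h'
  have h1 := (hE τ hτ).mem_of_smul_add_mem hx hy ha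
    ⟨add_mem (PointedCone.smul_mem _ ha.le hx) hy, h'⟩
  exact ⟨⟨x, hx, rfl⟩, (coneProj_mem_realSpan_iff hσL x).2 h1.2⟩

end

section

/-! ### Cartesian squares of affine charts -/

variable {N : Type u} [AddCommGroup N] (k : Type u) [Field k] {L : Submodule ℤ N}
  {σ τ : PointedCone ℝ (ℝ ⊗[ℤ] N)}

lemma quotientLatticeMap_maps (L : Submodule ℤ N) (σ τ : PointedCone ℝ (ℝ ⊗[ℤ] N)) :
    ∀ v ∈ quotientCone (restrictCone L σ) (restrictCone L τ),
      (quotientLatticeMap L σ).baseChange ℝ v ∈ quotientCone σ τ := by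
  rintro _ ⟨w, hw, rfl⟩
  exact ⟨L.subtype.baseChange ℝ w, hw, (quotientLatticeMap_coneProj L σ w).symm⟩

lemma quotientLatticeMap_comp_mkQ (L : Submodule ℤ N) (σ : PointedCone ℝ (ℝ ⊗[ℤ] N)) :
    quotientLatticeMap L σ ∘ₗ (coneLattice (restrictCone L σ)).mkQ =
      (coneLattice σ).mkQ ∘ₗ L.subtype := rfl

/-- Pull the character back to L and extend it to τ^∨. The extension vanishes on σ because σ ⊆ L_ℝ,
so it descends to N / N_σ. -/
lemma dualMonoidMap_quotientLatticeMap_surjective (hτ : IsSmoothCone τ) (hL : IsPrimitive L)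
    (hF : (τ ⊓ PointedCone.ofSubmodule (realSpan L)).IsFaceOf τ) (hσ : IsSmoothCone σ)
    (hσL : σ ≤ PointedCone.ofSubmodule (realSpan L)) :
    Function.Surjective
      (dualMonoidMap (quotientLatticeMap L σ) (quotientLatticeMap_maps L σ τ)) := by
  intro a
  obtain ⟨h0, hm, -⟩ := exists_dualMonoid_descend_eq (hσ.restrict hL hσL) a
  obtain ⟨⟨m, hm'⟩, hmm⟩ := hτ.dualMonoidMap_subtype_surjective hL hF ⟨_, hm⟩
  have hmm' : m ∘ₗ L.subtype = a.1 ∘ₗ (coneLattice (restrictCone L σ)).mkQ :=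
    congrArg Subtype.val hmm
  have hσ0 : ∀ v ∈ σ, realEval m v = 0 := by
    intro v hv
    obtain ⟨w, rfl⟩ := hσL hv
    rw [← realEval_comp, hmm']
    exact h0 w hv
  refine ⟨⟨descend m hσ0, descend_mem hσ0 le_rfl hm'⟩, ?_⟩
  refine Subtype.ext (Submodule.linearMap_qext _ ?_)
  change (descend m hσ0 ∘ₗ quotientLatticeMap L σ) ∘ₗ (coneLattice (restrictCone L σ)).mkQ = _
  rw [LinearMap.comp_assoc, quotientLatticeMap_comp_mkQ, ← LinearMap.comp_assoc]
  have h1 : descend m hσ0 ∘ₗ (coneLattice σ).mkQ = m := Submodule.liftQ_mkQ _ _ _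
  rw [h1, hmm']

/-- The affine toric variety of `τ ∩ L_ℝ` meets the orbit closure in the affine toric variety of its
quotient by `σ`. -/
lemma isPullback_perpChartMap (hτ : IsSmoothCone τ) (hL : IsPrimitive L)
    (hF : (τ ⊓ PointedCone.ofSubmodule (realSpan L)).IsFaceOf τ) (hσ : IsSmoothCone σ)
    (hle : σ ≤ τ) (hσL : σ ≤ PointedCone.ofSubmodule (realSpan L)) :
    IsPullback
      (perpChartMap k (restrictCone_mono L hle)
        (le_refl (quotientCone (restrictCone L σ) (restrictCone L τ))))
      (toricChartMap k (quotientLatticeMap L σ) (quotientLatticeMap_maps L σ τ))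
      (toricChartMap k L.subtype (restrictCone_maps L τ))
      (perpChartMap k hle (le_refl (quotientCone σ τ))) := by
  have hs := dualMonoidMap_quotientLatticeMap_surjective hτ hL hF hσ hσL
  refine isPullback_specMap_of_ker_le _ _ _ _
    (mapDomainRingHom_surjective k _ (hτ.dualMonoidMap_subtype_surjective hL hF))
    (mapDomainRingHom_surjective k _ hs) ?_ ?_
  · refine AddMonoidAlgebra.ringHom_ext (fun r => ?_) (fun m => ?_)
    · have h1 := AlgHom.commutes (perpHom k hle (le_refl (quotientCone σ τ))) r
      have h2 := AlgHom.commutes (perpHom k (restrictCone_mono L hle)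
        (le_refl (quotientCone (restrictCone L σ) (restrictCone L τ)))) r
      simp only [AddMonoidAlgebra.coe_algebraMap, Function.comp_apply, Algebra.algebraMap_self,
        RingHom.id_apply] at h1 h2
      simp only [RingHom.comp_apply, AlgHom.toRingHom_eq_coe, RingHom.coe_coe, h1,
        AddMonoidAlgebra.mapDomainRingHom_apply, AddMonoidAlgebra.mapDomain_single, map_zero, h2]
    · simp only [RingHom.comp_apply, AlgHom.toRingHom_eq_coe, RingHom.coe_coe,
        AddMonoidAlgebra.mapDomainRingHom_apply, AddMonoidAlgebra.mapDomain_single]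
      -- Since σ ⊆ L_ℝ, being perpendicular to σ can be tested after restriction to L, so both
      -- composites kill the same characters.
      by_cases h : ∀ v ∈ σ, realEval m.1 v = 0
      · have h' : ∀ v ∈ restrictCone L σ,
            realEval (dualMonoidMap L.subtype (restrictCone_maps L τ) m).1 v = 0 := by
          intro v hv
          refine (realEval_comp L.subtype m.1 v).trans (h _ hv)
        rw [perpHom_single_of_perp k hle le_rfl m h,
          perpHom_single_of_perp k (restrictCone_mono L hle) le_rfl _ h',
          AddMonoidAlgebra.mapDomain_single]
        congr 1
        refine Subtype.ext (Submodule.linearMap_qext _ ?_)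
        rfl
      · have h' : ¬ ∀ v ∈ restrictCone L σ,
            realEval (dualMonoidMap L.subtype (restrictCone_maps L τ) m).1 v = 0 := by
          intro h'
          refine h fun v hv => ?_
          obtain ⟨w, rfl⟩ := hσL hv
          exact (realEval_comp L.subtype m.1 w).symm.trans (h' w hv)
        rw [perpHom_single_of_not_perp k hle le_rfl m h,
          perpHom_single_of_not_perp k (restrictCone_mono L hle) le_rfl _ h',
          AddMonoidAlgebra.mapDomain_zero]
  · refine (ker_mapDomainRingHom_le k _ hs).trans (Ideal.span_le.2 ?_)
    rintro _ ⟨a, b, hab, rfl⟩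
    obtain ⟨ha0, ha, had⟩ := exists_dualMonoid_descend_eq hσ a
    obtain ⟨hb0, hb, hbd⟩ := exists_dualMonoid_descend_eq hσ b
    have hab' : a.1 ∘ₗ quotientLatticeMap L σ = b.1 ∘ₗ quotientLatticeMap L σ :=
      congrArg Subtype.val hab
    have key : AddMonoidAlgebra.single (⟨_, ha⟩ : dualMonoid τ) (1 : k) -
        AddMonoidAlgebra.single (⟨_, hb⟩ : dualMonoid τ) 1 ∈ RingHom.ker
          (AddMonoidAlgebra.mapDomainRingHom k
            (dualMonoidMap L.subtype (restrictCone_maps L τ))) := by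
      rw [RingHom.mem_ker, map_sub, AddMonoidAlgebra.mapDomainRingHom_apply,
        AddMonoidAlgebra.mapDomainRingHom_apply, AddMonoidAlgebra.mapDomain_single,
        AddMonoidAlgebra.mapDomain_single, sub_eq_zero]
      congr 1
      refine Subtype.ext ?_
      change (a.1 ∘ₗ (coneLattice σ).mkQ) ∘ₗ L.subtype = (b.1 ∘ₗ (coneLattice σ).mkQ) ∘ₗ L.subtype
      rw [LinearMap.comp_assoc, LinearMap.comp_assoc, ← quotientLatticeMap_comp_mkQ,
        ← LinearMap.comp_assoc, ← LinearMap.comp_assoc, hab']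
    have h := Ideal.mem_map_of_mem
      (perpHom k hle (le_refl (quotientCone σ τ))).toRingHom key
    rw [map_sub] at h
    have e1 := perpHom_single_of_perp k hle (le_refl (quotientCone σ τ)) ⟨_, ha⟩ ha0
    have e2 := perpHom_single_of_perp k hle (le_refl (quotientCone σ τ)) ⟨_, hb⟩ hb0
    simp only [had, hbd] at e1 e2
    change perpHom k hle (le_refl (quotientCone σ τ)) _ - perpHom k hle (le_refl (quotientCone σ τ)) _ ∈ _ at h
    rw [e1, e2] at h
    exact h

/-- For a face `σ` of a smooth cone `τ`, there is a projection of the lattice to `N_σ` such that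
`τ` is the sum of its projection `σ` and its projection to the complement. -/
lemma IsSmoothCone.exists_projection (hτ : IsSmoothCone τ) (h : σ.IsFaceOf τ) :
    ∃ t : N →ₗ[ℤ] N, (∀ n ∈ coneLattice σ, t n = n) ∧ (∀ n, t n ∈ coneLattice σ) ∧
      (∀ v ∈ τ, t.baseChange ℝ v ∈ σ) ∧ ∀ v ∈ τ, v - t.baseChange ℝ v ∈ τ := by
  classical
  obtain ⟨n, b, s, rfl⟩ := hτ
  have hσ := eq_hull_of_isFaceOf b s h
  set s' : Set (Fin n) := {i | i ∈ s ∧ (1 : ℝ) ⊗ₜ[ℤ] b i ∈ σ} with hs'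
  have hs's : s' ⊆ s := fun i hi => hi.1
  clear_value s'
  subst hσ
  -- Coordinate projection: it keeps the basis vectors generating σ and kills all others, including
  -- the remaining generators of τ.
  let t : N →ₗ[ℤ] N := b.constr ℤ fun i => if i ∈ s' then b i else 0
  have ht : ∀ i, t (b i) = if i ∈ s' then b i else 0 := fun i => by
    simp only [t, Module.Basis.constr_basis]
  have htr (v : ℝ ⊗[ℤ] N) (i : Fin n) : (b.baseChange ℝ).repr (t.baseChange ℝ v) i =
      if i ∈ s' then (b.baseChange ℝ).repr v i else 0 := by
    induction v with
    | zero => simp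
    | add x y hx hy =>
      rw [map_add, map_add, Finsupp.add_apply, hx, hy]
      split_ifs <;> simp
    | tmul r m =>
      have hm : b.repr (t m) i = if i ∈ s' then b.repr m i else 0 := by
        conv_lhs => rw [← b.sum_repr m]
        rw [map_sum, map_sum, Finsupp.finsetSum_apply, Finset.sum_eq_single i]
        · rw [map_smul, ht]
          split_ifs <;> simp
        · intro j _ hj
          rw [map_smul, ht]
          split_ifs <;> simp [hj]
        · simp
      rw [LinearMap.baseChange_tmul, Module.Basis.baseChange_repr_tmul,
        Module.Basis.baseChange_repr_tmul, hm]
      split_ifs <;> simp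
  refine ⟨t, fun m hm => ?_, fun m => ?_, fun v hv => ?_, fun v hv => ?_⟩
  · rw [mem_coneLattice] at hm
    conv_lhs => rw [← b.sum_repr m]
    conv_rhs => rw [← b.sum_repr m]
    rw [map_sum]
    refine Finset.sum_congr rfl fun i _ => ?_
    rw [map_smul, ht]
    split_ifs with hi
    · rfl
    · rw [hm i hi, zero_smul, zero_smul]
  · rw [← b.sum_repr m, map_sum]
    refine Submodule.sum_mem _ fun i _ => ?_
    rw [map_smul, ht]
    split_ifs with hi
    · exact Submodule.smul_mem _ _ (Submodule.subset_span (Submodule.subset_span ⟨i, hi, rfl⟩))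
    · rw [smul_zero]; exact zero_mem _
  · rw [mem_hull_basis] at hv ⊢
    refine ⟨fun i => ?_, fun i hi => ?_⟩
    · rw [htr]
      split_ifs
      exacts [hv.1 i, le_rfl]
    · rw [htr, if_neg hi]
  · rw [mem_hull_basis] at hv ⊢
    refine ⟨fun i => ?_, fun i hi => ?_⟩
    · rw [map_sub, Finsupp.sub_apply, htr]
      split_ifs
      exacts [(sub_self _).ge, by simpa using hv.1 i]
    · rw [map_sub, Finsupp.sub_apply, htr, if_neg fun h => hi (hs's h), sub_zero]
      exact hv.2 i hi

/-- A character in `τ^∨` is the sum of a character in `τ^∨` that only depends on the restriction to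
`N_σ`, and a character in `τ^∨ ∩ σ^⊥`. -/
lemma IsSmoothCone.exists_decomposition (hτ : IsSmoothCone τ) (h : σ.IsFaceOf τ) :
    ∃ t : N →ₗ[ℤ] N, (∀ n ∈ coneLattice σ, t n = n) ∧ (∀ n, t n ∈ coneLattice σ) ∧
      ∀ a ∈ dualMonoid τ, a ∘ₗ t ∈ dualMonoid τ ∧
        ∃ a' : dualMonoid (quotientCone σ τ), a = a ∘ₗ t + a'.1 ∘ₗ (coneLattice σ).mkQ := by
  obtain ⟨t, h1, h2, h3, h4⟩ := hτ.exists_projection h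
  refine ⟨t, h1, h2, fun a ha => ⟨fun v hv => ?_, ?_⟩⟩
  · rw [realEval_comp]
    exact ha _ (h.le (h3 v hv))
  · have hker : coneLattice σ ≤ LinearMap.ker (a - a ∘ₗ t) := fun n hn => by
      simp [h1 n hn]
    have hq : (coneLattice σ).liftQ (a - a ∘ₗ t) hker ∘ₗ (coneLattice σ).mkQ = a - a ∘ₗ t :=
      Submodule.liftQ_mkQ _ _ _
    refine ⟨⟨(coneLattice σ).liftQ (a - a ∘ₗ t) hker, ?_⟩, ?_⟩
    · rintro _ ⟨v, hv, rfl⟩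
      have h5 := realEval_comp (coneLattice σ).mkQ ((coneLattice σ).liftQ (a - a ∘ₗ t) hker) v
      rw [hq] at h5
      refine le_of_le_of_eq ?_ h5
      have h6 := ha _ (h4 v hv)
      rw [map_sub, ← realEval_comp] at h6
      rwa [sub_eq_add_neg, realEval_add, realEval_neg, ← sub_eq_add_neg]
    · simp only [hq, add_sub_cancel]

/-- The affine toric variety of `τ ∩ L_ℝ` is the preimage of the affine toric variety of its
quotient by `σ`. -/
lemma isPullback_quotientChartMap (hτ : IsSmoothCone τ) (hL : IsPrimitive L)
    (hF : (τ ⊓ PointedCone.ofSubmodule (realSpan L)).IsFaceOf τ) (h : σ.IsFaceOf τ)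
    (hσ : IsSmoothCone σ) (hσL : σ ≤ PointedCone.ofSubmodule (realSpan L)) :
    IsPullback (quotientChartMap k (restrictCone L σ) (restrictCone L τ))
      (toricChartMap k L.subtype (restrictCone_maps L τ))
      (toricChartMap k (quotientLatticeMap L σ) (quotientLatticeMap_maps L σ τ))
      (quotientChartMap k σ τ) := by
  have hfin := hτ.finite
  refine isPullback_specMap_of_ker_le _ _ _ _
    (mapDomainRingHom_surjective k _
      (dualMonoidMap_quotientLatticeMap_surjective hτ hL hF hσ hσL))
    (mapDomainRingHom_surjective k _ (hτ.dualMonoidMap_subtype_surjective hL hF)) ?_ ?_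
  · refine AddMonoidAlgebra.ringHom_ext (fun r => ?_) (fun m => ?_)
    · simp
    · simp only [RingHom.comp_apply, AddMonoidAlgebra.mapDomainRingHom_apply,
        AddMonoidAlgebra.mapDomain_single]
      rfl
  · refine (ker_mapDomainRingHom_le k _ (hτ.dualMonoidMap_subtype_surjective hL hF)).trans
      (Ideal.span_le.2 ?_)
    rintro _ ⟨⟨a, ha⟩, ⟨b, hb⟩, hab, rfl⟩
    have hab' : a ∘ₗ L.subtype = b ∘ₗ L.subtype := congrArg Subtype.val hab
    obtain ⟨t, -, ht2, ht3⟩ := hτ.exists_decomposition h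
    obtain ⟨hat, a', ha'⟩ := ht3 a ha
    obtain ⟨hbt, b', hb'⟩ := ht3 b hb
    -- The projection takes values in N_σ ⊆ L, where a and b agree; the two N_σ-parts coincide and
    -- can be factored out of the binomial.
    have htab : a ∘ₗ t = b ∘ₗ t := by
      ext n
      exact LinearMap.congr_fun hab' ⟨t n, coneLattice_le hL hσL (ht2 n)⟩
    have key : AddMonoidAlgebra.single a' (1 : k) - AddMonoidAlgebra.single b' 1 ∈ RingHom.ker
        (AddMonoidAlgebra.mapDomainRingHom k
          (dualMonoidMap (quotientLatticeMap L σ) (quotientLatticeMap_maps L σ τ))) := by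
      rw [RingHom.mem_ker, map_sub, AddMonoidAlgebra.mapDomainRingHom_apply,
        AddMonoidAlgebra.mapDomainRingHom_apply, AddMonoidAlgebra.mapDomain_single,
        AddMonoidAlgebra.mapDomain_single, sub_eq_zero]
      congr 1
      refine Subtype.ext (Submodule.linearMap_qext _ ?_)
      change (a'.1 ∘ₗ (coneLattice σ).mkQ) ∘ₗ L.subtype =
        (b'.1 ∘ₗ (coneLattice σ).mkQ) ∘ₗ L.subtype
      rw [eq_sub_of_add_eq' ha'.symm, eq_sub_of_add_eq' hb'.symm, LinearMap.sub_comp, LinearMap.sub_comp, hab', htab]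
    have hI := Ideal.mem_map_of_mem (AddMonoidAlgebra.mapDomainRingHom k
      (dualMonoidMap (coneLattice σ).mkQ (σ := τ) (τ := quotientCone σ τ)
        fun _ hv => coneProj_mem hv)) key
    rw [map_sub, AddMonoidAlgebra.mapDomainRingHom_apply, AddMonoidAlgebra.mapDomainRingHom_apply,
      AddMonoidAlgebra.mapDomain_single, AddMonoidAlgebra.mapDomain_single] at hI
    have hI' := Ideal.mul_mem_left _ (AddMonoidAlgebra.single (⟨a ∘ₗ t, hat⟩ : dualMonoid τ) (1 : k)) hI
    rw [mul_sub, AddMonoidAlgebra.single_mul_single, AddMonoidAlgebra.single_mul_single,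
      mul_one] at hI'
    have ea : (⟨a, ha⟩ : dualMonoid τ) = ⟨a ∘ₗ t, hat⟩ +
        dualMonoidMap (coneLattice σ).mkQ (fun _ hv => coneProj_mem hv) a' := Subtype.ext ha'
    have eb : (⟨b, hb⟩ : dualMonoid τ) = ⟨a ∘ₗ t, hat⟩ +
        dualMonoidMap (coneLattice σ).mkQ (fun _ hv => coneProj_mem hv) b' :=
      Subtype.ext (hb'.trans (by rw [← htab]; rfl))
    rw [ea, eb]
    exact hI'

end

section

/-! ### Smoothness of the projection -/

variable {N : Type u} [AddCommGroup N] (k : Type u) [Field k] {L : Submodule ℤ N}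
  {σ τ : PointedCone ℝ (ℝ ⊗[ℤ] N)}

/-- The semigroup ring of ℕ^s × A is the polynomial ring over k[A] in finitely many variables. -/
lemma smooth_mapDomainRingHom_inr (A : Type u) [AddCommMonoid A] (s : Type) [Finite s] :
    (AddMonoidAlgebra.mapDomainRingHom k (AddMonoidHom.inr (s →₀ ℕ) A)).Smooth := by
  let e : AddMonoidAlgebra k ((s →₀ ℕ) × A) ≃+* MvPolynomial s (AddMonoidAlgebra k A) :=
    AddMonoidAlgebra.curryRingEquiv
  have h1 : (algebraMap (AddMonoidAlgebra k A) (MvPolynomial s (AddMonoidAlgebra k A))).Smooth :=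
    RingHom.smooth_algebraMap.2 ⟨inferInstance, inferInstance⟩
  have h2 : e.symm.toRingHom.Smooth := RingHom.Smooth.of_bijective e.symm.bijective
  have h3 (x : AddMonoidAlgebra k A) : algebraMap (AddMonoidAlgebra k A)
      (MvPolynomial s (AddMonoidAlgebra k A)) x = AddMonoidAlgebra.single 0 x := rfl
  have h4 (a : A) (r : k) : e.symm (AddMonoidAlgebra.single 0 (AddMonoidAlgebra.single a r)) =
      AddMonoidAlgebra.single (0, a) r := AddMonoidAlgebra.curryRingEquiv_symm_single _ _ _
  convert h1.comp h2 using 1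
  refine AddMonoidAlgebra.ringHom_ext (fun r => ?_) (fun a => ?_)
  · rw [RingHom.comp_apply, h3]
    refine Eq.trans ?_ (h4 _ _).symm
    simp
  · rw [RingHom.comp_apply, h3]
    refine Eq.trans ?_ (h4 _ _).symm
    simp

/-- The semigroup `τ^∨ ∩ M` is the product of `τ^∨ ∩ σ^⊥ ∩ M` and a free commutative monoid. -/
lemma IsSmoothCone.exists_addEquiv (hτ : IsSmoothCone τ) (h : σ.IsFaceOf τ) :
    ∃ (n : ℕ) (s : Set (Fin n)) (e : (s →₀ ℕ) × dualMonoid (quotientCone σ τ) ≃+ dualMonoid τ),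
      ∀ a, e (0, a) = dualMonoidMap (coneLattice σ).mkQ (fun _ hv => coneProj_mem hv) a := by
  classical
  obtain ⟨n, b, s₀, rfl⟩ := hτ
  have hσ := eq_hull_of_isFaceOf b s₀ h
  set s : Set (Fin n) := {i | i ∈ s₀ ∧ (1 : ℝ) ⊗ₜ[ℤ] b i ∈ σ} with hs
  have hbs (i : s) : b i ∈ coneLattice σ := Submodule.subset_span i.2.2
  have hσs (m : N) (hm : m ∈ coneLattice σ) : ∀ i, i ∉ s → b.repr m i = 0 := by
    rw [hσ] at hm
    exact (mem_coneLattice b s m).1 hm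
  have hss₀ : s ⊆ s₀ := fun i hi => hi.1
  have hbσ (i : s) : (1 : ℝ) ⊗ₜ[ℤ] b i ∈ σ := i.2.2
  clear_value s
  have hcoord (i : s) : b.coord i ∈
      dualMonoid (PointedCone.hull ℝ ((fun i => (1 : ℝ) ⊗ₜ[ℤ] b i) '' s₀)) := by
    intro v hv
    rw [mem_hull_basis] at hv
    rw [realEval_eq_sum b]
    refine Finset.sum_nonneg fun j _ => mul_nonneg (hv.1 j) ?_
    rw [b.coord_apply, b.repr_self, Finsupp.single_apply]
    split_ifs <;> simp
  -- The free factor is generated by the coordinate functions dual to the generators of σ; they lie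
  -- in τ^∨, and evaluation on those generators recovers the exponents.
  let f : (s →₀ ℕ) × dualMonoid (quotientCone σ _) →+
      dualMonoid (PointedCone.hull ℝ ((fun i => (1 : ℝ) ⊗ₜ[ℤ] b i) '' s₀)) :=
    AddMonoidHom.coprod
      (Finsupp.liftAddHom fun i : s => (multiplesHom _ ⟨b.coord i, hcoord i⟩ : ℕ →+ _))
      (dualMonoidMap (coneLattice σ).mkQ fun _ hv => coneProj_mem hv)
  have hf (c : s →₀ ℕ) (a) :
      (f (c, a)).1 = ∑ i, (c i : ℤ) • b.coord i + a.1 ∘ₗ (coneLattice σ).mkQ := by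
    simp only [f, AddMonoidHom.coprod_apply, Finsupp.liftAddHom_apply]
    rw [Finsupp.sum_fintype _ _ (by simp)]
    simp
    rfl
  have hfb (c : s →₀ ℕ) (a) (i : s) : (f (c, a)).1 (b i) = c i := by
    have h0 : (coneLattice σ).mkQ (b i) = 0 := by
      rw [Submodule.mkQ_apply, Submodule.Quotient.mk_eq_zero]
      exact hbs i
    rw [hf, LinearMap.add_apply, LinearMap.comp_apply, h0, map_zero, add_zero,
      LinearMap.sum_apply, Finset.sum_eq_single i]
    · simp
    · intro j _ hj
      have : (j : Fin n) ≠ i := fun h => hj (Subtype.ext h)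
      simp [this.symm]
    · simp
  have hbij : Function.Bijective f := by
    constructor
    · rintro ⟨c, a⟩ ⟨c', a'⟩ hcc
      have hc : c = c' := by
        ext i
        have h1 := hfb c a i
        rw [hcc, hfb] at h1
        exact_mod_cast h1.symm
      subst hc
      refine Prod.ext rfl (Subtype.ext (Submodule.linearMap_qext _ ?_))
      have h1 := hf c a
      rw [hcc, hf] at h1
      exact (add_left_cancel h1).symm
    · rintro ⟨a, ha⟩
      have hpos (i : Fin n) (hi : i ∈ s₀) : 0 ≤ a (b i) := by
        have := ha _ (Submodule.subset_span ⟨i, hi, rfl⟩)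
        simpa using this
      -- The part of `a` carried by the generators of σ. Its coefficients are nonnegative since
      -- these are generators of τ, so `toNat` loses nothing, and a − u vanishes on N_σ.
      let u : Module.Dual ℤ N := ∑ i : s, ((a (b i)).toNat : ℤ) • b.coord i
      have hu (j : Fin n) : u (b j) = if j ∈ s then a (b j) else 0 := by
        simp only [u, LinearMap.sum_apply, LinearMap.smul_apply, Module.Basis.coord_apply,
          Module.Basis.repr_self, smul_eq_mul]
        split_ifs with hj
        · rw [Finset.sum_eq_single ⟨j, hj⟩]
          · rw [Finsupp.single_eq_same, mul_one, Int.toNat_of_nonneg (hpos j (hss₀ hj))]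
          · intro i _ hi
            have : (i : Fin n) ≠ j := fun h => hi (Subtype.ext h)
            rw [Finsupp.single_eq_of_ne this, mul_zero]
          · simp
        · refine Finset.sum_eq_zero fun i _ => ?_
          have : (i : Fin n) ≠ j := by
            rintro rfl
            exact hj i.2
          rw [Finsupp.single_eq_of_ne this, mul_zero]
      have hker : coneLattice σ ≤ LinearMap.ker (a - u) := by
        intro m hm
        rw [LinearMap.mem_ker, ← b.sum_repr m, map_sum]
        refine Finset.sum_eq_zero fun i _ => ?_
        rw [map_smul, LinearMap.sub_apply, hu]
        split_ifs with hi
        · rw [sub_self, smul_zero]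
        · rw [hσs m hm i hi, zero_smul]
      have hq : (coneLattice σ).liftQ (a - u) hker ∘ₗ (coneLattice σ).mkQ = a - u :=
        Submodule.liftQ_mkQ _ _ _
      refine ⟨(Finsupp.equivFunOnFinite.symm fun i => (a (b i)).toNat,
        ⟨(coneLattice σ).liftQ (a - u) hker, ?_⟩), Subtype.ext ?_⟩
      · rintro _ ⟨v, hv, rfl⟩
        have h5 := realEval_comp (coneLattice σ).mkQ ((coneLattice σ).liftQ (a - u) hker) v
        refine le_of_le_of_eq ?_ h5
        rw [hq, realEval_eq_sum b]
        have hv' := (mem_hull_basis b s₀ v).1 hv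
        refine Finset.sum_nonneg fun j _ => ?_
        by_cases hj : j ∈ s₀
        · refine mul_nonneg (hv'.1 j) ?_
          rw [LinearMap.sub_apply, hu]
          split_ifs
          · simp
          · simpa using hpos j hj
        · rw [hv'.2 j hj, zero_mul]
      · rw [hf]
        simp only [hq]
        exact add_sub_cancel u a
  refine ⟨n, s, AddEquiv.ofBijective f hbij, fun a => Subtype.ext ((hf 0 a).trans ?_)⟩
  simp [dualMonoidMap]

lemma smooth_quotientChartMap (hτ : IsSmoothCone τ) (h : σ.IsFaceOf τ) :
    Smooth (quotientChartMap k σ τ) := by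
  obtain ⟨n, s, e, he⟩ := hτ.exists_addEquiv h
  rw [quotientChartMap, toricChartMap, HasRingHomProperty.Spec_iff (P := @Smooth.{u})]
  have h1 := smooth_mapDomainRingHom_inr k (dualMonoid (quotientCone σ τ)) s
  have h2 : (AddMonoidAlgebra.mapDomainRingHom k e.toAddMonoidHom).Smooth :=
    RingHom.Smooth.of_bijective ⟨AddMonoidAlgebra.mapDomain_injective e.injective,
      mapDomainRingHom_surjective k _ e.surjective⟩
  have h0 : e (0, 0) = 0 := map_zero e
  have heq : AddMonoidAlgebra.mapDomainRingHom k
      (dualMonoidMap (coneLattice σ).mkQ fun _ hv => coneProj_mem hv) =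
      (AddMonoidAlgebra.mapDomainRingHom k e.toAddMonoidHom).comp
        (AddMonoidAlgebra.mapDomainRingHom k (AddMonoidHom.inr _ _)) := by
    refine AddMonoidAlgebra.ringHom_ext (fun r => ?_) (fun a => ?_)
    · simp [h0]
    · simp [he]
  rw [CommRingCat.hom_ofHom]
  change RingHom.Smooth (AddMonoidAlgebra.mapDomainRingHom k
      (dualMonoidMap (coneLattice σ).mkQ fun _ hv => coneProj_mem hv))
  rw [heq]
  exact h1.comp h2

lemma SmoothFan.smooth_starProjection (S : SmoothFan N) (hσ : σ ∈ S.cones) :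
    Smooth (S.starProjection k σ hσ) := by
  have : IsZariskiLocalAtSource (@AlgebraicGeometry.Smooth.{u}) :=
    HasRingHomProperty.instIsZariskiLocalAtSource (P := @AlgebraicGeometry.Smooth.{u})
      (Q := RingHom.Smooth)
  refine IsZariskiLocalAtSource.of_openCover (P := @Smooth.{u}) (S.starCover k σ)
    fun (τ : {τ // τ ∈ S.cones ∧ σ ≤ τ}) => ?_
  have h1 := S.chartToStarOpen_starProjection k σ τ.1 hσ τ.2.1 τ.2.2
  change Smooth (S.chartToStarOpen k σ τ.1 τ.2.1 τ.2.2 ≫ _)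
  rw [h1]
  have := smooth_quotientChartMap k (S.smooth τ.1 τ.2.1) (S.isFaceOf_of_le hσ τ.2.1 τ.2.2)
  infer_instance

end

section

/-! ### The closure of a subtorus and the orbit closures -/

variable {N : Type u} [AddCommGroup N] (k : Type u) [Field k] {L : Submodule ℤ N}
  {σ τ : PointedCone ℝ (ℝ ⊗[ℤ] N)}

/-- N_σ ⊆ L, so the lattice generated by the points of σ is the same computed in L or in N. -/
lemma quotientLatticeMap_injective [Module.Finite ℤ N] (hL : IsPrimitive L)
    (hσL : σ ≤ PointedCone.ofSubmodule (realSpan L)) :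
    Function.Injective (quotientLatticeMap L σ) := by
  rw [← LinearMap.ker_eq_bot, LinearMap.ker_eq_bot']
  intro x hx
  obtain ⟨x, rfl⟩ := Submodule.mkQ_surjective _ x
  have h1 : (x : N) ∈ coneLattice σ := (Submodule.Quotient.mk_eq_zero _).1 hx
  have h2 : coneLattice σ ≤ (coneLattice (restrictCone L σ)).map L.subtype := by
    refine Submodule.span_le.2 fun n hn => ?_
    exact ⟨⟨n, coneLattice_le hL hσL (Submodule.subset_span hn)⟩, Submodule.subset_span hn, rfl⟩
  obtain ⟨y, hy, hyx⟩ := h2 h1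
  obtain rfl : y = x := Subtype.ext hyx
  exact (Submodule.Quotient.mk_eq_zero _).2 hy

lemma range_quotientLatticeMap (L : Submodule ℤ N) (σ : PointedCone ℝ (ℝ ⊗[ℤ] N)) :
    LinearMap.range (quotientLatticeMap L σ) = L.map (coneLattice σ).mkQ := by
  ext y
  constructor
  · rintro ⟨x, rfl⟩
    obtain ⟨x, rfl⟩ := Submodule.mkQ_surjective _ x
    exact ⟨x, x.2, rfl⟩
  · rintro ⟨x, hx, rfl⟩
    exact ⟨(coneLattice (restrictCone L σ)).mkQ ⟨x, hx⟩, rfl⟩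

lemma IsSmoothCone.quotientCone_self (hσ : IsSmoothCone σ) : quotientCone σ σ = ⊥ := by
  refine eq_bot_iff.2 ?_
  rintro _ ⟨v, hv, rfl⟩
  exact hσ.coneProj_eq_zero hv

/-- The subtorus of `L / N_σ` in the affine toric variety of the zero cone. -/
lemma exists_isPullback_torusToChart [Module.Finite ℤ N] (hL : IsPrimitive L)
    (hσ : IsSmoothCone σ) (hσL : σ ≤ PointedCone.ofSubmodule (realSpan L)) :
    ∃ u, IsPullback u (subtorusInclusion k (L.map (coneLattice σ).mkQ))
      (toricChartMap k (quotientLatticeMap L σ) (quotientLatticeMap_maps L σ σ))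
      (torusToChart k (quotientCone σ σ)) := by
  let e := (LinearEquiv.ofEq _ _ (range_quotientLatticeMap L σ).symm).trans
    (LinearEquiv.ofInjective _ (quotientLatticeMap_injective hL hσL)).symm
  have he : quotientLatticeMap L σ ∘ₗ e.toLinearMap =
      (L.map (coneLattice σ).mkQ).subtype := by
    ext x
    exact congrArg Subtype.val ((LinearEquiv.ofInjective (quotientLatticeMap L σ)
      (quotientLatticeMap_injective hL hσL)).apply_symm_apply
        (LinearEquiv.ofEq _ _ (range_quotientLatticeMap L σ).symm x))
  have h1 := isIso_torusMap k e
  have h2 := isIso_torusToChart k hσ.quotientCone_self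
  have h3 := isIso_torusToChart k (hσ.restrict hL hσL).quotientCone_self
  refine ⟨torusMap k e.toLinearMap ≫ torusToChart k _, IsPullback.of_horiz_isIso ⟨?_⟩⟩
  rw [Category.assoc, torusToChart_toricChartMap, ← Category.assoc, torusMap_comp, he]
  rfl

/-! ### Global cartesian squares -/

variable (S : SmoothFan N) (hL : IsPrimitive L) (hE : PropertyE S L) (hσ : σ ∈ S.cones)
  (hσL : σ ≤ PointedCone.ofSubmodule (realSpan L))

/-- `orbitInclusion` factors through the quotient chart of σ and then U_σ; the three cartesian
squares over these steps are pasted. -/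
lemma SmoothFan.exists_isPullback_orbitInclusion [Module.Finite ℤ N] (S : SmoothFan N)
    (hL : IsPrimitive L) (hE : PropertyE S L) (hσ : σ ∈ S.cones)
    (hσL : σ ≤ PointedCone.ofSubmodule (realSpan L)) :
    ∃ f, IsPullback f (subtorusInclusion k (L.map (coneLattice σ).mkQ))
      (S.subtorusClosure k L).subschemeι (S.orbitInclusion k σ hσ) := by
  obtain ⟨g, hg⟩ := S.exists_isPullback_subtorusClosure k hL hE hσ
  obtain ⟨u, hu⟩ := exists_isPullback_torusToChart k hL (S.smooth σ hσ) hσL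
  have hp := isPullback_perpChartMap k (S.smooth σ hσ) hL (hE σ hσ) (S.smooth σ hσ) le_rfl hσL
  exact ⟨_, hu.paste_horiz (hp.paste_horiz hg)⟩

/-- The morphism `X_{S'^σ} → X_{S^σ}` on the affine charts of a cone `τ ⊇ σ`. -/
lemma SmoothFan.isPullback_inducedStarInclusion (hτ : τ ∈ S.cones ∧ σ ≤ τ) :
    IsPullback (((S.induced L hL hE).star _ (S.restrictCone_mem L hL hE hσ)).chart k
        (quotientCone (restrictCone L σ) (restrictCone L τ))
        ((S.induced L hL hE).quotientCone_mem_star (S.restrictCone_mem L hL hE hσ)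
          ⟨S.restrictCone_mem L hL hE hτ.1, restrictCone_mono L hτ.2⟩))
      (toricChartMap k (quotientLatticeMap L σ) (quotientLatticeMap_maps L σ τ))
      (S.inducedStarInclusion k L hL hE σ hσ hσL)
      ((S.star σ hσ).chart k (quotientCone σ τ) (S.quotientCone_mem_star hσ hτ)) :=
  SmoothFan.isPullback_toricMap k _ _ _ (S.quotientLatticeMap_cone L hL hE σ hσ hσL) _ _
    (mem_quotientCone_restrictCone hL (S.smooth σ hσ) hτ.2 hσL)

lemma SmoothFan.isClosedImmersion_inducedStarInclusion :
    IsClosedImmersion (S.inducedStarInclusion k L hL hE σ hσ hσL) :=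
  isClosedImmersion_of_isPullback _ (S.starChartCover k hσ)
    fun (τ : {τ // τ ∈ S.cones ∧ σ ≤ τ}) =>
      ⟨_, _, _, S.isPullback_inducedStarInclusion k hL hE hσ hσL τ.2,
        isClosedImmersion_toricChartMap k _ _ (dualMonoidMap_quotientLatticeMap_surjective
          (S.smooth τ.1 τ.2.1) hL (hE τ.1 τ.2.1) (S.smooth σ hσ) hσL)⟩

lemma SmoothFan.exists_isPullback_starInclusion :
    ∃ g, IsPullback g (S.inducedStarInclusion k L hL hE σ hσ hσL)
      (S.subtorusClosure k L).subschemeι (S.starInclusion k σ hσ) := by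
  refine exists_isPullback_of_openCover _ _ _ (S.starChartCover k hσ)
    fun (τ : {τ // τ ∈ S.cones ∧ σ ≤ τ}) => ?_
  obtain ⟨g, hg⟩ := S.exists_isPullback_subtorusClosure k hL hE τ.2.1
  have hp := isPullback_perpChartMap k (S.smooth τ.1 τ.2.1) hL (hE τ.1 τ.2.1) (S.smooth σ hσ)
    τ.2.2 hσL
  have h1 := hp.paste_horiz hg
  -- The pasted square lies over the composite through U_τ; rewritten through X_{S^σ}, it is the
  -- local form required for gluing.
  rw [← S.chart_starInclusion k hσ τ.2] at h1
  exact ⟨_, _, _, _, S.isPullback_inducedStarInclusion k hL hE hσ hσL τ.2, h1⟩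

lemma SmoothFan.exists_isPullback_starProjection :
    ∃ q, IsPullback q ((S.subtorusClosure k L).subschemeι ∣_ S.starOpen k σ)
      (S.inducedStarInclusion k L hL hE σ hσ hσL) (S.starProjection k σ hσ) := by
  have := S.isClosedImmersion_inducedStarInclusion k hL hE hσ hσL
  refine exists_isPullback_of_openCover _ _ _ (S.starCover k σ)
    fun (τ : {τ // τ ∈ S.cones ∧ σ ≤ τ}) => ?_
  obtain ⟨g, hg⟩ := S.exists_isPullback_subtorusClosure k hL hE τ.2.1
  have hr := (isPullback_morphismRestrict (S.subtorusClosure k L).subschemeι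
    (S.starOpen k σ)).flip
  have hι := S.chartToStarOpen_ι k σ τ.1 τ.2.1 τ.2.2
  have hw : g ≫ (S.subtorusClosure k L).subschemeι =
      (toricChartMap k L.subtype (restrictCone_maps L τ.1) ≫
        S.chartToStarOpen k σ τ.1 τ.2.1 τ.2.2) ≫ (S.starOpen k σ).ι := by
    rw [Category.assoc, hι, hg.w]
  have hp := isPullback_quotientChartMap k (S.smooth τ.1 τ.2.1) hL (hE τ.1 τ.2.1)
    (S.isFaceOf_of_le hσ τ.2.1 τ.2.2) (S.smooth σ hσ) hσL
  have h1 := hp.paste_horiz (S.isPullback_inducedStarInclusion k hL hE hσ hσL τ.2)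
  rw [← S.chartToStarOpen_starProjection k σ τ.1 hσ τ.2.1 τ.2.2] at h1
  -- The square over U_τ → U^σ is obtained from the one over U_τ → X by cancelling the square that
  -- defines the restriction of X' to U^σ.
  refine ⟨_, hr.lift _ _ hw, _, _, IsPullback.of_right ?_ (hr.lift_snd _ _ _) hr, h1⟩
  rw [← hι] at hg
  rwa [hr.lift_fst]

end

end ToricGeometry

theorem mainTheorem7
    (k : Type u) [Field k] [IsAlgClosed k] [CharZero k]
    (N : Type u) [AddCommGroup N] [Module.Free ℤ N] [Module.Finite ℤ N]
    (S : SmoothFan N) (hcomplete : S.IsComplete) (hprojective : S.IsProjective)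
    (L : Submodule ℤ N) (hL : IsPrimitive L) (hE : PropertyE S L)
    (σ : PointedCone ℝ (ℝ ⊗[ℤ] N)) (hσ : σ ∈ S.cones)
    (hσL : σ ≤ PointedCone.ofSubmodule (realSpan L)) :
    -- the sublattice `L / N_σ ⊆ N / N_σ` is primitive, hence defines a subtorus `T'^σ ⊆ T^σ`
    IsPrimitive (L.map (coneLattice σ).mkQ) ∧
    -- `X' ∩ D_σ^∘ = T'^σ` inside `D_σ^∘ = T^σ`
    (∃ f : torus k (L.map (coneLattice σ).mkQ) ⟶ (S.subtorusClosure k L).subscheme,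
      IsPullback f (subtorusInclusion k (L.map (coneLattice σ).mkQ))
        (S.subtorusClosure k L).subschemeι (S.orbitInclusion k σ hσ)) ∧
    -- `T'^σ` has property (E) with respect to `S^σ`
    PropertyE (S.star σ hσ) (L.map (coneLattice σ).mkQ) ∧
    -- `X' ∩ D_σ = X_{S'^σ}` under the identification `e : X_{S^σ} ≅ D_σ`
    (∃ e : (S.star σ hσ).toricVariety k ≅ (S.orbitClosure k σ hσ).subscheme,
      e.hom ≫ (S.orbitClosure k σ hσ).subschemeι = S.starInclusion k σ hσ ∧
      ∃ g : ((S.induced L hL hE).star (restrictCone L σ)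
          (S.restrictCone_mem L hL hE hσ)).toricVariety k ⟶ (S.subtorusClosure k L).subscheme,
        IsPullback g (S.inducedStarInclusion k L hL hE σ hσ hσL ≫ e.hom)
          (S.subtorusClosure k L).subschemeι (S.orbitClosure k σ hσ).subschemeι) ∧
    -- the projection `U^σ → X_{S^σ}` is smooth, and `X' ∩ U^σ` is the preimage of `X_{S'^σ}`
    Smooth (S.starProjection k σ hσ) ∧
    ∃ q : ((S.subtorusClosure k L).subschemeι ⁻¹ᵁ S.starOpen k σ).toScheme ⟶
        ((S.induced L hL hE).star (restrictCone L σ)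
          (S.restrictCone_mem L hL hE hσ)).toricVariety k,
      IsPullback q ((S.subtorusClosure k L).subschemeι ∣_ S.starOpen k σ)
        (S.inducedStarInclusion k L hL hE σ hσ hσL) (S.starProjection k σ hσ) := by
  refine ⟨isPrimitive_map_mkQ hL hσL, S.exists_isPullback_orbitInclusion k hL hE hσ hσL,
    S.propertyE_star hE hσ hσL, ?_, S.smooth_starProjection k hσ,
    S.exists_isPullback_starProjection k hL hE hσ hσL⟩
  obtain ⟨e, he⟩ := S.exists_iso_orbitClosure k hσ
  obtain ⟨g, hg⟩ := S.exists_isPullback_starInclusion k hL hE hσ hσL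
  -- Only one corner of the square changes: X_{S^σ} is replaced by D_σ along `e`.
  refine ⟨e, he, g, hg.of_iso (Iso.refl _) (Iso.refl _) e (Iso.refl _) ?_ ?_ ?_ ?_⟩ <;>
    simp [he]
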